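/- **Conventions.** Let $R$ be a commutative ring with $1$. Graded algebras $A=\bigoplus_{n\ge 0}A_n$ are non-negatively graded, associative, unital; $A\otimes B$ carries the Koszul product $(a\otimes b)(a'\otimes b')=(-1)^{|b||a'|}aa'\otimes bb'$. A dga $(A,d)$ has a derivation $d$ of degree $-1$ with $d^2=0$. An *$(f,g)$-derivation homotopy* between dga maps $f,g:A\to B$ is a linear map $s$ of degree $1$ with $sd+ds=f-g$ and $s(xy)=(-1)^{|x|}f(x)s(y)+s(x)g(y)$; $f\simeq g$ (derivation homotopic) denotes the equivalence relation that this generates. A *graded Hopf algebra* is a graded algebra $H$ with a coassociative coproduct $\Delta_H:H\to H\otimes H$ that is a map of graded algebras and has a counit (no antipode is required). A *Hopf algebra up to homotopy* (Hah) is a triple $(A,d,\psi)$ with $(A,d)$ a dga that is flat over $R$ and $\psi:A\to A\otimes A$ a dga map with a (strict) counit $A\to R$, coassociative and cocommutative up to $\simeq$. A morphism of Hah's $f:(A,\psi_A)\to(B,\psi_B)$ is a dga map with $\psi_B f\simeq (f\otimes f)\psi_A$. It is a weak equivalence if it induces an isomorphism in homology. $A$ and $B$ have the same weak homotopy type if they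 are related by (a chain of) weak equivalences of Hah's $A\leftarrow C\to B$. **Setting.** Let $H$ be a graded Hopf algebra that is flat over $R$ (over a principal ideal domain: torsion free). Let $\Omega_H$ be the set of weak homotopy types of Hah's $A$ with $H(A)\cong H$ as graded algebras with coproduct (compatibly with the Künneth map $H(A)\otimes H(A)\to H(A\otimes A)$). Fix a Hopf resolution $\rho:(RH,d,\Delta)\to H$: a Hah that is bigraded by the resolution degree $q\ge 0$ ($RH=\bigoplus_q R_qH$) and the total degree, free as an algebra on a set of bihomogeneous generators, with $d(R_{q}H)\subset R_{q-1}H$, $d(R_0H)=0$, $\Delta(R_qH)\subset\bigoplus_{i+j=q}R_iH\otimes R_jH$, together with a dga map $\rho$ to $(H,0)$ that vanishes on $R_qH$ for $q>0$, preserves the coproducts strictly and induces an isomorphism in homology. Let $M_H$ be the set of pairs $(h,\nu)$ of linear maps $h:RH\to RH$, $\nu:RH\to RH\otimes RH$ with $h(R_qH)\subset\bigoplus_{i\le q-2}R_iH$, $\nu(R_qH)\subset\bigoplus_{i+j\le q-1}R_iH\otimes R_jH$, such that $(RH,d_h,\Delta_\nu)$ is a Hah, where $d_h=d+h$ and $\Delta_\nu=\Delta+\nu$.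 Let $G_H$ be the group of pairs $(p,s)$, where $p$ is an automorphism of the graded algebra $RH$ such that $p-1$ lowers the resolution degree by at least $1$ and $s:RH\to RH\otimes RH$ is linear of degree $1$, with $(p,s)(p',s')=(pp',(p'^{-1}\otimes p'^{-1})sp'+s')$. It acts by $(h,\nu)*(p,s)=(\bar h,\bar\nu)$, where $$d_{\bar h}=p^{-1}d_hp,\qquad \Delta_{\bar\nu}=(p^{-1}\otimes p^{-1})\Delta_\nu p+s\,d_{\bar h}+(d_{\bar h}\otimes 1+1\otimes d_{\bar h})s .$$ Let $D_H$ be the quotient of $M_H$ by the equivalence relation generated by $(h,\nu)\sim(h,\nu)*(p,s)$ for those $(p,s)$ for which $(h,\nu)*(p,s)$ is in $M_H$ and $s$ is a $(\Delta_{\bar\nu},(p^{-1}\otimes p^{-1})\Delta_\nu p)$-derivation homotopy for $d_{\bar h}$. **Theorem 5.2.** There is an action of the group $\mathrm{Aut}\,H$ of automorphisms of the graded Hopf algebra $H$ on $D_H$, determined as follows: $\alpha\cdot[(h,\nu)]=[(h',\nu')]$ if and only if there is a morphism of Hah's $k:(RH,d_h,\Delta_\nu)\to(RH,d_{h'},\Delta_{\nu'})$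 that induces $\alpha$ in homology, that is, for all $x\in R_0H$ there is $y\in R_0H$ with $\rho(y)=\alpha(\rho(x))$ and $k(x)-y\in\operatorname{im}d_{h'}$. Every $(RH,d_h,\Delta_\nu)$ with $(h,\nu)\in M_H$ has homology isomorphic to $H$, and assigning to $(h,\nu)$ the weak homotopy type of $(RH,d_h,\Delta_\nu)$ induces a bijection $$D_H/\mathrm{Aut}\,H\;\approx\;\Omega_H .$$ -/

import Mathlib

open scoped TensorProduct DirectSum

universe u v w

noncomputable section

namespace HopfPert

/-! ### The Koszul tensor product of nonnegatively graded algebras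

Throughout, a graded algebra is an `R`-algebra `A` with an internal grading `𝒜 : ℕ → Submodule R A`.
The algebra `𝒜 ᵍ⊗[R] ℬ` is Mathlib's graded tensor product, that is, `A ⊗ B` with
`(a ⊗ b) (a' ⊗ b') = (-1) ^ (|b| |a'|) a a' ⊗ b b'`. Mathlib does not provide its grading, so this
is supplied here. -/

section Tensor

variable {R : Type u} [CommRing R]
variable {A : Type v} {B : Type w} [Ring A] [Ring B] [Algebra R A] [Algebra R B]
variable (𝒜 : ℕ → Submodule R A) [GradedAlgebra 𝒜] (ℬ : ℕ → Submodule R B) [GradedAlgebra ℬ]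

/-- The submodule `∑_{i + j = n} P i ⊗ Q j` of the graded tensor product. -/
def tensorDeg (P : ℕ → Submodule R A) (Q : ℕ → Submodule R B) (n : ℕ) :
    Submodule R (𝒜 ᵍ⊗[R] ℬ) :=
  Submodule.span R {t | ∃ i j, i + j = n ∧ ∃ a ∈ P i, ∃ b ∈ Q j, t = a ᵍ⊗ₜ[R] b}

/-- The (total) grading of the tensor product of two graded algebras. -/
abbrev tensorGr : ℕ → Submodule R (𝒜 ᵍ⊗[R] ℬ) := tensorDeg 𝒜 ℬ 𝒜 ℬ

theorem tmul_mem {P : ℕ → Submodule R A} {Q : ℕ → Submodule R B} {i j : ℕ} {a : A} {b : B}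
    (ha : a ∈ P i) (hb : b ∈ Q j) : (a ᵍ⊗ₜ[R] b : 𝒜 ᵍ⊗[R] ℬ) ∈ tensorDeg 𝒜 ℬ P Q (i + j) :=
  Submodule.subset_span ⟨i, j, rfl, a, ha, b, hb, rfl⟩

instance tensorGradedMonoid : SetLike.GradedMonoid (tensorGr 𝒜 ℬ) where
  one_mem := Submodule.subset_span
    ⟨0, 0, rfl, 1, SetLike.one_mem_graded 𝒜, 1, SetLike.one_mem_graded ℬ, rfl⟩
  mul_mem := by
    intro m n x y hx hy
    induction hx using Submodule.span_induction with
    | zero => simp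
    | add x x' _ _ h h' => rw [add_mul]; exact Submodule.add_mem _ h h'
    | smul r x _ h => rw [smul_mul_assoc]; exact Submodule.smul_mem _ r h
    | mem x hx =>
      obtain ⟨i, j, rfl, a, ha, b, hb, rfl⟩ := hx
      induction hy using Submodule.span_induction with
      | zero => simp
      | add x x' _ _ h h' => rw [mul_add]; exact Submodule.add_mem _ h h'
      | smul r x _ h => rw [mul_smul_comm]; exact Submodule.smul_mem _ r h
      | mem y hy =>
        obtain ⟨k, l, rfl, a', ha', b', hb', rfl⟩ := hy
        have key := GradedTensorProduct.tmul_coe_mul_coe_tmul (R := R) 𝒜 ℬ a ⟨b, hb⟩ ⟨a', ha'⟩ b'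
        have hm := tmul_mem 𝒜 ℬ (SetLike.GradedMul.mul_mem ha ha')
          (SetLike.GradedMul.mul_mem hb hb')
        have e : i + j + (k + l) = i + k + (j + l) := by omega
        rw [e]
        refine key ▸ ?_
        rcases Int.units_eq_one_or ((-1 : ℤˣ) ^ (j * k)) with h | h
        · rw [h, one_smul]; exact hm
        · rw [h, Units.neg_smul, one_smul]; exact Submodule.neg_mem _ hm

/-- The canonical map `𝒜 i ⊗ ℬ j → (A ⊗ B)_{i + j}`. -/
def tensorPiece (i j : ℕ) : 𝒜 i ⊗[R] ℬ j →ₗ[R] tensorGr 𝒜 ℬ (i + j) :=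
  LinearMap.codRestrict _
    ((GradedTensorProduct.of R 𝒜 ℬ).toLinearMap ∘ₗ
      TensorProduct.map (𝒜 i).subtype (ℬ j).subtype)
    (fun t => by
      induction t using TensorProduct.induction_on with
      | zero => simp
      | tmul a b => exact tmul_mem 𝒜 ℬ a.2 b.2
      | add x y hx hy => rw [map_add]; exact Submodule.add_mem _ hx hy)

/-- Decomposition of an element of the tensor product into its homogeneous components. -/
def tensorDecompose : (𝒜 ᵍ⊗[R] ℬ) →ₗ[R] ⨁ n, tensorGr 𝒜 ℬ n :=
  DirectSum.toModule R (ℕ × ℕ) (⨁ n, tensorGr 𝒜 ℬ n)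
    (fun p => DirectSum.lof R ℕ (fun n => tensorGr 𝒜 ℬ n) (p.1 + p.2) ∘ₗ tensorPiece 𝒜 ℬ p.1 p.2)
  ∘ₗ (TensorProduct.directSum R R (fun i => 𝒜 i) (fun j => ℬ j)).toLinearMap
  ∘ₗ (GradedTensorProduct.auxEquiv R 𝒜 ℬ).toLinearMap

theorem tensorDecompose_tmul {i j : ℕ} (a : 𝒜 i) (b : ℬ j) :
    tensorDecompose 𝒜 ℬ ((a : A) ᵍ⊗ₜ[R] (b : B)) =
      DirectSum.lof R ℕ (fun n => tensorGr 𝒜 ℬ n) (i + j)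
        ⟨(a : A) ᵍ⊗ₜ[R] (b : B), tmul_mem 𝒜 ℬ a.2 b.2⟩ := by
  simp only [tensorDecompose, LinearMap.comp_apply, LinearEquiv.coe_coe,
    GradedTensorProduct.auxEquiv_tmul, DirectSum.decompose_coe, ← DirectSum.lof_eq_of R]
  erw [TensorProduct.directSum_lof_tmul_lof]
  rw [DirectSum.toModule_lof]
  rfl

/-- Two linear maps out of the graded tensor product agree if they agree on `a ⊗ b` with `a`, `b`
homogeneous. -/
theorem tensor_ext {M : Type*} [AddCommMonoid M] [Module R M] {f g : (𝒜 ᵍ⊗[R] ℬ) →ₗ[R] M}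
    (h : ∀ i j (a : 𝒜 i) (b : ℬ j), f ((a : A) ᵍ⊗ₜ[R] (b : B)) = g ((a : A) ᵍ⊗ₜ[R] (b : B))) :
    f = g := by
  apply GradedTensorProduct.hom_ext
  apply TensorProduct.ext
  refine DirectSum.decompose_lhom_ext 𝒜 fun i => ?_
  ext a : 1
  refine DirectSum.decompose_lhom_ext ℬ fun j => ?_
  ext b : 1
  exact h i j a b

instance tensorDecomposition : DirectSum.Decomposition (tensorGr 𝒜 ℬ) :=
  DirectSum.Decomposition.ofLinearMap _ (tensorDecompose 𝒜 ℬ)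
    (tensor_ext 𝒜 ℬ fun i j a b => by
      rw [LinearMap.comp_apply, tensorDecompose_tmul, DirectSum.coeLinearMap_lof]
      rfl)
    (by
      ext n ⟨x, hx⟩ : 2
      simp only [LinearMap.comp_apply, DirectSum.coeLinearMap_lof, LinearMap.id_apply]
      induction hx using Submodule.span_induction with
      | mem x hx =>
        obtain ⟨i, j, rfl, a, ha, b, hb, rfl⟩ := hx
        exact tensorDecompose_tmul 𝒜 ℬ ⟨a, ha⟩ ⟨b, hb⟩
      | zero =>
        rw [map_zero]; exact (map_zero (DirectSum.lof R ℕ (fun n => tensorGr 𝒜 ℬ n) n)).symm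
      | add x y hx hy h h' =>
        rw [map_add, h, h', ← map_add]; rfl
      | smul r x hx h =>
        rw [map_smul, h, ← map_smul]; rfl)

instance tensorGradedAlgebra : GradedAlgebra (tensorGr 𝒜 ℬ) where

/-- The parity involution `x ↦ (-1) ^ |x| x`. -/
def parity : A →ₗ[R] A :=
  DirectSum.coeLinearMap 𝒜 ∘ₗ
    DirectSum.lmap (fun n => ((-1 : R) ^ n) • (LinearMap.id : 𝒜 n →ₗ[R] 𝒜 n)) ∘ₗ
    (DirectSum.decomposeLinearEquiv 𝒜).toLinearMap

theorem parity_coe {n : ℕ} (x : 𝒜 n) : parity 𝒜 (x : A) = ((-1 : R) ^ n) • (x : A) := by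
  simp only [parity, LinearMap.comp_apply, LinearEquiv.coe_coe,
    DirectSum.decomposeLinearEquiv_apply, DirectSum.decompose_coe, ← DirectSum.lof_eq_of R]
  rw [DirectSum.lmap_lof, DirectSum.coeLinearMap_lof]
  rfl

variable {𝒜 ℬ} in
/-- `f ⊗ g` for maps of degree zero. -/
def tensorMap {A' : Type*} {B' : Type*} [Ring A'] [Ring B'] [Algebra R A'] [Algebra R B']
    {𝒜' : ℕ → Submodule R A'} [GradedAlgebra 𝒜'] {ℬ' : ℕ → Submodule R B'} [GradedAlgebra ℬ']
    (f : A →ₗ[R] A') (g : B →ₗ[R] B') : (𝒜 ᵍ⊗[R] ℬ) →ₗ[R] (𝒜' ᵍ⊗[R] ℬ') :=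
  (GradedTensorProduct.of R 𝒜' ℬ').toLinearMap ∘ₗ TensorProduct.map f g ∘ₗ
    (GradedTensorProduct.of R 𝒜 ℬ).symm.toLinearMap

/-- The differential `d ⊗ 1 + 1 ⊗ d` of the tensor product:
`a ⊗ b ↦ d a ⊗ b + (-1) ^ |a| a ⊗ d b`. -/
def tensorDiff (dA : A →ₗ[R] A) (dB : B →ₗ[R] B) : (𝒜 ᵍ⊗[R] ℬ) →ₗ[R] (𝒜 ᵍ⊗[R] ℬ) :=
  tensorMap dA LinearMap.id + tensorMap (parity 𝒜) dB

/-- The associativity isomorphism `(A ⊗ A) ⊗ A → A ⊗ (A ⊗ A)`. -/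
def tensorAssoc :
    (tensorGr 𝒜 𝒜 ᵍ⊗[R] 𝒜) →ₗ[R] (𝒜 ᵍ⊗[R] tensorGr 𝒜 𝒜) :=
  (GradedTensorProduct.of R 𝒜 (tensorGr 𝒜 𝒜)).toLinearMap ∘ₗ
    TensorProduct.map LinearMap.id (GradedTensorProduct.of R 𝒜 𝒜).toLinearMap ∘ₗ
    (TensorProduct.assoc R A A A).toLinearMap ∘ₗ
    TensorProduct.map (GradedTensorProduct.of R 𝒜 𝒜).symm.toLinearMap LinearMap.id ∘ₗ
    (GradedTensorProduct.of R (tensorGr 𝒜 𝒜) 𝒜).symm.toLinearMap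

end Tensor

/-! ### Differential graded algebras, derivation homotopies, homology -/

section DGA

variable {R : Type u} [CommRing R]
variable {A : Type v} {B : Type w} [Ring A] [Ring B] [Algebra R A] [Algebra R B]

/-- `(A, d)` is a differential graded algebra, with `d` of degree `-1`. -/
structure IsDGA (𝒜 : ℕ → Submodule R A) (d : A →ₗ[R] A) : Prop where
  map_mem : ∀ n, ∀ x ∈ 𝒜 (n + 1), d x ∈ 𝒜 n
  map_zero_degree : ∀ x ∈ 𝒜 0, d x = 0
  sq_zero : d ∘ₗ d = 0
  leibniz : ∀ n, ∀ x ∈ 𝒜 n, ∀ y, d (x * y) = d x * y + ((-1 : R) ^ n) • (x * d y)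

/-- `f` is a (unital, degree zero) map of differential graded algebras. -/
structure IsDGAMap (𝒜 : ℕ → Submodule R A) (dA : A →ₗ[R] A) (ℬ : ℕ → Submodule R B)
    (dB : B →ₗ[R] B) (f : A →ₗ[R] B) : Prop where
  map_one : f 1 = 1
  map_mul : ∀ x y, f (x * y) = f x * f y
  map_mem : ∀ n, ∀ x ∈ 𝒜 n, f x ∈ ℬ n
  comm : f ∘ₗ dA = dB ∘ₗ f

/-- `s` is an `(f, g)`-derivation homotopy: it has degree `1`, `s d + d s = f - g`, and
`s (x y) = (-1) ^ |x| f x s y + s x g y`. -/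
structure IsDerivationHomotopy (𝒜 : ℕ → Submodule R A) (dA : A →ₗ[R] A) (ℬ : ℕ → Submodule R B)
    (dB : B →ₗ[R] B) (f g s : A →ₗ[R] B) : Prop where
  map_mem : ∀ n, ∀ x ∈ 𝒜 n, s x ∈ ℬ (n + 1)
  homotopy : s ∘ₗ dA + dB ∘ₗ s = f - g
  map_mul : ∀ n, ∀ x ∈ 𝒜 n, ∀ y, s (x * y) = ((-1 : R) ^ n) • (f x * s y) + s x * g y

/-- The equivalence relation on maps of differential graded algebras generated by the existence of
a derivation homotopy (for a free source, a single derivation homotopy always suffices). -/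
def DerivationHomotopic (𝒜 : ℕ → Submodule R A) (dA : A →ₗ[R] A) (ℬ : ℕ → Submodule R B)
    (dB : B →ₗ[R] B) : (A →ₗ[R] B) → (A →ₗ[R] B) → Prop :=
  Relation.EqvGen fun f g => IsDGAMap 𝒜 dA ℬ dB f ∧ IsDGAMap 𝒜 dA ℬ dB g ∧
    ∃ s, IsDerivationHomotopy 𝒜 dA ℬ dB f g s

/-- The homology `ker d / im d`. -/
abbrev Homology (d : A →ₗ[R] A) : Type v :=
  LinearMap.ker d ⧸ (LinearMap.range d).submoduleOf (LinearMap.ker d)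

/-- The homology class of a cycle. -/
abbrev Homology.mk (d : A →ₗ[R] A) : LinearMap.ker d →ₗ[R] Homology d :=
  ((LinearMap.range d).submoduleOf (LinearMap.ker d)).mkQ

/-- The map induced on homology by a chain map. -/
def Homology.map {dA : A →ₗ[R] A} {dB : B →ₗ[R] B} (f : A →ₗ[R] B)
    (hf : f ∘ₗ dA = dB ∘ₗ f) : Homology dA →ₗ[R] Homology dB :=
  Submodule.mapQ _ _
    (f.restrict (p := LinearMap.ker dA) (q := LinearMap.ker dB) (fun x hx => by
      have h := LinearMap.congr_fun hf x
      simp only [LinearMap.comp_apply] at h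
      rw [LinearMap.mem_ker] at hx ⊢
      rw [← h, hx, map_zero]))
    (by
      rintro ⟨x, hx⟩ ⟨y, hy⟩
      refine ⟨f y, ?_⟩
      have h := LinearMap.congr_fun hf y
      simp only [LinearMap.comp_apply] at h
      rw [← h, hy]
      rfl)

/-- `f` is a chain map that induces an isomorphism in homology. -/
def IsWeakEquiv (dA : A →ₗ[R] A) (dB : B →ₗ[R] B) (f : A →ₗ[R] B) : Prop :=
  ∃ hf : f ∘ₗ dA = dB ∘ₗ f, Function.Bijective (Homology.map f hf)

end DGA

/-! ### Hopf algebras and Hopf algebras up to homotopy -/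

section Hah

variable {R : Type u} [CommRing R]

section Predicates

variable {A : Type v} {B : Type w} [Ring A] [Ring B] [Algebra R A] [Algebra R B]
variable (𝒜 : ℕ → Submodule R A) [GradedAlgebra 𝒜] (ℬ : ℕ → Submodule R B) [GradedAlgebra ℬ]

/-- The augmentation `ε` (a map of differential graded algebras to `R`) is a strict two-sided counit
for the coproduct `ψ`. -/
structure IsCounit (d : A →ₗ[R] A) (ψ : A →ₗ[R] (𝒜 ᵍ⊗[R] 𝒜)) (ε : A →ₐ[R] R) : Prop where
  map_pos_degree : ∀ n, n ≠ 0 → ∀ x ∈ 𝒜 n, ε x = 0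
  map_diff : ∀ x, ε (d x) = 0
  left : ∀ x, TensorProduct.lid R A (TensorProduct.map ε.toLinearMap LinearMap.id
    ((GradedTensorProduct.of R 𝒜 𝒜).symm (ψ x))) = x
  right : ∀ x, TensorProduct.rid R A (TensorProduct.map LinearMap.id ε.toLinearMap
    ((GradedTensorProduct.of R 𝒜 𝒜).symm (ψ x))) = x

/-- `(A, Δ)` is a graded Hopf algebra: `Δ` is a map of graded algebras, it is strictly
coassociative and it has a counit. No antipode is required (it exists automatically if `A` is
connected). -/
structure IsGradedHopf (Δ : A →ₗ[R] (𝒜 ᵍ⊗[R] 𝒜)) : Prop where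
  comul : IsDGAMap 𝒜 0 (tensorGr 𝒜 𝒜) 0 Δ
  counit : ∃ ε : A →ₐ[R] R, IsCounit 𝒜 0 Δ ε
  coassoc : tensorAssoc 𝒜 ∘ₗ tensorMap Δ LinearMap.id ∘ₗ Δ = tensorMap LinearMap.id Δ ∘ₗ Δ

/-- `(A, d, ψ)` is a Hopf algebra up to homotopy: `(A, d)` is a differential graded algebra, flat as
an `R`-module, and `ψ : A → A ⊗ A` is a map of differential graded algebras with a counit which is
coassociative and cocommutative up to derivation homotopy. -/
structure IsHah (d : A →ₗ[R] A) (ψ : A →ₗ[R] (𝒜 ᵍ⊗[R] 𝒜)) : Prop where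
  flat : Module.Flat R A
  dga : IsDGA 𝒜 d
  comul : IsDGAMap 𝒜 d (tensorGr 𝒜 𝒜) (tensorDiff 𝒜 𝒜 d d) ψ
  counit : ∃ ε : A →ₐ[R] R, IsCounit 𝒜 d ψ ε
  coassoc : DerivationHomotopic 𝒜 d (tensorGr 𝒜 (tensorGr 𝒜 𝒜))
    (tensorDiff 𝒜 (tensorGr 𝒜 𝒜) d (tensorDiff 𝒜 𝒜 d d))
    (tensorAssoc 𝒜 ∘ₗ tensorMap ψ LinearMap.id ∘ₗ ψ) (tensorMap LinearMap.id ψ ∘ₗ ψ)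
  cocomm : DerivationHomotopic 𝒜 d (tensorGr 𝒜 𝒜) (tensorDiff 𝒜 𝒜 d d)
    ((GradedTensorProduct.comm 𝒜 𝒜).toLinearMap ∘ₗ ψ) ψ

/-- `f` is a morphism of Hopf algebras up to homotopy: a map of differential graded algebras that
commutes with the coproducts up to derivation homotopy. -/
structure IsHahMap (dA : A →ₗ[R] A) (ψA : A →ₗ[R] (𝒜 ᵍ⊗[R] 𝒜)) (dB : B →ₗ[R] B)
    (ψB : B →ₗ[R] (ℬ ᵍ⊗[R] ℬ)) (f : A →ₗ[R] B) : Prop where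
  isDGAMap : IsDGAMap 𝒜 dA ℬ dB f
  comul : DerivationHomotopic 𝒜 dA (tensorGr ℬ ℬ) (tensorDiff ℬ ℬ dB dB)
    (ψB ∘ₗ f) (tensorMap f f ∘ₗ ψA)

/-- `i : H ≃ H(A, d)` is an isomorphism of graded algebras, compatible with the coproduct `Δ` of `H`
and with the map `H(A) → H(A ⊗ A)` induced by `ψ`: the latter sends `i x` to the image of
`(i ⊗ i) (Δ x)` under the Künneth map `H(A) ⊗ H(A) → H(A ⊗ A)`, `[z] ⊗ [z'] ↦ [z ⊗ z']`. -/
structure IsHopfIso (Δ : B →ₗ[R] (ℬ ᵍ⊗[R] ℬ)) (d : A →ₗ[R] A) (ψ : A →ₗ[R] (𝒜 ᵍ⊗[R] 𝒜))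
    (i : B ≃ₗ[R] Homology d) : Prop where
  map_mem : ∀ n, ∀ x ∈ ℬ n, ∃ z : LinearMap.ker d, (z : A) ∈ 𝒜 n ∧ Homology.mk d z = i x
  map_one : ∀ z : LinearMap.ker d, (z : A) = 1 → Homology.mk d z = i 1
  map_mul : ∀ x y, ∀ z z' z'' : LinearMap.ker d, Homology.mk d z = i x → Homology.mk d z' = i y →
    (z'' : A) = z * z' → Homology.mk d z'' = i (x * y)
  map_comul : ∀ x, ∃ (z : LinearMap.ker d) (t : LinearMap.ker d ⊗[R] LinearMap.ker d),
    Homology.mk d z = i x ∧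
    TensorProduct.map (Homology.mk d) (Homology.mk d) t =
      TensorProduct.map i.toLinearMap i.toLinearMap ((GradedTensorProduct.of R ℬ ℬ).symm (Δ x)) ∧
    ψ z - GradedTensorProduct.of R 𝒜 𝒜
        (TensorProduct.map (LinearMap.ker d).subtype (LinearMap.ker d).subtype t) ∈
      LinearMap.range (tensorDiff 𝒜 𝒜 d d)

/-- The group of automorphisms of the graded Hopf algebra `(A, Δ)`. -/
def hopfAut (Δ : A →ₗ[R] (𝒜 ᵍ⊗[R] 𝒜)) : Subgroup (A ≃ₐ[R] A) where
  carrier := {α | (∀ n x, α x ∈ 𝒜 n ↔ x ∈ 𝒜 n) ∧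
    ∀ x, Δ (α x) = tensorMap α.toLinearMap α.toLinearMap (Δ x)}
  one_mem' := by
    refine ⟨fun n x => Iff.rfl, fun x => ?_⟩
    have h : (tensorMap (1 : A ≃ₐ[R] A).toLinearMap (1 : A ≃ₐ[R] A).toLinearMap :
        (𝒜 ᵍ⊗[R] 𝒜) →ₗ[R] (𝒜 ᵍ⊗[R] 𝒜)) = LinearMap.id := tensor_ext 𝒜 𝒜 fun i j a b => rfl
    rw [h]
    rfl
  mul_mem' := by
    rintro α β ⟨hα, hα'⟩ ⟨hβ, hβ'⟩
    refine ⟨fun n x => (hα n (β x)).trans (hβ n x), fun x => ?_⟩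
    have h : (tensorMap (α * β).toLinearMap (α * β).toLinearMap :
        (𝒜 ᵍ⊗[R] 𝒜) →ₗ[R] (𝒜 ᵍ⊗[R] 𝒜)) =
        (tensorMap α.toLinearMap α.toLinearMap : (𝒜 ᵍ⊗[R] 𝒜) →ₗ[R] (𝒜 ᵍ⊗[R] 𝒜)) ∘ₗ
        (tensorMap β.toLinearMap β.toLinearMap : (𝒜 ᵍ⊗[R] 𝒜) →ₗ[R] (𝒜 ᵍ⊗[R] 𝒜)) :=
      tensor_ext 𝒜 𝒜 fun i j a b => rfl
    rw [h, LinearMap.comp_apply, ← hβ', ← hα']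
    rfl
  inv_mem' := by
    rintro α ⟨hα, hα'⟩
    refine ⟨fun n x => ?_, fun x => ?_⟩
    · rw [← hα n (α⁻¹ x)]
      exact (congrArg (· ∈ 𝒜 n) (α.apply_symm_apply x)).to_iff
    · have h : (tensorMap α⁻¹.toLinearMap α⁻¹.toLinearMap :
          (𝒜 ᵍ⊗[R] 𝒜) →ₗ[R] (𝒜 ᵍ⊗[R] 𝒜)) ∘ₗ
          (tensorMap α.toLinearMap α.toLinearMap : (𝒜 ᵍ⊗[R] 𝒜) →ₗ[R] (𝒜 ᵍ⊗[R] 𝒜)) =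
          LinearMap.id :=
        tensor_ext 𝒜 𝒜 fun i j a b => by
          change (α⁻¹ (α (a : A))) ᵍ⊗ₜ[R] (α⁻¹ (α (b : A))) = (a : A) ᵍ⊗ₜ[R] (b : A)
          rw [show α⁻¹ (α (a : A)) = a from α.symm_apply_apply _,
            show α⁻¹ (α (b : A)) = b from α.symm_apply_apply _]
      have hx : x = α (α⁻¹ x) := (α.apply_symm_apply x).symm
      conv_rhs => rw [hx, hα']
      exact (LinearMap.congr_fun h _).symm

end Predicates

/-- The objects of the category of Hopf algebras up to homotopy over `R`. -/
structure Hah (R : Type u) [CommRing R] : Type (max u (v + 1)) where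
  carrier : Type v
  [ring : Ring carrier]
  [algebra : Algebra R carrier]
  gr : ℕ → Submodule R carrier
  [graded : GradedAlgebra gr]
  diff : carrier →ₗ[R] carrier
  comul : carrier →ₗ[R] (gr ᵍ⊗[R] gr)
  isHah : IsHah gr diff comul

attribute [instance] Hah.ring Hah.algebra Hah.graded

/-- `C → A` is a morphism of Hopf algebras up to homotopy and a weak equivalence. -/
def Hah.IsWeakMap (C A : Hah.{u, v} R) (f : C.carrier →ₗ[R] A.carrier) : Prop :=
  IsHahMap C.gr A.gr C.diff C.comul A.diff A.comul f ∧ IsWeakEquiv C.diff A.diff f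

/-- Weak homotopy equivalence: there are weak equivalences `A ← C → B`. -/
def Hah.WeakEquivalent (A B : Hah.{u, v} R) : Prop :=
  ∃ (C : Hah.{u, v} R) (f : C.carrier →ₗ[R] A.carrier) (g : C.carrier →ₗ[R] B.carrier),
    Hah.IsWeakMap C A f ∧ Hah.IsWeakMap C B g

variable {H : Type w} [Ring H] [Algebra R H] (ℋ : ℕ → Submodule R H) [GradedAlgebra ℋ]
variable (ΔH : H →ₗ[R] (ℋ ᵍ⊗[R] ℋ))

/-- The homology of `A` is isomorphic to the graded Hopf algebra `H`. -/
def Hah.HasHomology (A : Hah.{u, v} R) : Prop :=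
  ∃ i : H ≃ₗ[R] Homology A.diff, IsHopfIso A.gr ℋ ΔH A.diff A.comul i

/-- `Ω_H`: the weak homotopy types of Hopf algebras up to homotopy with homology isomorphic to `H`
(the quotient by the equivalence relation generated by weak homotopy equivalence). -/
def WeakTypes : Type (max u (v + 1)) :=
  Quot fun A B : {A : Hah.{u, v} R // A.HasHomology ℋ ΔH} => Hah.WeakEquivalent A.1 B.1

/-- The weak homotopy type of `A`. -/
def WeakTypes.mk (A : Hah.{u, v} R) (hA : A.HasHomology ℋ ΔH) : WeakTypes.{u, v, w} ℋ ΔH :=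
  Quot.mk _ ⟨A, hA⟩

/-! ### Hopf resolutions and their perturbations -/

/-- A Hopf resolution `ρ : (RH, d, Δ) → H`. The grading `gr` is the total one and `res` is the
resolution grading; `RH` is bigraded and free as an algebra on bihomogeneous generators; `d` lowers
the resolution degree by one and `Δ` preserves it. -/
structure HopfResolution : Type (max u w (v + 1)) where
  carrier : Type v
  [ring : Ring carrier]
  [algebra : Algebra R carrier]
  gr : ℕ → Submodule R carrier
  [graded : GradedAlgebra gr]
  res : ℕ → Submodule R carrier
  [resGraded : GradedAlgebra res]
  diff : carrier →ₗ[R] carrier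
  comul : carrier →ₗ[R] (gr ᵍ⊗[R] gr)
  ρ : carrier →ₐ[R] H
  bigraded : ∀ n, ∀ x ∈ gr n, ∀ q, (DirectSum.decompose res x q : carrier) ∈ gr n
  free : ∃ (X : Type v) (x : X → carrier), (∀ i, ∃ q n, x i ∈ res q ∧ x i ∈ gr n) ∧
    Function.Bijective (FreeAlgebra.lift R x)
  isHah : IsHah gr diff comul
  diff_res : ∀ q, ∀ x ∈ res (q + 1), diff x ∈ res q
  diff_res_zero : ∀ x ∈ res 0, diff x = 0
  comul_res : ∀ q, ∀ x ∈ res q, comul x ∈ tensorDeg gr gr res res q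
  ρ_res : ∀ q, q ≠ 0 → ∀ x ∈ res q, ρ x = 0
  ρ_map : IsDGAMap gr diff ℋ 0 ρ.toLinearMap
  ρ_comul : tensorMap ρ.toLinearMap ρ.toLinearMap ∘ₗ comul = ΔH ∘ₗ ρ.toLinearMap
  ρ_weak : IsWeakEquiv diff (0 : H →ₗ[R] H) ρ.toLinearMap

attribute [instance] HopfResolution.ring HopfResolution.algebra HopfResolution.graded
  HopfResolution.resGraded

namespace HopfResolution

variable {ℋ ΔH} (S : HopfResolution.{u, v, w} ℋ ΔH)

/-- The elements of resolution degree less than `q`. -/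
def below (q : ℕ) : Submodule R S.carrier := ⨆ i, ⨆ _ : i < q, S.res i

/-- The set `M_H`: perturbations `(h, ν)` of `(RH, d, Δ)`. Here `h` lowers the resolution degree by
at least two, `ν` lowers it by at least one, and `(RH, d + h, Δ + ν)` is a Hopf algebra up to
homotopy (so that `h` is a derivation of degree `-1` with `(d + h)² = 0`, `Δ + ν` is an algebra map
of degree zero and `d + h` is a coderivation for it). -/
structure Perturbation where
  h : S.carrier →ₗ[R] S.carrier
  ν : S.carrier →ₗ[R] (S.gr ᵍ⊗[R] S.gr)
  h_res : ∀ q, ∀ x ∈ S.res q, h x ∈ ⨆ i, ⨆ _ : i + 2 ≤ q, S.res i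
  ν_res : ∀ q, ∀ x ∈ S.res q, ν x ∈ ⨆ i, ⨆ _ : i + 1 ≤ q, tensorDeg S.gr S.gr S.res S.res i
  isHah : IsHah S.gr (S.diff + h) (S.comul + ν)

/-- The Hopf algebra up to homotopy `(RH, d + h, Δ + ν)`. -/
def Perturbation.toHah {S : HopfResolution.{u, v, w} ℋ ΔH} (m : S.Perturbation) :
    Hah.{u, v} R where
  carrier := S.carrier
  gr := S.gr
  diff := S.diff + m.h
  comul := S.comul + m.ν
  isHah := m.isHah

/-- The elements `(p, s)` of the group `G_H`: `p` is an automorphism of the graded algebra `RH` such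
that `p - 1` lowers the resolution degree by at least one, and `s : RH → RH ⊗ RH` is a linear map of
degree one. -/
@[ext]
structure G where
  p : S.carrier ≃ₐ[R] S.carrier
  s : S.carrier →ₗ[R] (S.gr ᵍ⊗[R] S.gr)
  p_gr : ∀ n x, p x ∈ S.gr n ↔ x ∈ S.gr n
  p_res : ∀ q, ∀ x ∈ S.res q, p x - x ∈ S.below q
  s_gr : ∀ n, ∀ x ∈ S.gr n, s x ∈ tensorGr S.gr S.gr (n + 1)

/-- `p ⊗ p`. -/
def sq (p : S.carrier ≃ₐ[R] S.carrier) : (S.gr ᵍ⊗[R] S.gr) →ₗ[R] (S.gr ᵍ⊗[R] S.gr) :=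
  tensorMap p.toLinearMap p.toLinearMap

theorem sq_one : S.sq 1 = LinearMap.id := tensor_ext _ _ fun _ _ _ _ => rfl

theorem sq_mul (p p' : S.carrier ≃ₐ[R] S.carrier) : S.sq (p * p') = S.sq p ∘ₗ S.sq p' :=
  tensor_ext _ _ fun _ _ _ _ => rfl

theorem sq_mem {p : S.carrier ≃ₐ[R] S.carrier} (hp : ∀ n x, p x ∈ S.gr n ↔ x ∈ S.gr n) (n : ℕ)
    (t : S.gr ᵍ⊗[R] S.gr) (ht : t ∈ tensorGr S.gr S.gr n) : S.sq p t ∈ tensorGr S.gr S.gr n := by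
  induction ht using Submodule.span_induction with
  | zero => simp
  | add x y _ _ hx hy => rw [map_add]; exact Submodule.add_mem _ hx hy
  | smul r x _ hx => rw [map_smul]; exact Submodule.smul_mem _ r hx
  | mem x hx =>
    obtain ⟨i, j, rfl, a, ha, b, hb, rfl⟩ := hx
    exact tmul_mem _ _ ((hp i a).2 ha) ((hp j b).2 hb)

theorem inv_gr {p : S.carrier ≃ₐ[R] S.carrier} (hp : ∀ n x, p x ∈ S.gr n ↔ x ∈ S.gr n) (n : ℕ)
    (x : S.carrier) : p⁻¹ x ∈ S.gr n ↔ x ∈ S.gr n := by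
  rw [← hp n (p⁻¹ x)]
  exact (congrArg (· ∈ S.gr n) (p.apply_symm_apply x)).to_iff

theorem res_le_below {i q : ℕ} (h : i < q) : S.res i ≤ S.below q :=
  le_iSup₂_of_le i h le_rfl

theorem below_mono {i q : ℕ} (h : i ≤ q) : S.below i ≤ S.below q :=
  iSup₂_le fun _ hj => S.res_le_below (hj.trans_le h)

theorem map_below {p : S.carrier ≃ₐ[R] S.carrier} {q : ℕ}
    (hp : ∀ i < q, ∀ x ∈ S.res i, p x - x ∈ S.below i) {x : S.carrier} (hx : x ∈ S.below q) :
    p x ∈ S.below q := by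
  have h : S.below q ≤ (S.below q).comap p.toLinearMap := by
    refine iSup₂_le fun i hi y hy => ?_
    have h1 := S.below_mono hi.le (hp i hi y hy)
    have h2 := Submodule.add_mem _ h1 (S.res_le_below hi hy)
    rwa [sub_add_cancel] at h2
  exact h hx

theorem inv_res {p : S.carrier ≃ₐ[R] S.carrier}
    (hp : ∀ q, ∀ x ∈ S.res q, p x - x ∈ S.below q) (q : ℕ) :
    ∀ x ∈ S.res q, p⁻¹ x - x ∈ S.below q := by
  induction q using Nat.strong_induction_on with
  | _ q ih =>
    intro x hx
    have h := S.map_below (p := p⁻¹) ih (hp q x hx)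
    rw [map_sub, show p⁻¹ (p x) = x from p.symm_apply_apply x] at h
    have := Submodule.neg_mem _ h
    rwa [neg_sub] at this

/-- The group structure `(p, s) (p', s') = (p p', (p'⁻¹ ⊗ p'⁻¹) s p' + s')` of `G_H`. -/
instance : Mul S.G where
  mul g g' :=
    { p := g.p * g'.p
      s := S.sq g'.p⁻¹ ∘ₗ g.s ∘ₗ g'.p.toLinearMap + g'.s
      p_gr := fun n x => (g.p_gr n (g'.p x)).trans (g'.p_gr n x)
      p_res := fun q x hx => by
        have h1 := S.map_below (fun i _ => g.p_res i) (g'.p_res q x hx)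
        have h2 := Submodule.add_mem _ h1 (g.p_res q x hx)
        rw [map_sub, sub_add_sub_cancel] at h2
        exact h2
      s_gr := fun n x hx => Submodule.add_mem _
        (S.sq_mem (S.inv_gr g'.p_gr) _ _ (g.s_gr n _ ((g'.p_gr n x).2 hx))) (g'.s_gr n x hx) }

instance : One S.G where
  one :=
    { p := 1
      s := 0
      p_gr := fun _ _ => Iff.rfl
      p_res := fun q x _ => by simp
      s_gr := fun n x _ => Submodule.zero_mem _ }

instance : Inv S.G where
  inv g :=
    { p := g.p⁻¹
      s := -(S.sq g.p ∘ₗ g.s ∘ₗ g.p⁻¹.toLinearMap)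
      p_gr := S.inv_gr g.p_gr
      p_res := S.inv_res g.p_res
      s_gr := fun n x hx => Submodule.neg_mem _
        (S.sq_mem g.p_gr _ _ (g.s_gr n _ ((S.inv_gr g.p_gr n x).2 hx))) }

theorem mul_p (g g' : S.G) : (g * g').p = g.p * g'.p := rfl

theorem mul_s (g g' : S.G) :
    (g * g').s = S.sq g'.p⁻¹ ∘ₗ g.s ∘ₗ g'.p.toLinearMap + g'.s := rfl

instance : Group S.G :=
  Group.ofLeftAxioms
    (fun a b c => by
      apply G.ext
      · simp only [mul_p, mul_assoc]
      · simp only [mul_p, mul_s, mul_inv_rev, sq_mul, LinearMap.add_comp, LinearMap.comp_add,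
          add_assoc]
        rfl)
    (fun a => by
      apply G.ext
      · exact one_mul a.p
      · rw [mul_s]
        change S.sq a.p⁻¹ ∘ₗ 0 ∘ₗ a.p.toLinearMap + a.s = a.s
        rw [LinearMap.zero_comp, LinearMap.comp_zero, zero_add])
    (fun a => by
      apply G.ext
      · exact inv_mul_cancel a.p
      · rw [mul_s]
        change S.sq a.p⁻¹ ∘ₗ (-(S.sq a.p ∘ₗ a.s ∘ₗ a.p⁻¹.toLinearMap)) ∘ₗ a.p.toLinearMap + a.s = 0
        have h1 : S.sq a.p⁻¹ ∘ₗ S.sq a.p = LinearMap.id := by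
          rw [← sq_mul, inv_mul_cancel, sq_one]
        have h2 : a.p⁻¹.toLinearMap ∘ₗ a.p.toLinearMap = LinearMap.id :=
          LinearMap.ext fun x => a.p.symm_apply_apply x
        rw [LinearMap.neg_comp, LinearMap.comp_neg, LinearMap.comp_assoc, LinearMap.comp_assoc, h2,
          LinearMap.comp_id, ← LinearMap.comp_assoc, h1, LinearMap.id_comp, neg_add_cancel])

/-- The action of `G_H` on a differential: `d_h * (p, s) = p⁻¹ d_h p`, that is,
`d + h̄` with `h̄ = p⁻¹ h p + p⁻¹ (d p - p d)`. -/
def actDiff (D : S.carrier →ₗ[R] S.carrier) (g : S.G) : S.carrier →ₗ[R] S.carrier :=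
  g.p⁻¹.toLinearMap ∘ₗ D ∘ₗ g.p.toLinearMap

/-- The coproduct `(p⁻¹ ⊗ p⁻¹) Δ_ν p` transported along `p`. -/
def transportComul (Ψ : S.carrier →ₗ[R] (S.gr ᵍ⊗[R] S.gr)) (g : S.G) :
    S.carrier →ₗ[R] (S.gr ᵍ⊗[R] S.gr) :=
  S.sq g.p⁻¹ ∘ₗ Ψ ∘ₗ g.p.toLinearMap

/-- The action of `G_H` on a coproduct:
`Δ_ν * (p, s) = (p⁻¹ ⊗ p⁻¹) Δ_ν p + s d_h̄ + (d_h̄ ⊗ 1 + 1 ⊗ d_h̄) s`, with `d_h̄ = p⁻¹ d_h p`. -/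
def actComul (D : S.carrier →ₗ[R] S.carrier) (Ψ : S.carrier →ₗ[R] (S.gr ᵍ⊗[R] S.gr)) (g : S.G) :
    S.carrier →ₗ[R] (S.gr ᵍ⊗[R] S.gr) :=
  S.transportComul Ψ g + g.s ∘ₗ S.actDiff D g +
    tensorDiff S.gr S.gr (S.actDiff D g) (S.actDiff D g) ∘ₗ g.s

theorem actDiff_mul (D : S.carrier →ₗ[R] S.carrier) (g g' : S.G) :
    S.actDiff D (g * g') = S.actDiff (S.actDiff D g) g' := by
  simp only [actDiff, mul_p, mul_inv_rev]
  rfl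

theorem actDiff_one (D : S.carrier →ₗ[R] S.carrier) : S.actDiff D 1 = D := rfl

theorem actComul_one (D : S.carrier →ₗ[R] S.carrier) (Ψ : S.carrier →ₗ[R] (S.gr ᵍ⊗[R] S.gr)) :
    S.actComul D Ψ 1 = Ψ := by
  change S.sq (1 : S.carrier ≃ₐ[R] S.carrier)⁻¹ ∘ₗ Ψ ∘ₗ LinearMap.id + 0 ∘ₗ _ + _ ∘ₗ 0 = Ψ
  rw [inv_one, sq_one, LinearMap.zero_comp, LinearMap.comp_zero, add_zero, add_zero]
  rfl

theorem sq_tensorDiff (D : S.carrier →ₗ[R] S.carrier) (g : S.G) :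
    S.sq g.p⁻¹ ∘ₗ tensorDiff S.gr S.gr D D =
      tensorDiff S.gr S.gr (S.actDiff D g) (S.actDiff D g) ∘ₗ S.sq g.p⁻¹ := by
  have hpp : ∀ x, g.p (g.p⁻¹ x) = x := fun x => g.p.apply_symm_apply x
  refine tensor_ext _ _ fun i j a b => ?_
  have ha : (g.p⁻¹ (a : S.carrier)) ∈ S.gr i := (S.inv_gr g.p_gr i a).2 a.2
  have h1 := parity_coe S.gr a
  have h2 := parity_coe S.gr ⟨_, ha⟩
  have h3 : g.p⁻¹ (parity S.gr (a : S.carrier)) = parity S.gr (g.p⁻¹ (a : S.carrier)) := by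
    rw [h1, h2, map_smul]
  change S.sq g.p⁻¹ (D a ᵍ⊗ₜ[R] (b : S.carrier) + parity S.gr a ᵍ⊗ₜ[R] D b) =
    g.p⁻¹ (D (g.p (g.p⁻¹ a))) ᵍ⊗ₜ[R] g.p⁻¹ b +
      parity S.gr (g.p⁻¹ a) ᵍ⊗ₜ[R] g.p⁻¹ (D (g.p (g.p⁻¹ b)))
  rw [hpp, hpp, ← h3, map_add]
  rfl

theorem actComul_mul (D : S.carrier →ₗ[R] S.carrier) (Ψ : S.carrier →ₗ[R] (S.gr ᵍ⊗[R] S.gr))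
    (g g' : S.G) :
    S.actComul D Ψ (g * g') = S.actComul (S.actDiff D g) (S.actComul D Ψ g) g' := by
  have h1 := S.sq_tensorDiff (S.actDiff D g) g'
  have h2 : S.actDiff D g ∘ₗ g'.p.toLinearMap =
      g'.p.toLinearMap ∘ₗ S.actDiff (S.actDiff D g) g' :=
    LinearMap.ext fun x => (g'.p.apply_symm_apply _).symm
  have h3 : S.transportComul Ψ (g * g') = S.transportComul (S.transportComul Ψ g) g' := by
    simp only [transportComul, mul_p, mul_inv_rev, sq_mul]
    rfl
  have h4 : S.transportComul (S.actComul D Ψ g) g' =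
      S.transportComul (S.transportComul Ψ g) g' +
      (S.sq g'.p⁻¹ ∘ₗ g.s ∘ₗ g'.p.toLinearMap) ∘ₗ S.actDiff (S.actDiff D g) g' +
      tensorDiff S.gr S.gr (S.actDiff (S.actDiff D g) g') (S.actDiff (S.actDiff D g) g') ∘ₗ
        (S.sq g'.p⁻¹ ∘ₗ g.s ∘ₗ g'.p.toLinearMap) := by
    conv_rhs => rw [← LinearMap.comp_assoc (g.s ∘ₗ g'.p.toLinearMap), ← h1]
    simp only [LinearMap.comp_assoc]
    rw [← h2]
    simp only [actComul, transportComul, LinearMap.add_comp, LinearMap.comp_add,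
      LinearMap.comp_assoc]
  rw [actComul, h3, actDiff_mul, mul_s, LinearMap.add_comp, LinearMap.comp_add]
  conv_rhs => rw [actComul, h4]
  abel

/-- `(h̄, ν̄) = (h, ν) * (p, s)` for some `(p, s)` in `G_H`. The homotopy `s` has to be a derivation
homotopy, as is needed for `Δ + ν̄` to be an algebra map that is homotopic to the transported
coproduct. -/
def GRel (m m' : S.Perturbation) : Prop :=
  ∃ g : S.G, S.diff + m'.h = S.actDiff (S.diff + m.h) g ∧
    S.comul + m'.ν = S.actComul (S.diff + m.h) (S.comul + m.ν) g ∧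
    IsDerivationHomotopy S.gr (S.diff + m'.h) (tensorGr S.gr S.gr)
      (tensorDiff S.gr S.gr (S.diff + m'.h) (S.diff + m'.h))
      (S.comul + m'.ν) (S.transportComul (S.comul + m.ν) g) g.s

/-- `D_H`: the set of perturbations modulo the action of `G_H`. -/
def D {ℋ : ℕ → Submodule R H} [GradedAlgebra ℋ] {ΔH : H →ₗ[R] (ℋ ᵍ⊗[R] ℋ)}
    (S : HopfResolution.{u, v, w} ℋ ΔH) : Type v := Quot S.GRel

/-- The class in `D_H` of a perturbation. -/
def D.mk (m : S.Perturbation) : S.D := Quot.mk _ m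

/-- `k : (RH, d_h, Δ_ν) → (RH, d_h', Δ_ν')` induces `α` in homology, where the homology of a
perturbed resolution is identified with `H` by `[x] ↦ ρ x` for `x` of resolution degree zero. -/
def Induces {S : HopfResolution.{u, v, w} ℋ ΔH} (m' : S.Perturbation) (α : H ≃ₐ[R] H)
    (k : S.carrier →ₗ[R] S.carrier) : Prop :=
  ∀ x ∈ S.res 0, ∃ y ∈ S.res 0, S.ρ y = α (S.ρ x) ∧
    k x - y ∈ LinearMap.range (S.diff + m'.h)

/-- `(h', ν')` is a transform of `(h, ν)` under the automorphism `α` of `H`: there is a morphism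
`(RH, d_h, Δ_ν) → (RH, d_h', Δ_ν')` of Hopf algebras up to homotopy that induces `α`. -/
def IsTransform {S : HopfResolution.{u, v, w} ℋ ΔH} (α : H ≃ₐ[R] H) (m m' : S.Perturbation) :
    Prop :=
  ∃ k : S.carrier →ₗ[R] S.carrier,
    IsHahMap S.gr S.gr (S.diff + m.h) (S.comul + m.ν) (S.diff + m'.h) (S.comul + m'.ν) k ∧
    Induces m' α k

end HopfResolution

end Hah

end HopfPert

end

/-!
The theorem is obstruction theory for maps out of a free differential graded algebra, filtered by
the resolution degree.

A perturbed resolution `(RH, d_h)` is semifree: the differential of a generator lies in the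
subalgebra of the generators of lower resolution degree. Maps out of such an algebra and derivation
homotopies between them are constructed one generator at a time, since a derivation along a pair of
algebra maps may be prescribed freely on generators (`IsFreeOn.exists_twistedDer`,
`exists_of_levelwise`). Three facts follow. The relation "there is a derivation homotopy" is already
an equivalence relation on maps out of a semifree algebra (`IsSemiFree.exists_homotopy`; the product
of two homotopies that is needed to concatenate them is the corner of a twisted derivation with
values in triangular matrices). Weak equivalences induce bijections on homotopy classes
(`IsSemiFree.lift_of_weakEquiv`, `IsSemiFree.homotopic_of_weakEquiv`). If the target is filtered
like a perturbed resolution, the lift may be given a prescribed leading term and its corrections may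
be taken in the kernel of an algebra map (`IsSemiFree.filtered_lift`).

As `h` lowers the resolution degree by at least two, perturbing the differential does not change
the homology: every class is represented in resolution degree zero, with the same relations as
before, which identifies `H(RH, d_h)` with `H` as a Hopf algebra (`Perturbation.hasHomology`). The Künneth theorem
for weak equivalences of flat algebras (`IsWeakEquiv.tensor`) makes all this available for the
tensor square too, in particular `RH ⊗ RH` is a resolution of `H ⊗ H` (`IsResolution.tensor`).

* Models. Each Hopf algebra up to homotopy `A` with an isomorphism `i : H ≃ H(A)` is weakly
  equivalent to some `(RH, d_h, Δ_ν)`, by a map that induces `i` (`exists_model`). The pair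
  `(h, f : RH → A)` is built on generators (`exists_diffPerturbation`), and `Δ_ν` lifts `ψ f`
  through the weak equivalence `f ⊗ f` with leading term `Δ` (`exists_comul_lift`). To keep the
  counit strict, the corrections are taken in the kernel of `(ε ⊗ 1, 1 ⊗ ε)`; this requires that `f`
  preserves the augmentations, which holds as the counit of a bialgebra is unique
  (`IsHopfIso.counit_eq`). Coassociativity and cocommutativity up to homotopy are inherited from `A`
  (`IsSemiFree.isHah_of_weakEquiv`).
* The classes. Two perturbations have the same class in `D_H` if and only if they are related by a
  morphism that induces the identity of `H` (`mk_eq_mk_iff`). Indeed, such a morphism is homotopic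
  to one with leading term the identity; that one is an automorphism `p` of the algebra `RH`, and a
  homotopy that expresses its compatibility with the coproducts is the missing `s`
  (`IsTransform.gRel`).
* The action. Applying the existence of models to `(RH, d_h, Δ_ν)` with its homology identified with
  `H` in a way that is twisted by `α` yields `α • [(h, ν)]` (`exists_isTransform`); the
  characterization of the classes shows that it is well defined.
* The bijection. Perturbed resolutions are semifree, so weakly equivalent ones are related by a
  single weak equivalence, and this induces an automorphism of the Hopf algebra `H`
  (`exists_induces`). Hence two of them have the same weak homotopy type if and only if their classes
  are in the same orbit (`weakTypes_eq_iff`); surjectivity is the existence of models.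
-/

noncomputable section

set_option linter.unusedSectionVars false

namespace HopfPert

/-! ### Parity, homogeneous components and derivation homotopies -/

section GradedBasics

variable {R : Type u} [CommRing R]
variable {A : Type v} {B : Type w} [Ring A] [Ring B] [Algebra R A] [Algebra R B]
variable (𝒜 : ℕ → Submodule R A) [GradedAlgebra 𝒜] (ℬ : ℕ → Submodule R B) [GradedAlgebra ℬ]

theorem parity_of_mem {n : ℕ} {x : A} (hx : x ∈ 𝒜 n) : parity 𝒜 x = ((-1 : R) ^ n) • x :=
  parity_coe 𝒜 ⟨x, hx⟩

theorem homogeneous_induction {p : A → Prop} (h0 : p 0) (hom : ∀ n, ∀ x ∈ 𝒜 n, p x)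
    (add : ∀ x y, p x → p y → p (x + y)) (x : A) : p x :=
  DirectSum.Decomposition.inductionOn 𝒜 h0 (fun m => hom _ m.1 m.2) add x

theorem neg_one_pow_smul_smul {M : Type*} [AddCommGroup M] [Module R M] (n : ℕ) (x : M) :
    ((-1 : R) ^ n) • ((-1 : R) ^ n) • x = x := by
  rw [smul_smul, ← pow_add, Even.neg_one_pow ⟨n, rfl⟩, one_smul]

theorem parity_mem {n : ℕ} {x : A} (hx : x ∈ 𝒜 n) : parity 𝒜 x ∈ 𝒜 n := by
  rw [parity_of_mem 𝒜 hx]; exact Submodule.smul_mem _ _ hx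

theorem parity_parity (x : A) : parity 𝒜 (parity 𝒜 x) = x := by
  induction x using homogeneous_induction 𝒜 with
  | h0 => simp
  | hom n x hx => rw [parity_of_mem 𝒜 hx, map_smul, parity_of_mem 𝒜 hx, neg_one_pow_smul_smul]
  | add x y hx hy => rw [map_add, map_add, hx, hy]

theorem parity_mul (x y : A) : parity 𝒜 (x * y) = parity 𝒜 x * parity 𝒜 y := by
  induction x using homogeneous_induction 𝒜 with
  | h0 => simp
  | add x x' hx hx' => rw [add_mul, map_add, map_add, hx, hx', add_mul]
  | hom n x hx =>
    induction y using homogeneous_induction 𝒜 with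
    | h0 => simp
    | add x x' hx hx' => rw [mul_add, map_add, map_add, hx, hx', mul_add]
    | hom m y hy =>
      rw [parity_of_mem 𝒜 hx, parity_of_mem 𝒜 hy, parity_of_mem 𝒜 (SetLike.mul_mem_graded hx hy),
        smul_mul_smul_comm, pow_add]

theorem parity_one : parity 𝒜 1 = 1 := by
  rw [parity_of_mem 𝒜 (SetLike.one_mem_graded 𝒜), pow_zero, one_smul]

/-- The parity involution as an algebra homomorphism. -/
def parityHom : A →ₐ[R] A := AlgHom.ofLinearMap (parity 𝒜) (parity_one 𝒜) (parity_mul 𝒜)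

@[simp] theorem parityHom_apply (x : A) : parityHom 𝒜 x = parity 𝒜 x := rfl

theorem proj_of_mem {n : ℕ} {x : A} (hx : x ∈ 𝒜 n) : GradedAlgebra.proj 𝒜 n x = x := by
  rw [GradedAlgebra.proj_apply, DirectSum.decompose_of_mem_same 𝒜 hx]

theorem proj_of_mem_ne {m n : ℕ} {x : A} (hx : x ∈ 𝒜 m) (h : m ≠ n) :
    GradedAlgebra.proj 𝒜 n x = 0 := by
  rw [GradedAlgebra.proj_apply, DirectSum.decompose_of_mem_ne 𝒜 hx h]

theorem proj_mem (n : ℕ) (x : A) : GradedAlgebra.proj 𝒜 n x ∈ 𝒜 n := by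
  rw [GradedAlgebra.proj_apply]; exact SetLike.coe_mem _

theorem sum_proj (x : A) : ∃ N, ∀ M ≥ N, ∑ n ∈ Finset.range M, GradedAlgebra.proj 𝒜 n x = x := by
  induction x using homogeneous_induction 𝒜 with
  | h0 => exact ⟨0, by simp⟩
  | hom n x hx =>
    refine ⟨n + 1, fun M hM => ?_⟩
    rw [Finset.sum_eq_single n (fun m _ hm => proj_of_mem_ne 𝒜 hx hm.symm)
      (fun h => absurd (Finset.mem_range.2 hM) h), proj_of_mem 𝒜 hx]
  | add x y hx hy =>
    obtain ⟨N, hN⟩ := hx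
    obtain ⟨N', hN'⟩ := hy
    refine ⟨max N N', fun M hM => ?_⟩
    simp only [map_add, Finset.sum_add_distrib]
    rw [hN M (le_trans (le_max_left _ _) hM), hN' M (le_trans (le_max_right _ _) hM)]

variable {𝒜 ℬ}

theorem proj_map_of_degree_zero {f : A →ₗ[R] B} (hf : ∀ n, ∀ x ∈ 𝒜 n, f x ∈ ℬ n) (n : ℕ) (x : A) :
    GradedAlgebra.proj ℬ n (f x) = f (GradedAlgebra.proj 𝒜 n x) := by
  induction x using homogeneous_induction 𝒜 with
  | h0 => simp
  | add x y hx hy => simp only [map_add, hx, hy]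
  | hom m x hx =>
    by_cases h : m = n
    · subst h; rw [proj_of_mem 𝒜 hx, proj_of_mem ℬ (hf _ x hx)]
    · rw [proj_of_mem_ne 𝒜 hx h, proj_of_mem_ne ℬ (hf _ x hx) h, map_zero]

theorem proj_map_of_degree_neg_one {d : A →ₗ[R] B} (h0 : ∀ x ∈ 𝒜 0, d x = 0)
    (hd : ∀ n, ∀ x ∈ 𝒜 (n + 1), d x ∈ ℬ n) (n : ℕ) (x : A) :
    GradedAlgebra.proj ℬ n (d x) = d (GradedAlgebra.proj 𝒜 (n + 1) x) := by
  induction x using homogeneous_induction 𝒜 with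
  | h0 => simp
  | add x y hx hy => simp only [map_add, hx, hy]
  | hom m x hx =>
    rcases m with _ | m
    · rw [h0 x hx, proj_of_mem_ne 𝒜 hx (by omega), map_zero, map_zero]
    · by_cases h : m = n
      · subst h; rw [proj_of_mem 𝒜 hx, proj_of_mem ℬ (hd _ x hx)]
      · rw [proj_of_mem_ne 𝒜 hx (by omega), proj_of_mem_ne ℬ (hd _ x hx) h, map_zero]

theorem parity_map_of_degree_zero {f : A →ₗ[R] B} (hf : ∀ n, ∀ x ∈ 𝒜 n, f x ∈ ℬ n) (x : A) :
    parity ℬ (f x) = f (parity 𝒜 x) := by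
  induction x using homogeneous_induction 𝒜 with
  | h0 => simp
  | add x y hx hy => simp only [map_add, hx, hy]
  | hom m x hx => rw [parity_of_mem 𝒜 hx, parity_of_mem ℬ (hf _ x hx), map_smul]

theorem parity_map_of_degree_one {s : A →ₗ[R] B} (hs : ∀ n, ∀ x ∈ 𝒜 n, s x ∈ ℬ (n + 1)) (x : A) :
    parity ℬ (s x) = -s (parity 𝒜 x) := by
  induction x using homogeneous_induction 𝒜 with
  | h0 => simp
  | add x y hx hy => simp only [map_add, hx, hy]; abel
  | hom m x hx =>
    rw [parity_of_mem 𝒜 hx, parity_of_mem ℬ (hs _ x hx), map_smul, pow_succ, mul_neg_one, neg_smul]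

theorem parity_map_of_degree_neg_one {d : A →ₗ[R] B} (h0 : ∀ x ∈ 𝒜 0, d x = 0)
    (hd : ∀ n, ∀ x ∈ 𝒜 (n + 1), d x ∈ ℬ n) (x : A) : parity ℬ (d x) = -d (parity 𝒜 x) := by
  induction x using homogeneous_induction 𝒜 with
  | h0 => simp
  | add x y hx hy => simp only [map_add, hx, hy]; abel
  | hom m x hx =>
    rcases m with _ | m
    · rw [parity_of_mem 𝒜 hx, map_smul, h0 x hx]; simp
    · rw [parity_of_mem 𝒜 hx, parity_of_mem ℬ (hd _ x hx), map_smul, pow_succ, mul_neg_one,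
        neg_smul, neg_neg]

theorem IsDGA.parity_diff {d : A →ₗ[R] A} (h : IsDGA 𝒜 d) (x : A) :
    parity 𝒜 (d x) = -d (parity 𝒜 x) :=
  parity_map_of_degree_neg_one h.map_zero_degree h.map_mem x

theorem IsDGA.diff_diff {d : A →ₗ[R] A} (h : IsDGA 𝒜 d) (x : A) : d (d x) = 0 :=
  LinearMap.congr_fun h.sq_zero x

theorem IsDGA.diff_mul {d : A →ₗ[R] A} (h : IsDGA 𝒜 d) (x y : A) :
    d (x * y) = d x * y + parity 𝒜 x * d y := by
  induction x using homogeneous_induction 𝒜 with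
  | h0 => simp
  | add x x' hx hx' => simp only [add_mul, map_add, hx, hx']; abel
  | hom n x hx => rw [h.leibniz n x hx, parity_of_mem 𝒜 hx, smul_mul_assoc]

theorem IsDGA.diff_one {d : A →ₗ[R] A} (h : IsDGA 𝒜 d) : d 1 = 0 :=
  h.map_zero_degree 1 (SetLike.one_mem_graded 𝒜)

theorem IsDGAMap.comm_apply {dA : A →ₗ[R] A} {dB : B →ₗ[R] B} {f : A →ₗ[R] B}
    (h : IsDGAMap 𝒜 dA ℬ dB f) (x : A) : f (dA x) = dB (f x) := LinearMap.congr_fun h.comm x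

/-- A map of differential graded algebras as an algebra homomorphism. -/
def IsDGAMap.toAlgHom {dA : A →ₗ[R] A} {dB : B →ₗ[R] B} {f : A →ₗ[R] B}
    (h : IsDGAMap 𝒜 dA ℬ dB f) : A →ₐ[R] B := AlgHom.ofLinearMap f h.map_one h.map_mul

@[simp] theorem IsDGAMap.toAlgHom_apply {dA : A →ₗ[R] A} {dB : B →ₗ[R] B} {f : A →ₗ[R] B}
    (h : IsDGAMap 𝒜 dA ℬ dB f) (x : A) : h.toAlgHom x = f x := rfl

theorem IsDGAMap.map_parity {dA : A →ₗ[R] A} {dB : B →ₗ[R] B} {f : A →ₗ[R] B}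
    (h : IsDGAMap 𝒜 dA ℬ dB f) (x : A) : parity ℬ (f x) = f (parity 𝒜 x) :=
  parity_map_of_degree_zero h.map_mem x

variable {C : Type*} [Ring C] [Algebra R C] {𝒞 : ℕ → Submodule R C} [GradedAlgebra 𝒞]

theorem IsDGAMap.comp {dA : A →ₗ[R] A} {dB : B →ₗ[R] B} {dC : C →ₗ[R] C} {f : A →ₗ[R] B}
    {g : B →ₗ[R] C} (hg : IsDGAMap ℬ dB 𝒞 dC g) (hf : IsDGAMap 𝒜 dA ℬ dB f) :
    IsDGAMap 𝒜 dA 𝒞 dC (g ∘ₗ f) where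
  map_one := by simp [hf.map_one, hg.map_one]
  map_mul x y := by simp [hf.map_mul, hg.map_mul]
  map_mem n x hx := hg.map_mem n _ (hf.map_mem n x hx)
  comm := LinearMap.ext fun x => by
    simp only [LinearMap.comp_apply, hf.comm_apply, hg.comm_apply]

theorem IsDGAMap.id (dA : A →ₗ[R] A) : IsDGAMap 𝒜 dA 𝒜 dA LinearMap.id where
  map_one := rfl
  map_mul _ _ := rfl
  map_mem _ _ hx := hx
  comm := rfl

theorem IsDerivationHomotopy.map_mul' {dA : A →ₗ[R] A} {dB : B →ₗ[R] B} {f g s : A →ₗ[R] B}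
    (h : IsDerivationHomotopy 𝒜 dA ℬ dB f g s) (x y : A) :
    s (x * y) = f (parity 𝒜 x) * s y + s x * g y := by
  induction x using homogeneous_induction 𝒜 with
  | h0 => simp
  | add x x' hx hx' => simp only [add_mul, map_add, hx, hx']; abel
  | hom n x hx => rw [h.map_mul n x hx, parity_of_mem 𝒜 hx, map_smul, smul_mul_assoc]

theorem IsDerivationHomotopy.homotopy_apply {dA : A →ₗ[R] A} {dB : B →ₗ[R] B} {f g s : A →ₗ[R] B}
    (h : IsDerivationHomotopy 𝒜 dA ℬ dB f g s) (x : A) : s (dA x) + dB (s x) = f x - g x :=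
  LinearMap.congr_fun h.homotopy x

theorem IsDerivationHomotopy.of_mul {dA : A →ₗ[R] A} {dB : B →ₗ[R] B} {f g s : A →ₗ[R] B}
    (h1 : ∀ n, ∀ x ∈ 𝒜 n, s x ∈ ℬ (n + 1)) (h2 : ∀ x, s (dA x) + dB (s x) = f x - g x)
    (h3 : ∀ x y, s (x * y) = f (parity 𝒜 x) * s y + s x * g y) :
    IsDerivationHomotopy 𝒜 dA ℬ dB f g s where
  map_mem := h1
  homotopy := LinearMap.ext h2
  map_mul n x hx y := by rw [h3, parity_of_mem 𝒜 hx, map_smul, smul_mul_assoc]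

theorem IsDGA.of_mul {d : A →ₗ[R] A} (h1 : ∀ n, ∀ x ∈ 𝒜 (n + 1), d x ∈ 𝒜 n)
    (h2 : ∀ x ∈ 𝒜 0, d x = 0) (h3 : ∀ x, d (d x) = 0)
    (h4 : ∀ x y, d (x * y) = d x * y + parity 𝒜 x * d y) : IsDGA 𝒜 d where
  map_mem := h1
  map_zero_degree := h2
  sq_zero := LinearMap.ext h3
  leibniz n x hx y := by rw [h4, parity_of_mem 𝒜 hx, smul_mul_assoc]

theorem IsDerivationHomotopy.precomp {dA : A →ₗ[R] A} {dB : B →ₗ[R] B} {dC : C →ₗ[R] C}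
    {f g s : B →ₗ[R] C} (h : IsDerivationHomotopy ℬ dB 𝒞 dC f g s) {e : A →ₗ[R] B}
    (he : IsDGAMap 𝒜 dA ℬ dB e) :
    IsDerivationHomotopy 𝒜 dA 𝒞 dC (f ∘ₗ e) (g ∘ₗ e) (s ∘ₗ e) := by
  refine .of_mul (fun n x hx => h.map_mem n _ (he.map_mem n x hx)) (fun x => ?_) (fun x y => ?_)
  · simp only [LinearMap.comp_apply, he.comm_apply, h.homotopy_apply]
  · simp only [LinearMap.comp_apply, he.map_mul, h.map_mul', he.map_parity]

theorem IsDerivationHomotopy.postcomp {dA : A →ₗ[R] A} {dB : B →ₗ[R] B} {dC : C →ₗ[R] C}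
    {f g s : A →ₗ[R] B} (h : IsDerivationHomotopy 𝒜 dA ℬ dB f g s) {e : B →ₗ[R] C}
    (he : IsDGAMap ℬ dB 𝒞 dC e) :
    IsDerivationHomotopy 𝒜 dA 𝒞 dC (e ∘ₗ f) (e ∘ₗ g) (e ∘ₗ s) := by
  refine .of_mul (fun n x hx => he.map_mem _ _ (h.map_mem n x hx)) (fun x => ?_) (fun x y => ?_)
  · simp only [LinearMap.comp_apply, ← he.comm_apply, ← map_add, h.homotopy_apply, map_sub]
  · simp only [LinearMap.comp_apply, he.map_mul, h.map_mul', map_add]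

theorem DerivationHomotopic.of_homotopy {dA : A →ₗ[R] A} {dB : B →ₗ[R] B} {f g s : A →ₗ[R] B}
    (hf : IsDGAMap 𝒜 dA ℬ dB f) (hg : IsDGAMap 𝒜 dA ℬ dB g)
    (h : IsDerivationHomotopy 𝒜 dA ℬ dB f g s) : DerivationHomotopic 𝒜 dA ℬ dB f g :=
  .rel _ _ ⟨hf, hg, s, h⟩

theorem DerivationHomotopic.refl {dA : A →ₗ[R] A} {dB : B →ₗ[R] B} (f : A →ₗ[R] B) :
    DerivationHomotopic 𝒜 dA ℬ dB f f := Relation.EqvGen.refl f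

theorem DerivationHomotopic.symm {dA : A →ₗ[R] A} {dB : B →ₗ[R] B} {f g : A →ₗ[R] B}
    (h : DerivationHomotopic 𝒜 dA ℬ dB f g) : DerivationHomotopic 𝒜 dA ℬ dB g f :=
  Relation.EqvGen.symm _ _ h

theorem DerivationHomotopic.trans {dA : A →ₗ[R] A} {dB : B →ₗ[R] B} {f g h : A →ₗ[R] B}
    (h1 : DerivationHomotopic 𝒜 dA ℬ dB f g) (h2 : DerivationHomotopic 𝒜 dA ℬ dB g h) :
    DerivationHomotopic 𝒜 dA ℬ dB f h := Relation.EqvGen.trans _ _ _ h1 h2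

/-- A construction on maps that preserves derivation homotopies preserves the relation they
generate. -/
theorem DerivationHomotopic.map {A' B' : Type*} [Ring A'] [Ring B'] [Algebra R A'] [Algebra R B']
    {𝒜' : ℕ → Submodule R A'} [GradedAlgebra 𝒜'] {ℬ' : ℕ → Submodule R B'} [GradedAlgebra ℬ']
    {dA : A →ₗ[R] A} {dB : B →ₗ[R] B} {dA' : A' →ₗ[R] A'} {dB' : B' →ₗ[R] B'}
    {f g : A →ₗ[R] B} (h : DerivationHomotopic 𝒜 dA ℬ dB f g) (F : (A →ₗ[R] B) → (A' →ₗ[R] B'))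
    (hF : ∀ f, IsDGAMap 𝒜 dA ℬ dB f → IsDGAMap 𝒜' dA' ℬ' dB' (F f))
    (hs : ∀ f g s, IsDGAMap 𝒜 dA ℬ dB f → IsDGAMap 𝒜 dA ℬ dB g →
      IsDerivationHomotopy 𝒜 dA ℬ dB f g s →
      ∃ s', IsDerivationHomotopy 𝒜' dA' ℬ' dB' (F f) (F g) s') :
    DerivationHomotopic 𝒜' dA' ℬ' dB' (F f) (F g) := by
  induction h with
  | rel f g h =>
    obtain ⟨hf, hg, s, h⟩ := h
    obtain ⟨s', h'⟩ := hs f g s hf hg h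
    exact .of_homotopy (hF f hf) (hF g hg) h'
  | refl f => exact .refl _
  | symm f g _ ih => exact ih.symm
  | trans f g h _ _ ih ih' => exact ih.trans ih'

theorem DerivationHomotopic.precomp {dA : A →ₗ[R] A} {dB : B →ₗ[R] B} {dC : C →ₗ[R] C}
    {f g : B →ₗ[R] C} (h : DerivationHomotopic ℬ dB 𝒞 dC f g) {e : A →ₗ[R] B}
    (he : IsDGAMap 𝒜 dA ℬ dB e) : DerivationHomotopic 𝒜 dA 𝒞 dC (f ∘ₗ e) (g ∘ₗ e) :=
  h.map (fun f => f ∘ₗ e) (fun _ hf => hf.comp he) fun _ _ _ _ _ h => ⟨_, h.precomp he⟩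

theorem DerivationHomotopic.postcomp {dA : A →ₗ[R] A} {dB : B →ₗ[R] B} {dC : C →ₗ[R] C}
    {f g : A →ₗ[R] B} (h : DerivationHomotopic 𝒜 dA ℬ dB f g) {e : B →ₗ[R] C}
    (he : IsDGAMap ℬ dB 𝒞 dC e) : DerivationHomotopic 𝒜 dA 𝒞 dC (e ∘ₗ f) (e ∘ₗ g) :=
  h.map (fun f => e ∘ₗ f) (fun _ hf => he.comp hf) fun _ _ _ _ _ h => ⟨_, h.postcomp he⟩

end GradedBasics

/-! ### The tensor product of differential graded algebras -/

section TensorBasics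

variable {R : Type u} [CommRing R]
variable {A : Type*} {B : Type*} {C : Type*} {A' : Type*} {B' : Type*} {C' : Type*}
variable [Ring A] [Ring B] [Ring C] [Ring A'] [Ring B'] [Ring C']
variable [Algebra R A] [Algebra R B] [Algebra R C] [Algebra R A'] [Algebra R B'] [Algebra R C']
variable {𝒜 : ℕ → Submodule R A} [GradedAlgebra 𝒜] {ℬ : ℕ → Submodule R B} [GradedAlgebra ℬ]
variable {𝒞 : ℕ → Submodule R C} [GradedAlgebra 𝒞]
variable {𝒜' : ℕ → Submodule R A'} [GradedAlgebra 𝒜']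
variable {ℬ' : ℕ → Submodule R B'} [GradedAlgebra ℬ']
variable {𝒞' : ℕ → Submodule R C'} [GradedAlgebra 𝒞']

theorem tmul_mul_tmul {j i : ℕ} (a : A) {b : B} (hb : b ∈ ℬ j) {a' : A} (ha' : a' ∈ 𝒜 i) (b' : B) :
    (a ᵍ⊗ₜ[R] b * a' ᵍ⊗ₜ[R] b' : 𝒜 ᵍ⊗[R] ℬ) =
      ((-1 : R) ^ (j * i)) • ((a * a') ᵍ⊗ₜ[R] (b * b') : 𝒜 ᵍ⊗[R] ℬ) := by
  have key := GradedTensorProduct.tmul_coe_mul_coe_tmul (R := R) 𝒜 ℬ a ⟨b, hb⟩ ⟨a', ha'⟩ b'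
  refine key.trans ?_
  rcases Nat.even_or_odd (j * i) with h | h
  · have : ((-1 : ℤˣ) ^ (j * i)) = 1 := h.neg_one_pow
    rw [this, one_smul, h.neg_one_pow, one_smul]
  · have : ((-1 : ℤˣ) ^ (j * i)) = -1 := h.neg_one_pow
    rw [this, Units.neg_smul, one_smul, h.neg_one_pow, neg_smul, one_smul]

theorem tmul_smul_left (r : R) (a : A) (b : B) :
    ((r • a) ᵍ⊗ₜ[R] b : 𝒜 ᵍ⊗[R] ℬ) = r • (a ᵍ⊗ₜ[R] b : 𝒜 ᵍ⊗[R] ℬ) := rfl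

theorem tmul_smul_right (r : R) (a : A) (b : B) :
    (a ᵍ⊗ₜ[R] (r • b) : 𝒜 ᵍ⊗[R] ℬ) = r • (a ᵍ⊗ₜ[R] b : 𝒜 ᵍ⊗[R] ℬ) := by
  change GradedTensorProduct.of R 𝒜 ℬ (a ⊗ₜ[R] (r • b)) = _
  rw [TensorProduct.tmul_smul, map_smul]

theorem tmul_add_left (a a' : A) (b : B) :
    ((a + a') ᵍ⊗ₜ[R] b : 𝒜 ᵍ⊗[R] ℬ) = a ᵍ⊗ₜ[R] b + a' ᵍ⊗ₜ[R] b := by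
  change GradedTensorProduct.of R 𝒜 ℬ ((a + a') ⊗ₜ[R] b) = _
  rw [TensorProduct.add_tmul, map_add]

theorem tmul_add_right (a : A) (b b' : B) :
    (a ᵍ⊗ₜ[R] (b + b') : 𝒜 ᵍ⊗[R] ℬ) = a ᵍ⊗ₜ[R] b + a ᵍ⊗ₜ[R] b' := by
  change GradedTensorProduct.of R 𝒜 ℬ (a ⊗ₜ[R] (b + b')) = _
  rw [TensorProduct.tmul_add, map_add]

theorem tmul_sub_left (a a' : A) (b : B) :
    ((a - a') ᵍ⊗ₜ[R] b : 𝒜 ᵍ⊗[R] ℬ) = a ᵍ⊗ₜ[R] b - a' ᵍ⊗ₜ[R] b := by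
  change GradedTensorProduct.of R 𝒜 ℬ ((a - a') ⊗ₜ[R] b) = _
  rw [TensorProduct.sub_tmul, map_sub]

theorem tmul_sub_right (a : A) (b b' : B) :
    (a ᵍ⊗ₜ[R] (b - b') : 𝒜 ᵍ⊗[R] ℬ) = a ᵍ⊗ₜ[R] b - a ᵍ⊗ₜ[R] b' := by
  change GradedTensorProduct.of R 𝒜 ℬ (a ⊗ₜ[R] (b - b')) = _
  rw [TensorProduct.tmul_sub, map_sub]

theorem tmul_zero_left (b : B) : ((0 : A) ᵍ⊗ₜ[R] b : 𝒜 ᵍ⊗[R] ℬ) = 0 := by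
  change GradedTensorProduct.of R 𝒜 ℬ ((0 : A) ⊗ₜ[R] b) = _
  rw [TensorProduct.zero_tmul, map_zero]

theorem tmul_zero_right (a : A) : (a ᵍ⊗ₜ[R] (0 : B) : 𝒜 ᵍ⊗[R] ℬ) = 0 := by
  change GradedTensorProduct.of R 𝒜 ℬ (a ⊗ₜ[R] (0 : B)) = _
  rw [TensorProduct.tmul_zero, map_zero]

theorem tensor_induction {p : 𝒜 ᵍ⊗[R] ℬ → Prop} (h0 : p 0)
    (tmul : ∀ (a : A) (b : B), p (a ᵍ⊗ₜ[R] b)) (add : ∀ x y, p x → p y → p (x + y))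
    (t : 𝒜 ᵍ⊗[R] ℬ) : p t :=
  TensorProduct.induction_on (motive := fun t => p (GradedTensorProduct.of R 𝒜 ℬ t))
    ((GradedTensorProduct.of R 𝒜 ℬ).symm t) (by rwa [map_zero]) tmul
    (fun x y hx hy => by rw [map_add]; exact add _ _ hx hy)

theorem tensor_homogeneous_induction {p : 𝒜 ᵍ⊗[R] ℬ → Prop} (h0 : p 0)
    (tmul : ∀ i j, ∀ a ∈ 𝒜 i, ∀ b ∈ ℬ j, p (a ᵍ⊗ₜ[R] b)) (add : ∀ x y, p x → p y → p (x + y))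
    (t : 𝒜 ᵍ⊗[R] ℬ) : p t := by
  induction t using tensor_induction with
  | h0 => exact h0
  | add x y hx hy => exact add x y hx hy
  | tmul a b =>
    induction a using homogeneous_induction 𝒜 with
    | h0 => rw [tmul_zero_left]; exact h0
    | add x y hx hy => rw [tmul_add_left]; exact add _ _ hx hy
    | hom i a ha =>
      induction b using homogeneous_induction ℬ with
      | h0 => rw [tmul_zero_right]; exact h0
      | add x y hx hy => rw [tmul_add_right]; exact add _ _ hx hy
      | hom j b hb => exact tmul i j a ha b hb

theorem tensor_map_mem {M : Type*} [AddCommGroup M] [Module R M]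
    {P : ℕ → Submodule R A} {Q : ℕ → Submodule R B} {n : ℕ}
    {N : Submodule R M} {f : (𝒜 ᵍ⊗[R] ℬ) →ₗ[R] M}
    (h : ∀ i j, i + j = n → ∀ a ∈ P i, ∀ b ∈ Q j, f (a ᵍ⊗ₜ[R] b) ∈ N) {t : 𝒜 ᵍ⊗[R] ℬ}
    (ht : t ∈ tensorDeg 𝒜 ℬ P Q n) : f t ∈ N := by
  have : tensorDeg 𝒜 ℬ P Q n ≤ N.comap f := by
    refine Submodule.span_le.2 ?_
    rintro _ ⟨i, j, hij, a, ha, b, hb, rfl⟩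
    exact h i j hij a ha b hb
  exact this ht

@[simp] theorem tensorMap_tmul (f : A →ₗ[R] A') (g : B →ₗ[R] B') (a : A) (b : B) :
    (tensorMap f g : (𝒜 ᵍ⊗[R] ℬ) →ₗ[R] (𝒜' ᵍ⊗[R] ℬ')) (a ᵍ⊗ₜ[R] b) = f a ᵍ⊗ₜ[R] g b := rfl

theorem tensorMap_comp (f : A →ₗ[R] A') (g : B →ₗ[R] B') (f' : A' →ₗ[R] C) (g' : B' →ₗ[R] C') :
    (tensorMap f' g' : (𝒜' ᵍ⊗[R] ℬ') →ₗ[R] (𝒞 ᵍ⊗[R] 𝒞')) ∘ₗ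
      (tensorMap f g : (𝒜 ᵍ⊗[R] ℬ) →ₗ[R] (𝒜' ᵍ⊗[R] ℬ')) = tensorMap (f' ∘ₗ f) (g' ∘ₗ g) :=
  tensor_ext _ _ fun _ _ _ _ => rfl

theorem tensorMap_id : (tensorMap LinearMap.id LinearMap.id : (𝒜 ᵍ⊗[R] ℬ) →ₗ[R] (𝒜 ᵍ⊗[R] ℬ)) =
    LinearMap.id := tensor_ext _ _ fun _ _ _ _ => rfl

theorem tensorDiff_tmul (dA : A →ₗ[R] A) (dB : B →ₗ[R] B) (a : A) (b : B) :
    tensorDiff 𝒜 ℬ dA dB (a ᵍ⊗ₜ[R] b) = dA a ᵍ⊗ₜ[R] b + parity 𝒜 a ᵍ⊗ₜ[R] dB b := rfl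

theorem one_eq_tmul : (1 : 𝒜 ᵍ⊗[R] ℬ) = (1 : A) ᵍ⊗ₜ[R] (1 : B) := rfl

theorem parity_tmul (a : A) (b : B) : parity (tensorGr 𝒜 ℬ) (a ᵍ⊗ₜ[R] b) =
    parity 𝒜 a ᵍ⊗ₜ[R] parity ℬ b := by
  have h : parity (tensorGr 𝒜 ℬ) = tensorMap (parity 𝒜) (parity ℬ) := by
    refine tensor_ext _ _ fun i j a b => ?_
    rw [parity_of_mem _ (tmul_mem 𝒜 ℬ a.2 b.2), tensorMap_tmul, parity_of_mem _ a.2,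
      parity_of_mem _ b.2, tmul_smul_left, tmul_smul_right, smul_smul, pow_add]
  rw [h, tensorMap_tmul]

theorem tmul_mem_of_eq {i j n : ℕ} {a : A} {b : B} (ha : a ∈ 𝒜 i) (hb : b ∈ ℬ j) (h : i + j = n) :
    (a ᵍ⊗ₜ[R] b : 𝒜 ᵍ⊗[R] ℬ) ∈ tensorGr 𝒜 ℬ n := h ▸ tmul_mem 𝒜 ℬ ha hb

theorem IsDGA.tensor {dA : A →ₗ[R] A} {dB : B →ₗ[R] B} (hA : IsDGA 𝒜 dA) (hB : IsDGA ℬ dB) :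
    IsDGA (tensorGr 𝒜 ℬ) (tensorDiff 𝒜 ℬ dA dB) := by
  have hmem : ∀ n, ∀ t ∈ tensorGr 𝒜 ℬ (n + 1), tensorDiff 𝒜 ℬ dA dB t ∈ tensorGr 𝒜 ℬ n := by
    intro n t ht
    refine tensor_map_mem (fun i j hij a ha b hb => ?_) ht
    rw [tensorDiff_tmul]
    refine Submodule.add_mem _ ?_ ?_
    · rcases i with _ | i
      · rw [hA.map_zero_degree a ha, tmul_zero_left]; exact Submodule.zero_mem _
      · exact tmul_mem_of_eq (hA.map_mem i a ha) hb (by omega)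
    · rcases j with _ | j
      · rw [hB.map_zero_degree b hb, tmul_zero_right]; exact Submodule.zero_mem _
      · exact tmul_mem_of_eq (parity_mem 𝒜 ha) (hB.map_mem j b hb) (by omega)
  refine .of_mul hmem ?_ (fun t => ?_) (fun s t => ?_)
  · intro t ht
    have : tensorDiff 𝒜 ℬ dA dB t ∈ (⊥ : Submodule R (𝒜 ᵍ⊗[R] ℬ)) := by
      refine tensor_map_mem (fun i j hij a ha b hb => ?_) ht
      obtain rfl : i = 0 := by omega
      obtain rfl : j = 0 := by omega
      rw [tensorDiff_tmul, hA.map_zero_degree a ha, hB.map_zero_degree b hb, tmul_zero_left,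
        tmul_zero_right, add_zero]
      exact Submodule.zero_mem _
    exact (Submodule.mem_bot R).1 this
  · induction t using tensor_induction with
    | h0 => simp
    | add x y hx hy => rw [map_add, map_add, hx, hy, add_zero]
    | tmul a b =>
      rw [tensorDiff_tmul, map_add, tensorDiff_tmul, tensorDiff_tmul, hA.diff_diff, hB.diff_diff,
        hA.parity_diff, tmul_zero_left, tmul_zero_right, zero_add, add_zero, ← tmul_add_left,
        neg_add_cancel, tmul_zero_left]
  · induction s using tensor_homogeneous_induction with
    | h0 => simp
    | add x y hx hy => simp only [add_mul, map_add, hx, hy]; abel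
    | tmul i j a ha b hb =>
      induction t using tensor_homogeneous_induction with
      | h0 => simp
      | add x y hx hy => simp only [mul_add, map_add, hx, hy]; abel
      | tmul k l a' ha' b' hb' =>
        have hda' : ∀ x : A, ((x ᵍ⊗ₜ[R] b * dA a' ᵍ⊗ₜ[R] b' : 𝒜 ᵍ⊗[R] ℬ)) =
            ((-1 : R) ^ (j * k + j)) • ((x * dA a') ᵍ⊗ₜ[R] (b * b') : 𝒜 ᵍ⊗[R] ℬ) := by
          intro x
          rcases k with _ | k
          · simp only [hA.map_zero_degree a' ha', mul_zero, tmul_zero_left, smul_zero]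
          · rw [tmul_mul_tmul _ hb (hA.map_mem k a' ha')]
            congr 1
            rw [mul_add, mul_one, add_assoc, pow_add _ (j * k) (j + j),
              Even.neg_one_pow ⟨j, rfl⟩, mul_one]
        have hdb : ∀ x : A, ((x ᵍ⊗ₜ[R] dB b * a' ᵍ⊗ₜ[R] b' : 𝒜 ᵍ⊗[R] ℬ)) =
            ((-1 : R) ^ (j * k + k)) • ((x * a') ᵍ⊗ₜ[R] (dB b * b') : 𝒜 ᵍ⊗[R] ℬ) := by
          intro x
          rcases j with _ | j
          · simp only [hB.map_zero_degree b hb, zero_mul, tmul_zero_right, smul_zero]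
          · rw [tmul_mul_tmul _ (hB.map_mem j b hb) ha']
            congr 1
            rw [add_mul, one_mul, add_assoc, pow_add _ (j * k) (k + k),
              Even.neg_one_pow ⟨k, rfl⟩, mul_one]
        rw [tmul_mul_tmul _ hb ha', map_smul, tensorDiff_tmul, tensorDiff_tmul, tensorDiff_tmul,
          hA.diff_mul, hB.diff_mul, parity_tmul, parity_mul, add_mul, mul_add,
          tmul_mul_tmul _ hb ha', hdb, parity_of_mem 𝒜 ha, parity_of_mem 𝒜 ha', parity_of_mem ℬ hb]
        simp only [tmul_smul_left, tmul_smul_right, smul_mul_assoc, mul_smul_comm, hda',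
          tmul_add_left, tmul_add_right]
        rw [tmul_mul_tmul _ hb ha']
        simp only [smul_add, smul_smul]
        have e : ((-1 : R) ^ j) * (-1) ^ j = 1 := by rw [← pow_add]; exact Even.neg_one_pow ⟨j, rfl⟩
        have e1 : (-1 : R) ^ j * ((-1) ^ i * (-1) ^ (j * k + j)) = (-1) ^ (j * k) * (-1) ^ i := by
          rw [pow_add, mul_left_comm, mul_left_comm ((-1 : R) ^ j), e]; ring
        have e2 : (-1 : R) ^ (j * k + k) * (-1) ^ i = (-1) ^ (j * k) * ((-1) ^ k * (-1) ^ i) := by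
          ring
        have e3 : (-1 : R) ^ k * ((-1) ^ j * ((-1) ^ i * (-1) ^ (j * k))) =
            (-1) ^ (j * k) * ((-1) ^ j * ((-1) ^ k * (-1) ^ i)) := by ring
        rw [e1, e2, e3]
        abel

theorem IsDGAMap.tensor {dA : A →ₗ[R] A} {dB : B →ₗ[R] B} {dA' : A' →ₗ[R] A'} {dB' : B' →ₗ[R] B'}
    {f : A →ₗ[R] A'} {g : B →ₗ[R] B'} (hf : IsDGAMap 𝒜 dA 𝒜' dA' f) (hg : IsDGAMap ℬ dB ℬ' dB' g) :
    IsDGAMap (tensorGr 𝒜 ℬ) (tensorDiff 𝒜 ℬ dA dB) (tensorGr 𝒜' ℬ') (tensorDiff 𝒜' ℬ' dA' dB')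
      (tensorMap f g) where
  map_one := by rw [one_eq_tmul, tensorMap_tmul, hf.map_one, hg.map_one, one_eq_tmul]
  map_mul s t := by
    induction s using tensor_homogeneous_induction with
    | h0 => simp
    | add x y hx hy => simp only [add_mul, map_add, hx, hy]
    | tmul i j a ha b hb =>
      induction t using tensor_homogeneous_induction with
      | h0 => simp
      | add x y hx hy => simp only [mul_add, map_add, hx, hy]
      | tmul k l a' ha' b' hb' =>
        rw [tmul_mul_tmul _ hb ha', map_smul, tensorMap_tmul, tensorMap_tmul, tensorMap_tmul,
          tmul_mul_tmul _ (hg.map_mem _ _ hb) (hf.map_mem _ _ ha'), hf.map_mul, hg.map_mul]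
  map_mem n t ht := tensor_map_mem (f := tensorMap f g)
    (fun i j hij a ha b hb => tmul_mem_of_eq (hf.map_mem i a ha) (hg.map_mem j b hb) hij) ht
  comm := tensor_ext _ _ fun i j a b => by
    simp only [LinearMap.comp_apply, tensorDiff_tmul, map_add, tensorMap_tmul, hf.comm_apply,
      hg.comm_apply, hf.map_parity]

@[simp] theorem tensorAssoc_tmul (a b c : A) :
    tensorAssoc 𝒜 ((a ᵍ⊗ₜ[R] b : 𝒜 ᵍ⊗[R] 𝒜) ᵍ⊗ₜ[R] c) = a ᵍ⊗ₜ[R] (b ᵍ⊗ₜ[R] c : 𝒜 ᵍ⊗[R] 𝒜) := rfl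

theorem tensor_assoc_induction {p : (tensorGr 𝒜 𝒜) ᵍ⊗[R] 𝒜 → Prop} (h0 : p 0)
    (tmul : ∀ i j k, ∀ a ∈ 𝒜 i, ∀ b ∈ 𝒜 j, ∀ c ∈ 𝒜 k, p ((a ᵍ⊗ₜ[R] b : 𝒜 ᵍ⊗[R] 𝒜) ᵍ⊗ₜ[R] c))
    (add : ∀ x y, p x → p y → p (x + y)) (t : (tensorGr 𝒜 𝒜) ᵍ⊗[R] 𝒜) : p t := by
  induction t using tensor_homogeneous_induction with
  | h0 => exact h0
  | add x y hx hy => exact add x y hx hy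
  | tmul i k s hs c hc =>
    clear hs
    induction s using tensor_homogeneous_induction with
    | h0 => rw [tmul_zero_left]; exact h0
    | add x y hx hy => rw [tmul_add_left]; exact add _ _ hx hy
    | tmul i j a ha b hb => exact tmul i j k a ha b hb c hc

theorem isDGAMap_tensorAssoc {d : A →ₗ[R] A} :
    IsDGAMap (tensorGr (tensorGr 𝒜 𝒜) 𝒜)
      (tensorDiff (tensorGr 𝒜 𝒜) 𝒜 (tensorDiff 𝒜 𝒜 d d) d) (tensorGr 𝒜 (tensorGr 𝒜 𝒜))
      (tensorDiff 𝒜 (tensorGr 𝒜 𝒜) d (tensorDiff 𝒜 𝒜 d d)) (tensorAssoc 𝒜) where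
  map_one := rfl
  map_mul s t := by
    induction s using tensor_assoc_induction with
    | h0 => simp
    | add x y hx hy => simp only [add_mul, map_add, hx, hy]
    | tmul i j k a ha b hb c hc =>
      induction t using tensor_assoc_induction with
      | h0 => simp
      | add x y hx hy => simp only [mul_add, map_add, hx, hy]
      | tmul i' j' k' a' ha' b' hb' c' hc' =>
        rw [tmul_mul_tmul _ hc (tmul_mem 𝒜 𝒜 ha' hb'), tmul_mul_tmul _ hb ha', tensorAssoc_tmul,
          tensorAssoc_tmul, tmul_mul_tmul _ (tmul_mem 𝒜 𝒜 hb hc) ha', tmul_mul_tmul _ hc hb',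
          tmul_smul_left, tmul_smul_right, map_smul, map_smul, tensorAssoc_tmul, smul_smul,
          smul_smul, ← pow_add, ← pow_add]
        congr 2
        ring
  map_mem n t ht := by
    refine tensor_map_mem (fun i k hik s hs c hc => ?_) ht
    refine tensor_map_mem (f := tensorAssoc 𝒜 ∘ₗ (GradedTensorProduct.of R (tensorGr 𝒜 𝒜)
      𝒜).toLinearMap ∘ₗ (TensorProduct.mk R (𝒜 ᵍ⊗[R] 𝒜) A).flip c)
      (fun i j hij a ha b hb => ?_) hs
    exact tmul_mem_of_eq ha (tmul_mem 𝒜 𝒜 hb hc) (by omega)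
  comm := LinearMap.ext fun t => by
    induction t using tensor_assoc_induction with
    | h0 => simp
    | add x y hx hy => simp only [map_add, hx, hy]
    | tmul i j k a ha b hb c hc =>
      simp only [LinearMap.comp_apply, tensorDiff_tmul, map_add, tmul_add_left, tmul_add_right,
        tensorAssoc_tmul, parity_tmul, add_assoc]

theorem comm_tmul {i j : ℕ} {a : A} (ha : a ∈ 𝒜 i) {b : B} (hb : b ∈ ℬ j) :
    GradedTensorProduct.comm 𝒜 ℬ (a ᵍ⊗ₜ[R] b) =
      ((-1 : R) ^ (j * i)) • (b ᵍ⊗ₜ[R] a : ℬ ᵍ⊗[R] 𝒜) := by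
  refine (GradedTensorProduct.comm_coe_tmul_coe (R := R) 𝒜 ℬ ⟨a, ha⟩ ⟨b, hb⟩).trans ?_
  rcases Nat.even_or_odd (j * i) with h | h
  · have : ((-1 : ℤˣ) ^ (j * i)) = 1 := h.neg_one_pow
    rw [this, one_smul, h.neg_one_pow, one_smul]
  · have : ((-1 : ℤˣ) ^ (j * i)) = -1 := h.neg_one_pow
    rw [this, Units.neg_smul, one_smul, h.neg_one_pow, neg_smul, one_smul]

theorem isDGAMap_comm {dA : A →ₗ[R] A} {dB : B →ₗ[R] B} (hA : IsDGA 𝒜 dA) (hB : IsDGA ℬ dB) :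
    IsDGAMap (tensorGr 𝒜 ℬ) (tensorDiff 𝒜 ℬ dA dB) (tensorGr ℬ 𝒜)
      (tensorDiff ℬ 𝒜 dB dA) (GradedTensorProduct.comm 𝒜 ℬ).toLinearMap where
  map_one := map_one (GradedTensorProduct.comm 𝒜 ℬ)
  map_mul := map_mul (GradedTensorProduct.comm 𝒜 ℬ)
  map_mem n t ht := tensor_map_mem (fun i j hij a ha b hb => by
    rw [AlgEquiv.toLinearMap_apply, comm_tmul ha hb]
    exact Submodule.smul_mem _ _ (tmul_mem_of_eq hb ha (by omega))) ht
  comm := LinearMap.ext fun t => by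
    induction t using tensor_homogeneous_induction with
    | h0 => simp
    | add x y hx hy => simp only [map_add, hx, hy]
    | tmul i j a ha b hb =>
      have h1 : GradedTensorProduct.comm 𝒜 ℬ (dA a ᵍ⊗ₜ[R] b) =
          ((-1 : R) ^ (j * i + j)) • (b ᵍ⊗ₜ[R] dA a : ℬ ᵍ⊗[R] 𝒜) := by
        rcases i with _ | i
        · simp only [hA.map_zero_degree a ha, tmul_zero_left, tmul_zero_right, smul_zero, map_zero]
        · rw [comm_tmul (hA.map_mem i a ha) hb]
          congr 1
          rw [mul_add, mul_one, add_assoc, pow_add _ (j * i) (j + j), Even.neg_one_pow ⟨j, rfl⟩,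
            mul_one]
      have h2 : GradedTensorProduct.comm 𝒜 ℬ (a ᵍ⊗ₜ[R] dB b) =
          ((-1 : R) ^ (j * i + i)) • (dB b ᵍ⊗ₜ[R] a : ℬ ᵍ⊗[R] 𝒜) := by
        rcases j with _ | j
        · simp only [hB.map_zero_degree b hb, tmul_zero_left, tmul_zero_right, smul_zero, map_zero]
        · rw [comm_tmul ha (hB.map_mem j b hb)]
          congr 1
          rw [add_mul, one_mul, add_assoc, pow_add _ (j * i) (i + i), Even.neg_one_pow ⟨i, rfl⟩,
            mul_one]
      simp only [LinearMap.comp_apply, AlgEquiv.toLinearMap_apply, tensorDiff_tmul, map_add]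
      rw [comm_tmul ha hb, map_smul, tensorDiff_tmul, parity_of_mem 𝒜 ha, parity_of_mem ℬ hb,
        tmul_smul_left, tmul_smul_left, map_smul, h1, h2, smul_add, smul_smul, smul_smul, ← pow_add,
        ← pow_add, add_comm]
      congr 2
      rw [add_comm, add_assoc, pow_add _ (j * i) (i + i), Even.neg_one_pow ⟨i, rfl⟩, mul_one]

theorem IsDerivationHomotopy.tensorRight {dA : A →ₗ[R] A} {dB : B →ₗ[R] B} {dA' : A' →ₗ[R] A'}
    {dB' : B' →ₗ[R] B'} {f g s : A →ₗ[R] A'} {k : B →ₗ[R] B'}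
    (h : IsDerivationHomotopy 𝒜 dA 𝒜' dA' f g s)
    (hg : IsDGAMap 𝒜 dA 𝒜' dA' g) (hk : IsDGAMap ℬ dB ℬ' dB' k) :
    IsDerivationHomotopy (tensorGr 𝒜 ℬ) (tensorDiff 𝒜 ℬ dA dB) (tensorGr 𝒜' ℬ')
      (tensorDiff 𝒜' ℬ' dA' dB') (tensorMap f k) (tensorMap g k) (tensorMap s k) := by
  refine .of_mul (fun n t ht => tensor_map_mem (f := tensorMap s k)
    (fun i j hij a ha b hb => tmul_mem_of_eq (h.map_mem i a ha) (hk.map_mem j b hb) (by omega)) ht)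
    (fun t => ?_) (fun t t' => ?_)
  · induction t using tensor_induction with
    | h0 => simp
    | add x y hx hy =>
      simp only [map_add] at hx hy ⊢
      rw [add_add_add_comm, hx, hy]; abel
    | tmul a b =>
      simp only [tensorDiff_tmul, map_add, tensorMap_tmul, hk.comm_apply,
        parity_map_of_degree_one h.map_mem, ← tmul_sub_left, ← h.homotopy_apply, tmul_add_left]
      rw [show -s (parity 𝒜 a) = 0 - s (parity 𝒜 a) by abel, tmul_sub_left, tmul_zero_left]
      abel
  · induction t using tensor_homogeneous_induction with
    | h0 => simp
    | add x y hx hy => simp only [add_mul, map_add, hx, hy]; abel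
    | tmul i j a ha b hb =>
      induction t' using tensor_homogeneous_induction with
      | h0 => simp
      | add x y hx hy => simp only [mul_add, map_add, hx, hy]; abel
      | tmul k l a' ha' b' hb' =>
        rw [tmul_mul_tmul _ hb ha', map_smul, parity_tmul]
        simp only [tensorMap_tmul]
        rw [tmul_mul_tmul _ (hk.map_mem _ _ (parity_mem ℬ hb)) (h.map_mem _ _ ha'),
          tmul_mul_tmul _ (hk.map_mem _ _ hb) (hg.map_mem _ _ ha'), h.map_mul', hk.map_mul,
          tmul_add_left, smul_add, parity_of_mem ℬ hb, map_smul, smul_mul_assoc, tmul_smul_right,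
          smul_smul, ← pow_add]
        congr 2
        rw [mul_add, mul_one, add_assoc, pow_add _ (j * k) (j + j), Even.neg_one_pow ⟨j, rfl⟩,
          mul_one]

theorem IsDerivationHomotopy.tensorLeft {dA : A →ₗ[R] A} {dB : B →ₗ[R] B} {dA' : A' →ₗ[R] A'}
    {dB' : B' →ₗ[R] B'} {f g s : B →ₗ[R] B'} {k : A →ₗ[R] A'}
    (h : IsDerivationHomotopy ℬ dB ℬ' dB' f g s) (hf : IsDGAMap ℬ dB ℬ' dB' f)
    (hk : IsDGAMap 𝒜 dA 𝒜' dA' k) (hA : IsDGA 𝒜 dA) :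
    IsDerivationHomotopy (tensorGr 𝒜 ℬ) (tensorDiff 𝒜 ℬ dA dB) (tensorGr 𝒜' ℬ')
      (tensorDiff 𝒜' ℬ' dA' dB') (tensorMap k f) (tensorMap k g)
      (tensorMap (k ∘ₗ parity 𝒜) s) := by
  refine .of_mul (fun n t ht => tensor_map_mem (f := tensorMap (k ∘ₗ parity 𝒜) s)
    (fun i j hij a ha b hb =>
      tmul_mem_of_eq (hk.map_mem i _ (parity_mem 𝒜 ha)) (h.map_mem j b hb) (by omega)) ht)
    (fun t => ?_) (fun t t' => ?_)
  · induction t using tensor_induction with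
    | h0 => simp
    | add x y hx hy =>
      simp only [map_add] at hx hy ⊢
      rw [add_add_add_comm, hx, hy]; abel
    | tmul a b =>
      simp only [tensorDiff_tmul, map_add, tensorMap_tmul, LinearMap.comp_apply, hk.map_parity,
        parity_parity, hA.parity_diff, ← tmul_sub_right, ← h.homotopy_apply, tmul_add_right,
        map_neg, hk.comm_apply]
      rw [show -dA' (k (parity 𝒜 a)) = 0 - dA' (k (parity 𝒜 a)) by abel, tmul_sub_left,
        tmul_zero_left]
      abel
  · induction t using tensor_homogeneous_induction with
    | h0 => simp
    | add x y hx hy => simp only [add_mul, map_add, hx, hy]; abel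
    | tmul i j a ha b hb =>
      induction t' using tensor_homogeneous_induction with
      | h0 => simp
      | add x y hx hy => simp only [mul_add, map_add, hx, hy]; abel
      | tmul l m a' ha' b' hb' =>
        rw [tmul_mul_tmul _ hb ha', map_smul, parity_tmul]
        simp only [tensorMap_tmul, LinearMap.comp_apply]
        rw [tmul_mul_tmul _ (hf.map_mem _ _ (parity_mem ℬ hb)) (hk.map_mem _ _ (parity_mem 𝒜 ha')),
          tmul_mul_tmul _ (h.map_mem _ _ hb) (hk.map_mem _ _ ha'), h.map_mul', parity_mul,
          hk.map_mul, tmul_add_right, smul_add, parity_of_mem 𝒜 ha', map_smul, mul_smul_comm,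
          tmul_smul_left, tmul_smul_left, smul_smul, smul_smul, ← pow_add]
        congr 3
        rw [add_mul, one_mul]

theorem DerivationHomotopic.tensorRight {dA : A →ₗ[R] A} {dB : B →ₗ[R] B} {dA' : A' →ₗ[R] A'}
    {dB' : B' →ₗ[R] B'} {f g : A →ₗ[R] A'} {k : B →ₗ[R] B'}
    (h : DerivationHomotopic 𝒜 dA 𝒜' dA' f g) (hk : IsDGAMap ℬ dB ℬ' dB' k) :
    DerivationHomotopic (tensorGr 𝒜 ℬ) (tensorDiff 𝒜 ℬ dA dB) (tensorGr 𝒜' ℬ')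
      (tensorDiff 𝒜' ℬ' dA' dB') (tensorMap f k) (tensorMap g k) :=
  h.map (fun f => tensorMap f k) (fun _ hf => hf.tensor hk)
    fun _ _ _ _ hg h => ⟨_, h.tensorRight hg hk⟩

theorem DerivationHomotopic.tensorLeft {dA : A →ₗ[R] A} {dB : B →ₗ[R] B} {dA' : A' →ₗ[R] A'}
    {dB' : B' →ₗ[R] B'} {f g : B →ₗ[R] B'} {k : A →ₗ[R] A'}
    (h : DerivationHomotopic ℬ dB ℬ' dB' f g) (hk : IsDGAMap 𝒜 dA 𝒜' dA' k) (hA : IsDGA 𝒜 dA) :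
    DerivationHomotopic (tensorGr 𝒜 ℬ) (tensorDiff 𝒜 ℬ dA dB) (tensorGr 𝒜' ℬ')
      (tensorDiff 𝒜' ℬ' dA' dB') (tensorMap k f) (tensorMap k g) :=
  h.map (fun f => tensorMap k f) (fun _ hf => hk.tensor hf)
    fun _ _ _ hf _ h => ⟨_, h.tensorLeft hf hk hA⟩

end TensorBasics

/-! ### Twisted derivations -/

section Twisted

variable {R : Type u} [CommRing R] {P : Type*} {N : Type*} [Ring P] [Ring N] [Algebra R P]
  [Algebra R N]

/-- `s (x y) = a x s y + s x b y`: a derivation along the pair of algebra maps `(a, b)`.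
A differential is a derivation along (parity, identity), an `(f, g)`-derivation homotopy is one
along (`f` after parity, `g`), and the difference `u - l` of two algebra maps is one along
`(l, u)`. -/
def IsTwistedDer (a b : P →ₐ[R] N) (s : P →ₗ[R] N) : Prop :=
  ∀ x y, s (x * y) = a x * s y + s x * b y

theorem IsTwistedDer.map_one {a b : P →ₐ[R] N} {s : P →ₗ[R] N} (h : IsTwistedDer a b s) :
    s 1 = 0 := by
  have := h 1 1
  rw [mul_one, _root_.map_one a, _root_.map_one b, one_mul, mul_one] at this
  simpa using this

theorem IsTwistedDer.map_algebraMap {a b : P →ₐ[R] N} {s : P →ₗ[R] N} (h : IsTwistedDer a b s)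
    (r : R) : s (algebraMap R P r) = 0 := by
  rw [Algebra.algebraMap_eq_smul_one, map_smul, h.map_one, smul_zero]

/-- A twisted derivation that vanishes on generators vanishes. -/
theorem IsTwistedDer.eq_zero {a b : P →ₐ[R] N} {s : P →ₗ[R] N} (h : IsTwistedDer a b s)
    {S : Set P} (hS : ∀ x ∈ S, s x = 0) {x : P} (hx : x ∈ Algebra.adjoin R S) : s x = 0 := by
  induction hx using Algebra.adjoin_induction with
  | mem x hx => exact hS x hx
  | algebraMap r => exact h.map_algebraMap r
  | add x y _ _ hx hy => rw [map_add, hx, hy, add_zero]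
  | mul x y _ _ hx hy => rw [h, hx, hy, mul_zero, zero_mul, add_zero]

theorem IsTwistedDer.sub {a b : P →ₐ[R] N} {s s' : P →ₗ[R] N} (h : IsTwistedDer a b s)
    (h' : IsTwistedDer a b s') : IsTwistedDer a b (s - s') := fun x y => by
  simp only [LinearMap.sub_apply, h x y, h' x y, mul_sub, sub_mul]; abel

/-- Twisted derivations that agree on generators agree, even along different pairs of maps. -/
theorem IsTwistedDer.eqOn {a b a' b' : P →ₐ[R] N} {s s' : P →ₗ[R] N} (h : IsTwistedDer a b s)
    (h' : IsTwistedDer a' b' s') {S : Set P} (ha : ∀ x ∈ S, a x = a' x) (hb : ∀ x ∈ S, b x = b' x)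
    (hS : ∀ x ∈ S, s x = s' x) {x : P} (hx : x ∈ Algebra.adjoin R S) : s x = s' x := by
  have key : ∀ x ∈ Algebra.adjoin R S, a x = a' x ∧ b x = b' x ∧ s x = s' x := by
    intro x hx
    induction hx using Algebra.adjoin_induction with
    | mem x hx => exact ⟨ha x hx, hb x hx, hS x hx⟩
    | algebraMap r => simp [h.map_algebraMap, h'.map_algebraMap]
    | add x y _ _ hx hy => simp only [map_add, hx, hy, and_self]
    | mul x y _ _ hx hy => simp only [map_mul, h x y, h' x y, hx, hy, and_self]
  exact (key x hx).2.2

theorem algHom_eqOn_adjoin {a b : P →ₐ[R] N} {S : Set P} (h : ∀ x ∈ S, a x = b x) {x : P}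
    (hx : x ∈ Algebra.adjoin R S) : a x = b x :=
  (AlgHom.eqOn_adjoin_iff (φ := a) (ψ := b)).2 h hx

end Twisted

/-! ### Free algebras -/

section Free

variable {R : Type u} [CommRing R] {P : Type*} {N : Type*} [Ring P] [Ring N] [Algebra R P]
  [Algebra R N] {X : Type*}

/-- `x` is a family of free generators of the algebra `P`. -/
def IsFreeOn (R : Type*) [CommRing R] {P : Type*} [Ring P] [Algebra R P] {X : Type*} (x : X → P) :
    Prop :=
  Function.Bijective (FreeAlgebra.lift R x)

variable {x : X → P}

/-- The algebra map with prescribed values on free generators. -/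
def IsFreeOn.lift (hx : IsFreeOn R x) (g : X → N) : P →ₐ[R] N :=
  (FreeAlgebra.lift R g).comp (AlgEquiv.ofBijective (FreeAlgebra.lift R x) hx).symm.toAlgHom

@[simp] theorem IsFreeOn.lift_apply (hx : IsFreeOn R x) (g : X → N) (i : X) : hx.lift g
    (x i) = g i := by
  have : (AlgEquiv.ofBijective (FreeAlgebra.lift R x) hx).symm (x i) = FreeAlgebra.ι R i := by
    rw [AlgEquiv.symm_apply_eq]
    exact (FreeAlgebra.lift_ι_apply x i).symm
  change FreeAlgebra.lift R g ((AlgEquiv.ofBijective (FreeAlgebra.lift R x) hx).symm (x i)) = g i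
  rw [this, FreeAlgebra.lift_ι_apply]

theorem IsFreeOn.adjoin_eq_top (hx : IsFreeOn R x) : Algebra.adjoin R (Set.range x) = ⊤ := by
  have h := FreeAlgebra.adjoin_range_ι R X
  have h2 := congrArg (Subalgebra.map (FreeAlgebra.lift R x)) h
  rw [AlgHom.map_adjoin, Algebra.map_top, (AlgHom.range_eq_top _).2 hx.2, ← Set.range_comp] at h2
  rw [← h2]
  congr 2
  ext i
  simp

theorem IsFreeOn.hom_ext (hx : IsFreeOn R x) {a b : P →ₐ[R] N} (h : ∀ i, a (x i) = b (x i)) :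
    a = b :=
  AlgHom.ext_of_adjoin_eq_top (IsFreeOn.adjoin_eq_top hx) (by rintro _ ⟨i, rfl⟩; exact h i)

theorem IsFreeOn.twistedDer_ext (hx : IsFreeOn R x) {a b : P →ₐ[R] N} {s s' : P →ₗ[R] N}
    (h : IsTwistedDer a b s)
    (h' : IsTwistedDer a b s') (hs : ∀ i, s (x i) = s' (x i)) : s = s' := by
  refine LinearMap.ext fun y => sub_eq_zero.1 ?_
  refine (h.sub h').eq_zero (S := Set.range x) ?_ (by rw [hx.adjoin_eq_top]; trivial)
  rintro _ ⟨i, rfl⟩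
  rw [LinearMap.sub_apply, hs, sub_self]

/-- Twisted derivations with prescribed values on free generators, from the algebra map
`x ↦ !![a x, s x; 0, b x]`. -/
theorem IsFreeOn.exists_twistedDer (hx : IsFreeOn R x) (a b : P →ₐ[R] N) (t : X → N) :
    ∃ s : P →ₗ[R] N, IsTwistedDer a b s ∧ ∀ i, s (x i) = t i := by
  let M : P →ₐ[R] Matrix (Fin 2) (Fin 2) N := hx.lift fun i => !![a (x i), t i; 0, b (x i)]
  have hM : ∀ y, M y 0 0 = a y ∧ M y 1 0 = 0 ∧ M y 1 1 = b y := by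
    intro y
    have hy : y ∈ Algebra.adjoin R (Set.range x) := by rw [hx.adjoin_eq_top]; trivial
    induction hy using Algebra.adjoin_induction with
    | mem y hy =>
      obtain ⟨i, rfl⟩ := hy
      simp [M]
    | algebraMap r => simp [Matrix.algebraMap_matrix_apply]
    | add y z _ _ hy hz => simp [hy, hz]
    | mul y z _ _ hy hz => simp [Matrix.mul_apply, Fin.sum_univ_two, hy, hz]
  refine ⟨Matrix.entryLinearMap R N 0 1 ∘ₗ M.toLinearMap, fun y z => ?_, fun i => ?_⟩
  · simp [Matrix.mul_apply, Fin.sum_univ_two, hM]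
  · simp [M]

/-- The twisted derivation with prescribed values on free generators. -/
def IsFreeOn.der (hx : IsFreeOn R x) (a b : P →ₐ[R] N) (t : X → N) : P →ₗ[R] N :=
  (hx.exists_twistedDer a b t).choose

theorem IsFreeOn.isTwistedDer_der (hx : IsFreeOn R x) (a b : P →ₐ[R] N) (t : X → N) :
    IsTwistedDer a b (hx.der a b t) := (hx.exists_twistedDer a b t).choose_spec.1

@[simp] theorem IsFreeOn.der_apply (hx : IsFreeOn R x) (a b : P →ₐ[R] N) (t : X → N) (i : X) :
    hx.der a b t (x i) = t i := (hx.exists_twistedDer a b t).choose_spec.2 i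

variable {𝒢 : ℕ → Submodule R P} [GradedAlgebra 𝒢]

/-- If the free generators are homogeneous, then every property of homogeneous elements that is
linear and multiplicative follows from the case of generators. -/
theorem IsFreeOn.homogeneous_span (hx : IsFreeOn R x) {deg : X → ℕ} (hdeg : ∀ i, x i ∈ 𝒢 (deg i))
    {p : ℕ → Submodule R P} (h1 : (1 : P) ∈ p 0)
    (hmul : ∀ m n, ∀ y ∈ 𝒢 m, ∀ z ∈ 𝒢 n, y ∈ p m → z ∈ p n → y * z ∈ p (m + n))
    (hgen : ∀ i, x i ∈ p (deg i)) (n : ℕ) (y : P) (hy : y ∈ 𝒢 n) : y ∈ p n := by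
  have key : ∀ n, GradedAlgebra.proj 𝒢 n y ∈ p n := by
    have hy : y ∈ Algebra.adjoin R (Set.range x) := by rw [hx.adjoin_eq_top]; trivial
    clear * - hy h1 hmul hgen hdeg
    induction hy using Algebra.adjoin_induction with
    | mem y hy =>
      obtain ⟨i, rfl⟩ := hy
      intro n
      by_cases h : deg i = n
      · subst h; rw [proj_of_mem 𝒢 (hdeg i)]; exact hgen i
      · rw [proj_of_mem_ne 𝒢 (hdeg i) h]; exact Submodule.zero_mem _
    | algebraMap r =>
      intro n
      rw [Algebra.algebraMap_eq_smul_one, map_smul]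
      refine Submodule.smul_mem _ _ ?_
      rcases n with _ | n
      · rw [proj_of_mem 𝒢 (SetLike.one_mem_graded 𝒢)]; exact h1
      · rw [proj_of_mem_ne 𝒢 (SetLike.one_mem_graded 𝒢) (by omega)]; exact Submodule.zero_mem _
    | add y z _ _ hy hz => intro n; rw [map_add]; exact Submodule.add_mem _ (hy n) (hz n)
    | mul y z _ _ hy hz =>
      intro n
      obtain ⟨N, hN⟩ := sum_proj 𝒢 y
      obtain ⟨N', hN'⟩ := sum_proj 𝒢 z
      rw [← hN N le_rfl, ← hN' N' le_rfl, Finset.sum_mul_sum, map_sum]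
      refine Submodule.sum_mem _ fun i _ => ?_
      rw [map_sum]
      refine Submodule.sum_mem _ fun j _ => ?_
      have hij := SetLike.mul_mem_graded (A := 𝒢) (proj_mem 𝒢 i y) (proj_mem 𝒢 j z)
      by_cases h : i + j = n
      · subst h
        rw [proj_of_mem 𝒢 hij]
        exact hmul i j _ (proj_mem 𝒢 i y) _ (proj_mem 𝒢 j z) (hy i) (hz j)
      · rw [proj_of_mem_ne 𝒢 hij h]; exact Submodule.zero_mem _
  have := key n
  rwa [proj_of_mem 𝒢 hy] at this

theorem IsFreeOn.der_mem (hx : IsFreeOn R x) {deg : X → ℕ} (hdeg : ∀ i, x i ∈ 𝒢 (deg i))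
    {a b : P →ₐ[R] N}
    {s : P →ₗ[R] N} (hs : IsTwistedDer a b s) (Q : ℕ → Submodule R N)
    (ha : ∀ m n, ∀ y ∈ 𝒢 m, ∀ z ∈ Q n, a y * z ∈ Q (m + n))
    (hb : ∀ m n, ∀ z ∈ Q m, ∀ y ∈ 𝒢 n, z * b y ∈ Q (m + n))
    (hgen : ∀ i, s (x i) ∈ Q (deg i)) (n : ℕ) (y : P) (hy : y ∈ 𝒢 n) : s y ∈ Q n := by
  refine hx.homogeneous_span hdeg (p := fun n => (Q n).comap s) ?_ ?_ hgen n y hy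
  · rw [Submodule.mem_comap, hs.map_one]; exact Submodule.zero_mem _
  · intro m n y hym z hzn hy hz
    rw [Submodule.mem_comap, hs]
    exact Submodule.add_mem _ (ha m n y hym _ hz) (hb m n _ hy z hzn)

theorem IsFreeOn.hom_mem (hx : IsFreeOn R x) {deg : X → ℕ} (hdeg : ∀ i, x i ∈ 𝒢 (deg i))
    (a : P →ₐ[R] N)
    (Q : ℕ → Submodule R N) (h1 : (1 : N) ∈ Q 0)
    (hmul : ∀ m n, ∀ y ∈ Q m, ∀ z ∈ Q n, y * z ∈ Q (m + n))
    (hgen : ∀ i, a (x i) ∈ Q (deg i)) (n : ℕ) (y : P) (hy : y ∈ 𝒢 n) : a y ∈ Q n := by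
  refine hx.homogeneous_span hdeg (p := fun n => (Q n).comap a.toLinearMap) ?_ ?_ hgen n y hy
  · rw [Submodule.mem_comap, AlgHom.toLinearMap_apply, map_one]; exact h1
  · intro m n y _ z _ hy hz
    rw [Submodule.mem_comap, AlgHom.toLinearMap_apply, map_mul]
    exact hmul m n _ hy _ hz

/-- Elements of degree less than `q` lie in the subalgebra of the generators of degree less than
`q`. -/
theorem IsFreeOn.mem_adjoin (hx : IsFreeOn R x) {deg : X → ℕ} (hdeg : ∀ i, x i ∈ 𝒢 (deg i))
    {q n : ℕ} (h : n < q)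
    {y : P} (hy : y ∈ 𝒢 n) : y ∈ Algebra.adjoin R (x '' {i | deg i < q}) := by
  have key := hx.homogeneous_span hdeg
    (p := fun n => if n < q then Subalgebra.toSubmodule (Algebra.adjoin R (x '' {i | deg i < q}))
      else ⊤) ?_ ?_ ?_ n y hy
  · rwa [if_pos h] at key
  · split_ifs
    · exact one_mem (Algebra.adjoin R (x '' {i | deg i < q}))
    · trivial
  · intro m n y _ z _ hy hz
    split_ifs with hmn
    · rw [if_pos (by omega)] at hy hz
      exact mul_mem (S := Subalgebra R P) hy hz
    · trivial
  · intro i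
    split_ifs with hi
    · exact Algebra.subset_adjoin ⟨i, hi, rfl⟩
    · trivial

end Free

/-! ### Choosing values on generators level by level -/

/-- Values on generators can be chosen one level at a time, if the condition on the value at `i`
depends only on the values at lower levels, and can be met once those satisfy it. -/
theorem exists_of_levelwise {X V : Type*} (lev : X → ℕ) (T : X → V → Prop)
    (Good : (X → V) → X → V → Prop) (h0 : ∀ i, ∃ a, T i a)
    (congr : ∀ v v' i a, T i a → (∀ j, lev j < lev i → v j = v' j) → Good v i a → Good v' i a)
    (step : ∀ v i, (∀ j, T j (v j)) → (∀ j, lev j < lev i → Good v j (v j)) →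
      ∃ a, T i a ∧ Good v i a) :
    ∃ v, ∀ i, T i (v i) ∧ Good v i (v i) := by
  classical
  choose v0 hv0 using h0
  let ext : (i : X) → ((j : X) → lev j < lev i → V) → X → V :=
    fun i w j => if h : lev j < lev i then w j h else v0 j
  let v : X → V := WellFounded.fix (InvImage.wf lev Nat.lt_wfRel.wf) fun i w =>
    if h : ∃ a, T i a ∧ Good (ext i w) i a then h.choose else v0 i
  have hv : ∀ i, v i = if h : ∃ a, T i a ∧ Good (ext i fun j _ => v j) i a then h.choose
      else v0 i := fun i => WellFounded.fix_eq _ _ i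
  have hT : ∀ i, T i (v i) := by
    intro i
    rw [hv]
    split_ifs with h
    · exact h.choose_spec.1
    · exact hv0 i
  refine ⟨v, fun i => ⟨hT i, ?_⟩⟩
  induction hi : lev i using Nat.strong_induction_on generalizing i with
  | _ n ih =>
    subst hi
    have hext : ∀ i j, lev j < lev i → v j = ext i (fun j _ => v j) j := fun i j h => by
      simp only [ext, dif_pos h]
    have hextT : ∀ j, T j (ext i (fun j _ => v j) j) := fun j => by
      simp only [ext]
      split_ifs
      · exact hT j
      · exact hv0 j
    have ex : ∃ a, T i a ∧ Good (ext i fun j _ => v j) i a := by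
      refine step _ i hextT fun j hj => ?_
      have h1 := ih (lev j) hj j rfl
      rw [← hext i j hj]
      exact congr v _ j _ (hT j) (fun k hk => hext i k (hk.trans hj)) h1
    have h2 := ex.choose_spec.2
    have h3 : v i = ex.choose := by rw [hv, dif_pos ex]
    rw [← h3] at h2
    exact congr _ v i _ (hT i) (fun j hj => (hext i j hj).symm) h2

/-! ### Weak equivalences -/

section WeakEquiv

variable {R : Type u} [CommRing R]
variable {A : Type*} {B : Type*} {C : Type*} {A' : Type*} {B' : Type*}
variable [Ring A] [Ring B] [Ring C] [Ring A'] [Ring B']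
variable [Algebra R A] [Algebra R B] [Algebra R C] [Algebra R A'] [Algebra R B']

theorem Homology.mk_eq_zero {d : A →ₗ[R] A} {z : LinearMap.ker d} :
    Homology.mk d z = 0 ↔ ∃ w, d w = z := by
  rw [Submodule.mkQ_apply, Submodule.Quotient.mk_eq_zero]
  exact Iff.rfl

theorem Homology.mk_eq_mk {d : A →ₗ[R] A} {z z' : LinearMap.ker d} :
    Homology.mk d z = Homology.mk d z' ↔ ∃ w, d w = z - z' := by
  rw [← sub_eq_zero, ← map_sub, Homology.mk_eq_zero]
  rfl

theorem Homology.mk_surjective (d : A →ₗ[R] A) : Function.Surjective (Homology.mk d) :=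
  Submodule.mkQ_surjective _

/-- A weak equivalence in terms of elements: every cycle is homologous to an image of a cycle, and
cycles with bounding image bound. -/
theorem isWeakEquiv_iff {dA : A →ₗ[R] A} {dB : B →ₗ[R] B} {f : A →ₗ[R] B} :
    IsWeakEquiv dA dB f ↔ (∀ x, f (dA x) = dB (f x)) ∧
      (∀ a b, dA a = 0 → f a = dB b → ∃ a', dA a' = a) ∧
      (∀ b, dB b = 0 → ∃ a b', dA a = 0 ∧ b = f a + dB b') := by
  constructor
  · rintro ⟨hf, hinj, hsurj⟩
    refine ⟨fun x => LinearMap.congr_fun hf x, fun a b ha hab => ?_, fun b hb => ?_⟩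
    · refine (Homology.mk_eq_zero (z := ⟨a, ha⟩)).1 (hinj ?_)
      rw [map_zero]
      exact Homology.mk_eq_zero.2 ⟨b, hab.symm⟩
    · obtain ⟨h, hh⟩ := hsurj (Homology.mk dB ⟨b, hb⟩)
      obtain ⟨⟨a, ha⟩, rfl⟩ := Homology.mk_surjective dA h
      obtain ⟨w, hw⟩ := Homology.mk_eq_mk.1 hh.symm
      exact ⟨a, w, ha, by rw [hw]; exact (add_sub_cancel _ _).symm⟩
  · rintro ⟨hf, hinj, hsurj⟩
    refine ⟨LinearMap.ext hf, ?_, ?_⟩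
    · rw [← LinearMap.ker_eq_bot, LinearMap.ker_eq_bot']
      intro h hh
      obtain ⟨⟨a, ha⟩, rfl⟩ := Homology.mk_surjective dA h
      obtain ⟨w, hw⟩ := Homology.mk_eq_zero.1 hh
      exact Homology.mk_eq_zero.2 (hinj a w ha hw.symm)
    · intro h
      obtain ⟨⟨b, hb⟩, rfl⟩ := Homology.mk_surjective dB h
      obtain ⟨a, b', ha, hab⟩ := hsurj b hb
      exact ⟨Homology.mk dA ⟨a, ha⟩, Homology.mk_eq_mk.2 ⟨-b', by
        change dB (-b') = f a - b
        rw [hab, map_neg]; abel⟩⟩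

/-- The mapping cone of a weak equivalence is acyclic. -/
theorem IsWeakEquiv.cone {dA : A →ₗ[R] A} {dB : B →ₗ[R] B} {f : A →ₗ[R] B}
    (h : IsWeakEquiv dA dB f) {a : A} {b : B} (ha : dA a = 0) (hab : f a = dB b) :
    ∃ a' b', dA a' = a ∧ f a' - dB b' = b := by
  obtain ⟨hf, hinj, hsurj⟩ := isWeakEquiv_iff.1 h
  obtain ⟨a₁, ha₁⟩ := hinj a b ha hab
  obtain ⟨c, b', hc, hb'⟩ := hsurj (f a₁ - b) (by rw [map_sub, ← hf, ha₁, hab, sub_self])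
  refine ⟨a₁ - c, b', by rw [map_sub, ha₁, hc, sub_zero], ?_⟩
  rw [map_sub, sub_sub, ← hb', sub_sub_cancel]

theorem isWeakEquiv_of_cone {dA : A →ₗ[R] A} {dB : B →ₗ[R] B} {f : A →ₗ[R] B}
    (hf : ∀ x, f (dA x) = dB (f x))
    (h : ∀ a b, dA a = 0 → f a = dB b → ∃ a' b', dA a' = a ∧ f a' - dB b' = b) :
    IsWeakEquiv dA dB f := by
  refine isWeakEquiv_iff.2 ⟨hf, fun a b ha hab => ?_, fun b hb => ?_⟩
  · obtain ⟨a', _, h', _⟩ := h a b ha hab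
    exact ⟨a', h'⟩
  · obtain ⟨a', b', h1, h2⟩ := h 0 b (map_zero _) (by rw [map_zero, hb])
    exact ⟨a', -b', h1, by rw [map_neg, ← h2, sub_eq_add_neg]⟩

theorem IsWeakEquiv.comp {dA : A →ₗ[R] A} {dB : B →ₗ[R] B} {dC : C →ₗ[R] C} {f : A →ₗ[R] B}
    {g : B →ₗ[R] C} (hg : IsWeakEquiv dB dC g) (hf : IsWeakEquiv dA dB f) :
    IsWeakEquiv dA dC (g ∘ₗ f) := by
  obtain ⟨hf0, hf1, hf2⟩ := isWeakEquiv_iff.1 hf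
  obtain ⟨hg0, hg1, hg2⟩ := isWeakEquiv_iff.1 hg
  refine isWeakEquiv_iff.2 ⟨fun x => ?_, fun a c ha hac => ?_, fun c hc => ?_⟩
  · simp only [LinearMap.comp_apply, hf0, hg0]
  · obtain ⟨b, hb⟩ := hg1 (f a) c (by rw [← hf0, ha, map_zero]) hac
    exact hf1 a b ha hb.symm
  · obtain ⟨b, c', hb, hc'⟩ := hg2 c hc
    obtain ⟨a, b', ha, hb'⟩ := hf2 b hb
    refine ⟨a, g b' + c', ha, ?_⟩
    rw [hc', hb', map_add, map_add, LinearMap.comp_apply, hg0, add_assoc]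

theorem IsWeakEquiv.id (d : A →ₗ[R] A) : IsWeakEquiv d d LinearMap.id :=
  isWeakEquiv_iff.2 ⟨fun _ => rfl, fun _ b _ h => ⟨b, h.symm⟩, fun b hb =>
    ⟨b, 0, hb, by rw [map_zero, add_zero]; rfl⟩⟩

/-- Two out of three: the source map is a weak equivalence if the composite and the target map are.
-/
theorem IsWeakEquiv.of_comp {dA : A →ₗ[R] A} {dB : B →ₗ[R] B} {dC : C →ₗ[R] C} {f : A →ₗ[R] B}
    {g : B →ₗ[R] C} (hg : IsWeakEquiv dB dC g) (hf0 : ∀ x, f (dA x) = dB (f x))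
    (h : IsWeakEquiv dA dC (g ∘ₗ f)) : IsWeakEquiv dA dB f := by
  obtain ⟨_, h1, h2⟩ := isWeakEquiv_iff.1 h
  obtain ⟨hg0, hg1, hg2⟩ := isWeakEquiv_iff.1 hg
  refine isWeakEquiv_iff.2 ⟨hf0, fun a b ha hab => ?_, fun b hb => ?_⟩
  · exact h1 a (g b) ha (by rw [LinearMap.comp_apply, hab, hg0])
  · obtain ⟨a, c, ha, hc⟩ := h2 (g b) (by rw [← hg0, hb, map_zero])
    obtain ⟨b', hb'⟩ := hg1 (b - f a) c (by rw [map_sub, hb, ← hf0, ha, map_zero, sub_zero])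
      (by rw [map_sub, hc, LinearMap.comp_apply, add_sub_cancel_left])
    exact ⟨a, b', ha, by rw [hb', add_sub_cancel]⟩

/-- A chain map that agrees on homology with a weak equivalence is a weak equivalence. -/
theorem IsWeakEquiv.of_homotopy {dA : A →ₗ[R] A} {dB : B →ₗ[R] B} {f g : A →ₗ[R] B}
    (hf : IsWeakEquiv dA dB f) (hg0 : ∀ x, g (dA x) = dB (g x))
    (h : ∀ z, dA z = 0 → ∃ w, dB w = f z - g z) : IsWeakEquiv dA dB g := by
  obtain ⟨hf0, hf1, hf2⟩ := isWeakEquiv_iff.1 hf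
  refine isWeakEquiv_iff.2 ⟨hg0, fun a b ha hab => ?_, fun b hb => ?_⟩
  · obtain ⟨w, hw⟩ := h a ha
    exact hf1 a (b + w) ha (by rw [map_add, hw, hab, add_sub_cancel])
  · obtain ⟨a, b', ha, hb'⟩ := hf2 b hb
    obtain ⟨w, hw⟩ := h a ha
    exact ⟨a, w + b', ha, by rw [hb', map_add, hw]; abel⟩

/-- Derivation homotopic maps agree on homology. -/
theorem DerivationHomotopic.homologous {𝒜 : ℕ → Submodule R A} {ℬ : ℕ → Submodule R B}
    {dA : A →ₗ[R] A} {dB : B →ₗ[R] B} {f g : A →ₗ[R] B}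
    (h : DerivationHomotopic 𝒜 dA ℬ dB f g) (z : A) (hz : dA z = 0) : ∃ w, dB w = f z - g z := by
  induction h with
  | rel f g h =>
    obtain ⟨_, _, s, hs⟩ := h
    refine ⟨s z, ?_⟩
    have := LinearMap.congr_fun hs.homotopy z
    simpa [hz] using this
  | refl f => exact ⟨0, by simp⟩
  | symm f g _ ih =>
    obtain ⟨w, hw⟩ := ih
    exact ⟨-w, by rw [map_neg, hw, neg_sub]⟩
  | trans f g h _ _ ih ih' =>
    obtain ⟨w, hw⟩ := ih
    obtain ⟨w', hw'⟩ := ih'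
    exact ⟨w + w', by rw [map_add, hw, hw', sub_add_sub_cancel]⟩

/-! ### The Künneth theorem for weak equivalences -/

/-- If `(C, D)` is acyclic and `B` is flat and graded by the natural numbers, with `δ` of degree
`-1`, then `(C ⊗ B, D ⊗ 1 + τ ⊗ δ)` is acyclic: the component of a cycle of highest degree in `B` is
a cycle, hence a boundary, for `D ⊗ 1`. -/
theorem acyclic_tensor {M : Type*} [AddCommGroup M] [Module R M] (ℬ : ℕ → Submodule R B)
    [GradedAlgebra ℬ] [Module.Flat R B] (D τ : M →ₗ[R] M) (δ : B →ₗ[R] B)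
    (hD : ∀ c, D c = 0 → ∃ c', D c' = c) (hD2 : D ∘ₗ D = 0) (hτ : D ∘ₗ τ = -(τ ∘ₗ D))
    (hδ2 : δ ∘ₗ δ = 0) (hδ0 : ∀ x ∈ ℬ 0, δ x = 0) (hδ : ∀ n, ∀ x ∈ ℬ (n + 1), δ x ∈ ℬ n)
    (z : M ⊗[R] B)
    (hz : (TensorProduct.map D LinearMap.id + TensorProduct.map τ δ :
      M ⊗[R] B →ₗ[R] M ⊗[R] B) z = 0) :
    ∃ w, (TensorProduct.map D LinearMap.id + TensorProduct.map τ δ : M ⊗[R] B →ₗ[R] M ⊗[R] B) w =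
      z := by
  set T : M ⊗[R] B →ₗ[R] M ⊗[R] B :=
    TensorProduct.map D LinearMap.id + TensorProduct.map τ δ with hT
  have hTT : ∀ w, T (T w) = 0 := by
    have : T ∘ₗ T = 0 := by
      refine TensorProduct.ext' fun m b => ?_
      have h1 := LinearMap.congr_fun hD2 m
      have h2 := LinearMap.congr_fun hδ2 b
      have h3 := LinearMap.congr_fun hτ m
      simp only [LinearMap.comp_apply, LinearMap.zero_apply, LinearMap.neg_apply] at h1 h2 h3
      simp [hT, h1, h2, h3, TensorProduct.neg_tmul]
    exact fun w => LinearMap.congr_fun this w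
  let π : ℕ → M ⊗[R] B →ₗ[R] M ⊗[R] B := fun j => LinearMap.lTensor M (GradedAlgebra.proj ℬ j)
  have hπT : ∀ j w, π j (T w) = TensorProduct.map D LinearMap.id (π j w) +
      TensorProduct.map τ δ (π (j + 1) w) := by
    intro j w
    induction w using TensorProduct.induction_on with
    | zero => simp
    | add x y hx hy => simp only [map_add, hx, hy]; abel
    | tmul m b => simp [π, hT, proj_map_of_degree_neg_one hδ0 hδ]
  have hππ : ∀ i j w, π i (π j w) = if i = j then π j w else 0 := by
    intro i j w
    induction w using TensorProduct.induction_on with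
    | zero => simp
    | add x y hx hy => simp only [map_add, hx, hy]; split_ifs <;> simp
    | tmul m b =>
      simp only [π, LinearMap.lTensor_tmul]
      split_ifs with h
      · subst h; rw [proj_of_mem ℬ (proj_mem ℬ _ b)]
      · rw [proj_of_mem_ne ℬ (proj_mem ℬ _ b) (Ne.symm h), TensorProduct.tmul_zero]
  have hπsum : ∀ w, ∃ N, ∀ L ≥ N, ∑ i ∈ Finset.range L, π i w = w := by
    intro w
    induction w using TensorProduct.induction_on with
    | zero => exact ⟨0, by simp⟩
    | add x y hx hy =>
      obtain ⟨N, hN⟩ := hx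
      obtain ⟨N', hN'⟩ := hy
      refine ⟨max N N', fun L hL => ?_⟩
      simp only [map_add, Finset.sum_add_distrib]
      rw [hN L (le_trans (le_max_left _ _) hL), hN' L (le_trans (le_max_right _ _) hL)]
    | tmul m b =>
      obtain ⟨N, hN⟩ := sum_proj ℬ b
      refine ⟨N, fun L hL => ?_⟩
      simp only [π, LinearMap.lTensor_tmul]
      rw [← TensorProduct.tmul_sum, hN L hL]
  have hexact : ∀ w : M ⊗[R] B, TensorProduct.map D LinearMap.id w = 0 →
      ∃ w', TensorProduct.map D LinearMap.id w' = w := by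
    have h : Function.Exact D D := fun c =>
      ⟨fun h => hD c h, by rintro ⟨c', rfl⟩; exact LinearMap.congr_fun hD2 c'⟩
    exact fun w hw => (Module.Flat.rTensor_exact B h w).1 hw
  have main : ∀ N z, T z = 0 → (∀ i ≥ N, π i z = 0) → ∃ w, T w = z := by
    intro N
    induction N with
    | zero =>
      intro z _ h
      obtain ⟨N, hN⟩ := hπsum z
      refine ⟨0, ?_⟩
      rw [map_zero, ← hN N le_rfl]
      exact (Finset.sum_eq_zero fun i _ => h i (Nat.zero_le i)).symm
    | succ N ih =>
      intro z hz h
      have h1 := hπT N z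
      rw [hz, map_zero, h (N + 1) le_rfl, map_zero, add_zero] at h1
      obtain ⟨w, hw⟩ := hexact _ h1.symm
      have hw' : TensorProduct.map D LinearMap.id (π N w) = π N z := by
        have h2 := hππ N N z
        rw [if_pos rfl, ← hw] at h2
        rw [← hw, ← h2]
        clear * -
        induction w using TensorProduct.induction_on with
        | zero => simp
        | add x y hx hy => simp only [map_add, hx, hy]
        | tmul m b => simp [π]
      obtain ⟨w₂, hw₂⟩ := ih (z - T (π N w)) (by rw [map_sub, hz, hTT, sub_zero]) (fun i hi => by
        rw [map_sub, hπT, hππ, hππ, if_neg (by omega : i + 1 ≠ N), map_zero, add_zero]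
        split_ifs with hiN
        · subst hiN; rw [hw', sub_self]
        · rw [map_zero, sub_zero, h i (by omega)])
      exact ⟨w₂ + π N w, by rw [map_add, hw₂, sub_add_cancel]⟩
  obtain ⟨N, hN⟩ := hπsum z
  refine main N z hz fun i hi => ?_
  rw [← hN N le_rfl, map_sum]
  refine Finset.sum_eq_zero fun j hj => ?_
  rw [hππ, if_neg (by have := Finset.mem_range.1 hj; omega)]

variable {𝒜 : ℕ → Submodule R A} [GradedAlgebra 𝒜] {ℬ : ℕ → Submodule R B} [GradedAlgebra ℬ]
variable {𝒜' : ℕ → Submodule R A'} [GradedAlgebra 𝒜']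
variable {ℬ' : ℕ → Submodule R B'} [GradedAlgebra ℬ']
variable {dA : A →ₗ[R] A} {dB : B →ₗ[R] B} {dA' : A' →ₗ[R] A'} {dB' : B' →ₗ[R] B'}

theorem IsWeakEquiv.tensorRight {f : A →ₗ[R] A'} (hf : IsDGAMap 𝒜 dA 𝒜' dA' f)
    (hw : IsWeakEquiv dA dA' f) (hA : IsDGA 𝒜 dA) (hA' : IsDGA 𝒜' dA') (hB : IsDGA ℬ dB)
    [Module.Flat R B] :
    IsWeakEquiv (tensorDiff 𝒜 ℬ dA dB) (tensorDiff 𝒜' ℬ dA' dB) (tensorMap f LinearMap.id) := by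
  have hid : IsDGAMap ℬ dB ℬ dB LinearMap.id := IsDGAMap.id dB
  refine isWeakEquiv_of_cone (fun x => (hf.tensor hid).comm_apply x) fun x y hx hxy => ?_
  let D : (A × A') →ₗ[R] (A × A') := LinearMap.prod (dA ∘ₗ LinearMap.fst R A A')
    (f ∘ₗ LinearMap.fst R A A' - dA' ∘ₗ LinearMap.snd R A A')
  let τ : (A × A') →ₗ[R] (A × A') := LinearMap.prod (parity 𝒜 ∘ₗ LinearMap.fst R A A')
    (-(parity 𝒜' ∘ₗ LinearMap.snd R A A'))
  let p₁ : (A × A') ⊗[R] B →ₗ[R] (𝒜 ᵍ⊗[R] ℬ) :=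
    (GradedTensorProduct.of R 𝒜 ℬ).toLinearMap ∘ₗ LinearMap.rTensor B (LinearMap.fst R A A')
  let p₂ : (A × A') ⊗[R] B →ₗ[R] (𝒜' ᵍ⊗[R] ℬ) :=
    (GradedTensorProduct.of R 𝒜' ℬ).toLinearMap ∘ₗ LinearMap.rTensor B (LinearMap.snd R A A')
  let i₁ : (𝒜 ᵍ⊗[R] ℬ) →ₗ[R] (A × A') ⊗[R] B :=
    LinearMap.rTensor B (LinearMap.inl R A A') ∘ₗ (GradedTensorProduct.of R 𝒜 ℬ).symm.toLinearMap
  let i₂ : (𝒜' ᵍ⊗[R] ℬ) →ₗ[R] (A × A') ⊗[R] B :=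
    LinearMap.rTensor B (LinearMap.inr R A A') ∘ₗ (GradedTensorProduct.of R 𝒜' ℬ).symm.toLinearMap
  let T : (A × A') ⊗[R] B →ₗ[R] (A × A') ⊗[R] B :=
    TensorProduct.map D LinearMap.id + TensorProduct.map τ dB
  have hp₁ : ∀ m b, p₁ (m ⊗ₜ b) = m.1 ᵍ⊗ₜ[R] b := fun _ _ => rfl
  have hp₂ : ∀ m b, p₂ (m ⊗ₜ b) = m.2 ᵍ⊗ₜ[R] b := fun _ _ => rfl
  have hi₁ : ∀ a b, i₁ (a ᵍ⊗ₜ[R] b) = (a, (0 : A')) ⊗ₜ b := fun _ _ => rfl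
  have hi₂ : ∀ a b, i₂ (a ᵍ⊗ₜ[R] b) = ((0 : A), a) ⊗ₜ b := fun _ _ => rfl
  have hT : ∀ m b, T (m ⊗ₜ b) = (dA m.1, f m.1 - dA' m.2) ⊗ₜ b +
      (parity 𝒜 m.1, -parity 𝒜' m.2) ⊗ₜ dB b := fun _ _ => rfl
  have h1 : ∀ w, p₁ (T w) = tensorDiff 𝒜 ℬ dA dB (p₁ w) := by
    intro w
    induction w using TensorProduct.induction_on with
    | zero => simp only [map_zero]
    | add x y hx hy => simp only [map_add] at hx hy ⊢; rw [hx, hy]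
    | tmul m b => rw [hT, map_add, hp₁, hp₁, hp₁, tensorDiff_tmul]
  have h2 : ∀ w, p₂ (T w) = tensorMap f LinearMap.id (p₁ w) - tensorDiff 𝒜' ℬ dA' dB (p₂ w) := by
    intro w
    induction w using TensorProduct.induction_on with
    | zero => simp only [map_zero, sub_zero]
    | add x y hx hy => simp only [map_add] at hx hy ⊢; rw [hx, hy]; abel
    | tmul m b =>
      rw [hT, map_add, hp₁, hp₂, hp₂, hp₂, tensorDiff_tmul, tensorMap_tmul, LinearMap.id_apply,
        tmul_sub_left, ← zero_sub (parity 𝒜' m.2), tmul_sub_left, tmul_zero_left]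
      abel
  have hp : ∀ w, p₁ w = 0 → p₂ w = 0 → w = 0 := by
    intro w hw1 hw2
    have : w = i₁ (p₁ w) + i₂ (p₂ w) := by
      clear hw1 hw2
      induction w using TensorProduct.induction_on with
      | zero => simp only [map_zero, add_zero]
      | add x y hx hy =>
        simp only [map_add]
        rw [add_add_add_comm, ← hx, ← hy]
      | tmul m b =>
        rw [hp₁, hp₂, hi₁, hi₂, ← TensorProduct.add_tmul, Prod.mk_add_mk, add_zero, zero_add]
    rw [this, hw1, hw2, map_zero, map_zero, add_zero]
  let z : (A × A') ⊗[R] B := i₁ x + i₂ y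
  have hz1 : p₁ z = x := by
    have e1 : p₁ ∘ₗ i₁ = LinearMap.id := tensor_ext _ _ fun i j a b => rfl
    have e2 : p₁ ∘ₗ i₂ = 0 := tensor_ext _ _ fun i j a b => tmul_zero_left _
    rw [map_add, ← LinearMap.comp_apply, ← LinearMap.comp_apply, e1, e2]
    exact add_zero x
  have hz2 : p₂ z = y := by
    have e1 : p₂ ∘ₗ i₁ = 0 := tensor_ext _ _ fun i j a b => tmul_zero_left _
    have e2 : p₂ ∘ₗ i₂ = LinearMap.id := tensor_ext _ _ fun i j a b => rfl
    rw [map_add, ← LinearMap.comp_apply, ← LinearMap.comp_apply, e1, e2]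
    exact zero_add y
  have hTz : T z = 0 := by
    refine hp _ ?_ ?_
    · rw [h1, hz1, hx]
    · rw [h2, hz1, hz2, hxy, sub_self]
  have hD : ∀ c, D c = 0 → ∃ c', D c' = c := by
    rintro ⟨a, a'⟩ h
    have h1 : dA a = 0 := congrArg Prod.fst h
    have h2 : f a - dA' a' = 0 := congrArg Prod.snd h
    obtain ⟨b, b', h3, h4⟩ := hw.cone h1 (sub_eq_zero.1 h2)
    exact ⟨(b, b'), Prod.ext h3 h4⟩
  have hD2 : D ∘ₗ D = 0 := by
    refine LinearMap.ext fun m => Prod.ext (hA.diff_diff m.1) ?_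
    change f (dA m.1) - dA' (f m.1 - dA' m.2) = 0
    rw [map_sub, hA'.diff_diff, hf.comm_apply, sub_zero, sub_self]
  have hDτ : D ∘ₗ τ = -(τ ∘ₗ D) := by
    refine LinearMap.ext fun m => Prod.ext ?_ ?_
    · change dA (parity 𝒜 m.1) = -parity 𝒜 (dA m.1)
      rw [hA.parity_diff, neg_neg]
    · change f (parity 𝒜 m.1) - dA' (-parity 𝒜' m.2) = - -parity 𝒜' (f m.1 - dA' m.2)
      rw [neg_neg, map_neg, map_sub, hA'.parity_diff, hf.map_parity]
  obtain ⟨w, hw⟩ :=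
    acyclic_tensor ℬ D τ dB hD hD2 hDτ hB.sq_zero hB.map_zero_degree hB.map_mem z hTz
  refine ⟨p₁ w, p₂ w, ?_, ?_⟩
  · rw [← h1, show T w = z from hw, hz1]
  · rw [← h2, show T w = z from hw, hz2]

theorem IsWeakEquiv.tensorLeft {g : B →ₗ[R] B'} (hg : IsDGAMap ℬ dB ℬ' dB' g)
    (hw : IsWeakEquiv dB dB' g) (hA : IsDGA 𝒜 dA) (hB : IsDGA ℬ dB) (hB' : IsDGA ℬ' dB')
    [Module.Flat R A] :
    IsWeakEquiv (tensorDiff 𝒜 ℬ dA dB) (tensorDiff 𝒜 ℬ' dA dB') (tensorMap LinearMap.id g) := by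
  have h1 : IsWeakEquiv (tensorDiff ℬ 𝒜 dB dA) (tensorDiff ℬ' 𝒜 dB' dA)
      (tensorMap g LinearMap.id) := hw.tensorRight hg hB hB' hA
  obtain ⟨_, hi, hs⟩ := isWeakEquiv_iff.1 h1
  have hid : IsDGAMap 𝒜 dA 𝒜 dA LinearMap.id := IsDGAMap.id dA
  have hc := isDGAMap_comm hB hA
  have hc' := isDGAMap_comm hB' hA
  have hcc : ∀ x : ℬ ᵍ⊗[R] 𝒜, GradedTensorProduct.comm ℬ' 𝒜 (tensorMap g LinearMap.id x) =
      tensorMap LinearMap.id g (GradedTensorProduct.comm ℬ 𝒜 x) := by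
    intro x
    induction x using tensor_homogeneous_induction with
    | h0 => simp
    | add x y hx hy => simp only [map_add, hx, hy]
    | tmul i j b hb a ha =>
      rw [comm_tmul hb ha, map_smul, tensorMap_tmul, tensorMap_tmul,
        comm_tmul (hg.map_mem _ _ hb) (hid.map_mem _ _ ha)]
  have hd : ∀ x, GradedTensorProduct.comm ℬ 𝒜 (tensorDiff ℬ 𝒜 dB dA x) =
      tensorDiff 𝒜 ℬ dA dB (GradedTensorProduct.comm ℬ 𝒜 x) := fun x => hc.comm_apply x
  have hd' : ∀ x, GradedTensorProduct.comm ℬ' 𝒜 (tensorDiff ℬ' 𝒜 dB' dA x) =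
      tensorDiff 𝒜 ℬ' dA dB' (GradedTensorProduct.comm ℬ' 𝒜 x) := fun x => hc'.comm_apply x
  refine isWeakEquiv_iff.2 ⟨fun x => (hid.tensor hg).comm_apply x, fun a b ha hab => ?_,
    fun b hb => ?_⟩
  · obtain ⟨a, rfl⟩ := (GradedTensorProduct.comm ℬ 𝒜).surjective a
    obtain ⟨b, rfl⟩ := (GradedTensorProduct.comm ℬ' 𝒜).surjective b
    rw [← hd, EmbeddingLike.map_eq_zero_iff] at ha
    rw [← hcc, ← hd', EmbeddingLike.apply_eq_iff_eq] at hab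
    obtain ⟨a', rfl⟩ := hi a b ha hab
    exact ⟨GradedTensorProduct.comm ℬ 𝒜 a', (hd a').symm⟩
  · obtain ⟨b, rfl⟩ := (GradedTensorProduct.comm ℬ' 𝒜).surjective b
    rw [← hd', EmbeddingLike.map_eq_zero_iff] at hb
    obtain ⟨a, b', ha, rfl⟩ := hs b hb
    refine ⟨GradedTensorProduct.comm ℬ 𝒜 a, GradedTensorProduct.comm ℬ' 𝒜 b', ?_, ?_⟩
    · rw [← hd, ha, map_zero]
    · rw [map_add, hcc, hd']

theorem IsWeakEquiv.tensor {f : A →ₗ[R] A'} {g : B →ₗ[R] B'} (hf : IsDGAMap 𝒜 dA 𝒜' dA' f)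
    (hg : IsDGAMap ℬ dB ℬ' dB' g) (hfw : IsWeakEquiv dA dA' f) (hgw : IsWeakEquiv dB dB' g)
    (hA : IsDGA 𝒜 dA) (hB : IsDGA ℬ dB) (hA' : IsDGA 𝒜' dA') (hB' : IsDGA ℬ' dB')
    [Module.Flat R B] [Module.Flat R A'] :
    IsWeakEquiv (tensorDiff 𝒜 ℬ dA dB) (tensorDiff 𝒜' ℬ' dA' dB') (tensorMap f g) := by
  have h := (hgw.tensorLeft hg hA' hB hB').comp (hfw.tensorRight hf hA hA' hB)
  rw [tensorMap_comp, LinearMap.id_comp, LinearMap.comp_id] at h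
  exact h

instance tensorFlat [Module.Flat R A] [Module.Flat R B] : Module.Flat R (𝒜 ᵍ⊗[R] ℬ) :=
  Module.Flat.of_linearEquiv (GradedTensorProduct.of R 𝒜 ℬ).symm

end WeakEquiv

/-! ### Semifree differential graded algebras -/

section SemiFree

variable {R : Type u} [CommRing R]
variable {P : Type*} {N : Type*} {E : Type*} [Ring P] [Ring N] [Ring E]
  [Algebra R P] [Algebra R N] [Algebra R E] {X : Type*}
variable {𝒢 : ℕ → Submodule R P} [GradedAlgebra 𝒢] {𝒩 : ℕ → Submodule R N} [GradedAlgebra 𝒩]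
  {ℰ : ℕ → Submodule R E} [GradedAlgebra ℰ]
variable {d : P →ₗ[R] P} {dN : N →ₗ[R] N} {dE : E →ₗ[R] E}

/-- A differential graded algebra that is free as an algebra on homogeneous generators `x i`, such
that `d (x i)` lies in the subalgebra of the generators of lower level. -/
structure IsSemiFree (𝒢 : ℕ → Submodule R P) [GradedAlgebra 𝒢] (d : P →ₗ[R] P) (x : X → P)
    (lev deg : X → ℕ) : Prop where
  free : IsFreeOn R x
  dga : IsDGA 𝒢 d
  deg_mem : ∀ i, x i ∈ 𝒢 (deg i)
  diff_mem : ∀ i, d (x i) ∈ Algebra.adjoin R (x '' {j | lev j < lev i})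

theorem chain_on_adjoin (hd : ∀ x y, d (x * y) = d x * y + parity 𝒢 x * d y) (hN : IsDGA 𝒩 dN)
    (f : P →ₐ[R] N) (hf : ∀ x, parity 𝒩 (f x) = f (parity 𝒢 x)) {S : Set P}
    (hS : ∀ x ∈ S, f (d x) = dN (f x)) {y : P} (hy : y ∈ Algebra.adjoin R S) :
    f (d y) = dN (f y) := by
  have h : IsTwistedDer (f.comp (parityHom 𝒢)) f (f.toLinearMap ∘ₗ d - dN ∘ₗ f.toLinearMap) := by
    intro x y
    simp only [LinearMap.sub_apply, LinearMap.comp_apply, AlgHom.toLinearMap_apply, hd, map_add,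
      map_mul, hN.diff_mul, hf, AlgHom.comp_apply, parityHom_apply, mul_sub, sub_mul]
    abel
  have := h.eq_zero (S := S) (fun x hx => sub_eq_zero.2 (hS x hx)) hy
  exact sub_eq_zero.1 this

theorem homotopy_on_adjoin (hP : IsDGA 𝒢 d) (hN : IsDGA 𝒩 dN) (f g : P →ₐ[R] N) (s : P →ₗ[R] N)
    (hs : IsTwistedDer (f.comp (parityHom 𝒢)) g s) (hf : ∀ x, parity 𝒩 (f x) = f (parity 𝒢 x))
    (hsd : ∀ x, parity 𝒩 (s x) = -s (parity 𝒢 x)) {S : Set P}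
    (hfd : ∀ x, f (d x) = dN (f x)) (hgd : ∀ x ∈ S, g (d x) = dN (g x))
    (hg : ∀ x, parity 𝒩 (g x) = g (parity 𝒢 x))
    (hS : ∀ x ∈ S, s (d x) + dN (s x) = f x - g x) {y : P} (hy : y ∈ Algebra.adjoin R S) :
    s (d y) + dN (s y) = f y - g y := by
  induction hy using Algebra.adjoin_induction with
  | mem x hx => exact hS x hx
  | algebraMap r =>
    have h1 : d (algebraMap R P r) = 0 := by
      rw [Algebra.algebraMap_eq_smul_one, map_smul, hP.diff_one, smul_zero]
    simp [h1, hs.map_algebraMap]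
  | add x y _ _ hx hy => simp only [map_add]; rw [add_add_add_comm, hx, hy]; abel
  | mul x y _ hy' hx hy =>
    have e1 : s (d x) = f x - g x - dN (s x) := eq_sub_of_add_eq hx
    have e2 : s (d y) = f y - g y - dN (s y) := eq_sub_of_add_eq hy
    have e3 := chain_on_adjoin hP.diff_mul hN g hg hgd hy'
    simp only [hP.diff_mul, map_add, hs _ _, AlgHom.comp_apply, parityHom_apply,
      parity_parity, hP.parity_diff, hN.diff_mul, hf, hsd, map_neg, hfd, e1, e2, e3, map_mul,
      mul_sub, sub_mul, neg_mul]
    abel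

theorem IsDGAMap.of_generators {x : X → P} {lev deg : X → ℕ} (hP : IsSemiFree 𝒢 d x lev deg)
    (hN : IsDGA 𝒩 dN) (f : P →ₐ[R] N) (hdeg : ∀ i, f (x i) ∈ 𝒩 (deg i))
    (hd : ∀ i, f (d (x i)) = dN (f (x i))) : IsDGAMap 𝒢 d 𝒩 dN f.toLinearMap := by
  have hmem : ∀ n, ∀ y ∈ 𝒢 n, f y ∈ 𝒩 n := hP.free.hom_mem hP.deg_mem f 𝒩
    (SetLike.one_mem_graded 𝒩) (fun m n y hy z hz => SetLike.mul_mem_graded hy hz) hdeg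
  refine ⟨_root_.map_one f, _root_.map_mul f, hmem, LinearMap.ext fun y => ?_⟩
  refine chain_on_adjoin hP.dga.diff_mul hN f
    (parity_map_of_degree_zero (f := f.toLinearMap) hmem) (S := Set.range x) ?_
    (by rw [hP.free.adjoin_eq_top]; trivial)
  rintro _ ⟨i, rfl⟩
  exact hd i

theorem IsTwistedDer.degree_one {x : X → P} {lev deg : X → ℕ} (hP : IsSemiFree 𝒢 d x lev deg)
    {f g : P →ₐ[R] N} {s : P →ₗ[R] N} (hs : IsTwistedDer (f.comp (parityHom 𝒢)) g s)
    (hf : ∀ n, ∀ y ∈ 𝒢 n, f y ∈ 𝒩 n) (hg : ∀ n, ∀ y ∈ 𝒢 n, g y ∈ 𝒩 n)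
    (hgen : ∀ i, s (x i) ∈ 𝒩 (deg i + 1)) : ∀ n, ∀ y ∈ 𝒢 n, s y ∈ 𝒩 (n + 1) := by
  refine hP.free.der_mem hP.deg_mem hs (fun n => 𝒩 (n + 1)) ?_ ?_ hgen
  · intro m n y hy z hz
    have := SetLike.mul_mem_graded (hf m _ (parity_mem 𝒢 hy)) hz
    rwa [← add_assoc] at this
  · intro m n z hz y hy
    have := SetLike.mul_mem_graded hz (hg n _ hy)
    rwa [show m + 1 + n = m + n + 1 by omega] at this

theorem IsDerivationHomotopy.of_generators {x : X → P} {lev deg : X → ℕ}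
    (hP : IsSemiFree 𝒢 d x lev deg) (hN : IsDGA 𝒩 dN) {f g s : P →ₗ[R] N}
    (hf : IsDGAMap 𝒢 d 𝒩 dN f) (hg : IsDGAMap 𝒢 d 𝒩 dN g)
    (hs : IsTwistedDer (hf.toAlgHom.comp (parityHom 𝒢)) hg.toAlgHom s)
    (hdeg : ∀ i, s (x i) ∈ 𝒩 (deg i + 1))
    (h : ∀ i, s (d (x i)) + dN (s (x i)) = f (x i) - g (x i)) :
    IsDerivationHomotopy 𝒢 d 𝒩 dN f g s := by
  have hmem := hs.degree_one hP hf.map_mem hg.map_mem hdeg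
  refine .of_mul hmem (fun y => ?_) hs
  refine homotopy_on_adjoin hP.dga hN hf.toAlgHom hg.toAlgHom s hs hf.map_parity
    (parity_map_of_degree_one hmem) hf.comm_apply (fun x _ => hg.comm_apply x) hg.map_parity
    (S := Set.range x) ?_ (by rw [hP.free.adjoin_eq_top]; trivial)
  rintro _ ⟨i, rfl⟩
  exact h i

/-! ### Concatenation and reversal of derivation homotopies -/

/-- Given twisted derivations `S` and `t` along `(f, g)` and `(g, h)`, there is a map `K` with
`K (x y) = f x K y + S x t y + K x h y` and prescribed values on free generators; it is a corner of
a twisted derivation into the `2 × 2` matrices. -/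
theorem IsFreeOn.exists_corner {x : X → P} (hx : IsFreeOn R x) {f g h : P →ₐ[R] N}
    {S t : P →ₗ[R] N} (hS : IsTwistedDer f g S) (ht : IsTwistedDer g h t) (k : X → N) :
    ∃ K : P →ₗ[R] N, (∀ y z, K (y * z) = f y * K z + S y * t z + K y * h z) ∧
      ∀ i, K (x i) = k i := by
  -- along `f` times the identity matrix and `!![g, t; 0, h]`, the first row of a twisted derivation
  -- `W` satisfies the equations for `(S, K)`
  let b : P →ₐ[R] Matrix (Fin 2) (Fin 2) N := AlgHom.ofLinearMap
    { toFun := fun y => !![g y, t y; 0, h y]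
      map_add' := fun y z => by ext i j; fin_cases i <;> fin_cases j <;> simp
      map_smul' := fun r y => by ext i j; fin_cases i <;> fin_cases j <;> simp }
    (by ext i j; fin_cases i <;> fin_cases j <;> simp [ht.map_one])
    (fun y z => by
      ext i j
      fin_cases i <;> fin_cases j <;> simp [Matrix.mul_apply, Fin.sum_univ_two, ht y z])
  let a : P →ₐ[R] Matrix (Fin 2) (Fin 2) N := (Matrix.scalarAlgHom (Fin 2) R).comp f
  have ha : ∀ y, a y 0 0 = f y ∧ a y 0 1 = 0 := fun y => by simp [a]
  have hb : ∀ y, b y 0 0 = g y ∧ b y 0 1 = t y ∧ b y 1 0 = 0 ∧ b y 1 1 = h y :=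
    fun y => ⟨rfl, rfl, rfl, rfl⟩
  obtain ⟨W, hW, hWx⟩ := hx.exists_twistedDer a b fun i => !![S (x i), k i; 0, 0]
  have h1 : Matrix.entryLinearMap R N 0 0 ∘ₗ W = S := by
    refine hx.twistedDer_ext (a := f) (b := g) (fun y z => ?_) hS (fun i => ?_)
    · simp [hW y z, ha y, hb z, Matrix.mul_apply, Fin.sum_univ_two]
    · simp [hWx]
  refine ⟨Matrix.entryLinearMap R N 0 1 ∘ₗ W, fun y z => ?_, fun i => ?_⟩
  · have h2 : W y 0 0 = S y := LinearMap.congr_fun h1 y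
    simp [hW y z, ha y, hb z, Matrix.mul_apply, Fin.sum_univ_two, h2, add_assoc]
  · simp [hWx]

/-- The corner map corrects the sum of two composable homotopies to a derivation homotopy. -/
theorem corner_mul (hP : IsDGA 𝒢 d) (hN : IsDGA 𝒩 dN) {f g h s t K : P →ₗ[R] N}
    (hf : IsDGAMap 𝒢 d 𝒩 dN f) (hh : IsDGAMap 𝒢 d 𝒩 dN h)
    (hs : IsDerivationHomotopy 𝒢 d 𝒩 dN f g s)
    (ht : ∀ x y, t (x * y) = g (parity 𝒢 x) * t y + t x * h y)
    (hK : ∀ y z, K (y * z) = f y * K z + s (parity 𝒢 y) * t z + K y * h z)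
    (hKp : ∀ x, parity 𝒩 (K x) = K (parity 𝒢 x)) (x y : P)
    (hy : t (d y) + dN (t y) = g y - h y) :
    (s + t + dN ∘ₗ K - K ∘ₗ d) (x * y) =
      f (parity 𝒢 x) * (s + t + dN ∘ₗ K - K ∘ₗ d) y +
        (s + t + dN ∘ₗ K - K ∘ₗ d) x * h y := by
  have e1 : dN (s (parity 𝒢 x)) = f (parity 𝒢 x) - g (parity 𝒢 x) - s (d (parity 𝒢 x)) :=
    eq_sub_of_add_eq' (hs.homotopy_apply _)
  have e2 : dN (t y) = g y - h y - t (d y) := eq_sub_of_add_eq' hy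
  simp only [LinearMap.sub_apply, LinearMap.add_apply, LinearMap.comp_apply, hs.map_mul', ht, hK,
    hP.diff_mul, map_add, hN.diff_mul, hP.parity_diff, parity_parity, map_neg, hf.map_parity,
    parity_map_of_degree_one hs.map_mem, e1, e2, hKp, hf.comm_apply, hh.comm_apply, mul_sub,
    sub_mul, mul_add, add_mul, neg_mul]
  abel

theorem corner_degree {x : X → P} {lev deg : X → ℕ} (hP : IsSemiFree 𝒢 d x lev deg)
    {f h S t K : P →ₗ[R] N} (hf : ∀ n, ∀ y ∈ 𝒢 n, f y ∈ 𝒩 n) (hh : ∀ n, ∀ y ∈ 𝒢 n, h y ∈ 𝒩 n)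
    (hS : ∀ n, ∀ y ∈ 𝒢 n, S y ∈ 𝒩 (n + 1)) (ht : ∀ n, ∀ y ∈ 𝒢 n, t y ∈ 𝒩 (n + 1))
    (hh1 : h 1 = 1) (hf1 : f 1 = 1) (ht1 : t 1 = 0)
    (hK : ∀ y z, K (y * z) = f y * K z + S y * t z + K y * h z) (hKx : ∀ i, K (x i) = 0) :
    ∀ n, ∀ y ∈ 𝒢 n, K y ∈ 𝒩 (n + 2) := by
  refine hP.free.homogeneous_span hP.deg_mem (p := fun n => (𝒩 (n + 2)).comap K) ?_ ?_ ?_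
  · have h1 := hK 1 1
    rw [mul_one, hf1, hh1, ht1, one_mul, mul_zero, mul_one, add_zero] at h1
    have h2 : K 1 = 0 := by simpa using h1
    rw [Submodule.mem_comap, h2]
    exact Submodule.zero_mem _
  · intro m n y hy z hz hy' hz'
    rw [Submodule.mem_comap, hK]
    refine Submodule.add_mem _ (Submodule.add_mem _ ?_ ?_) ?_
    · have := SetLike.mul_mem_graded (hf _ _ hy) (show K z ∈ 𝒩 (n + 2) from hz')
      rwa [← add_assoc] at this
    · have := SetLike.mul_mem_graded (hS _ _ hy) (ht _ _ hz)
      rwa [show m + 1 + (n + 1) = m + n + 2 by omega] at this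
    · have := SetLike.mul_mem_graded (show K y ∈ 𝒩 (m + 2) from hy') (hh _ _ hz)
      rwa [show m + 2 + n = m + n + 2 by omega] at this
  · intro i
    rw [Submodule.mem_comap, hKx]
    exact Submodule.zero_mem _

theorem parity_map_of_degree_two {K : P →ₗ[R] N} (hK : ∀ n, ∀ x ∈ 𝒢 n, K x ∈ 𝒩 (n + 2)) (x : P) :
    parity 𝒩 (K x) = K (parity 𝒢 x) := by
  induction x using homogeneous_induction 𝒢 with
  | h0 => simp
  | add x y hx hy => simp only [map_add, hx, hy]
  | hom m x hx =>
    rw [parity_of_mem 𝒢 hx, parity_of_mem 𝒩 (hK _ x hx), map_smul, pow_add]; simp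

/-- Derivation homotopies out of a free algebra can be concatenated. -/
theorem IsSemiFree.homotopy_trans {x : X → P} {lev deg : X → ℕ} (hP : IsSemiFree 𝒢 d x lev deg)
    (hN : IsDGA 𝒩 dN) {f g h s t : P →ₗ[R] N} (hf : IsDGAMap 𝒢 d 𝒩 dN f)
    (hg : IsDGAMap 𝒢 d 𝒩 dN g) (hh : IsDGAMap 𝒢 d 𝒩 dN h)
    (hs : IsDerivationHomotopy 𝒢 d 𝒩 dN f g s) (ht : IsDerivationHomotopy 𝒢 d 𝒩 dN g h t) :
    ∃ r, IsDerivationHomotopy 𝒢 d 𝒩 dN f h r := by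
  have hS : IsTwistedDer hf.toAlgHom (hg.toAlgHom.comp (parityHom 𝒢)) (s ∘ₗ parity 𝒢) := by
    intro y z
    simp [parity_mul, hs.map_mul', parity_parity]
  have ht' : IsTwistedDer (hg.toAlgHom.comp (parityHom 𝒢)) hh.toAlgHom t := ht.map_mul'
  obtain ⟨K, hK, hKx⟩ := hP.free.exists_corner hS ht' fun _ => 0
  have hKdeg : ∀ n, ∀ y ∈ 𝒢 n, K y ∈ 𝒩 (n + 2) :=
    corner_degree hP (S := s ∘ₗ parity 𝒢) hf.map_mem hh.map_mem
      (fun n y hy => hs.map_mem n _ (parity_mem 𝒢 hy))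
      ht.map_mem hh.map_one hf.map_one ht'.map_one hK hKx
  refine ⟨s + t + dN ∘ₗ K - K ∘ₗ d, .of_mul (fun n y hy => ?_) (fun y => ?_) (fun y z => ?_)⟩
  · refine Submodule.sub_mem _ (Submodule.add_mem _ (Submodule.add_mem _ (hs.map_mem n y hy)
      (ht.map_mem n y hy)) (hN.map_mem _ _ (hKdeg n y hy))) ?_
    rcases n with _ | n
    · rw [LinearMap.comp_apply, hP.dga.map_zero_degree y hy, map_zero]; exact Submodule.zero_mem _
    · exact hKdeg n _ (hP.dga.map_mem n y hy)
  · have e1 := hs.homotopy_apply y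
    have e2 := ht.homotopy_apply y
    simp only [LinearMap.sub_apply, LinearMap.add_apply, LinearMap.comp_apply, map_add, map_sub,
      hP.dga.diff_diff, hN.diff_diff, map_zero]
    rw [← sub_add_sub_cancel (f y) (g y) (h y), ← e1, ← e2]
    abel
  · exact corner_mul hP.dga hN hf hh hs ht.map_mul' hK (parity_map_of_degree_two hKdeg) y z
      (ht.homotopy_apply z)

theorem corner_eqOn {f h S t t' K K' : P →ₗ[R] N}
    (hK : ∀ y z, K (y * z) = f y * K z + S y * t z + K y * h z)
    (hK' : ∀ y z, K' (y * z) = f y * K' z + S y * t' z + K' y * h z)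
    (hf1 : f 1 = 1) (hh1 : h 1 = 1) (ht1 : t 1 = 0) (ht1' : t' 1 = 0) {Z : Set P}
    (ht : ∀ y ∈ Algebra.adjoin R Z, t y = t' y) (hZ : ∀ y ∈ Z, K y = K' y) {y : P}
    (hy : y ∈ Algebra.adjoin R Z) : K y = K' y := by
  have hone : ∀ {K t : P →ₗ[R] N}, (∀ y z, K (y * z) = f y * K z + S y * t z + K y * h z) →
      t 1 = 0 → K 1 = 0 := by
    intro K t hK ht
    have h1 := hK 1 1
    rw [mul_one, hf1, hh1, ht, one_mul, mul_zero, mul_one, add_zero] at h1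
    simpa using h1
  induction hy using Algebra.adjoin_induction with
  | mem y hy => exact hZ y hy
  | algebraMap r =>
    rw [Algebra.algebraMap_eq_smul_one, map_smul, map_smul, hone hK ht1, hone hK' ht1']
  | add y z _ _ hy hz => rw [map_add, map_add, hy, hz]
  | mul y z _ hz' hy hz => rw [hK, hK', hy, hz, ht z hz']

/-- Derivation homotopies out of a free algebra can be reversed: `r = -s + K d` on generators, where
`K` is the corner map of `s` and `r`. -/
theorem IsSemiFree.homotopy_symm {x : X → P} {lev deg : X → ℕ} (hP : IsSemiFree 𝒢 d x lev deg)
    (hN : IsDGA 𝒩 dN) {f g s : P →ₗ[R] N} (hf : IsDGAMap 𝒢 d 𝒩 dN f)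
    (hg : IsDGAMap 𝒢 d 𝒩 dN g) (hs : IsDerivationHomotopy 𝒢 d 𝒩 dN f g s) :
    ∃ r, IsDerivationHomotopy 𝒢 d 𝒩 dN g f r := by
  have hS : IsTwistedDer hf.toAlgHom (hg.toAlgHom.comp (parityHom 𝒢)) (s ∘ₗ parity 𝒢) := by
    intro y z
    simp [parity_mul, hs.map_mul', parity_parity]
  let r : (X → N) → P →ₗ[R] N :=
    fun v => hP.free.der (hg.toAlgHom.comp (parityHom 𝒢)) hf.toAlgHom v
  have hr : ∀ v, IsTwistedDer (hg.toAlgHom.comp (parityHom 𝒢)) hf.toAlgHom (r v) := fun v =>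
    hP.free.isTwistedDer_der _ _ v
  have hrx : ∀ v i, r v (x i) = v i := fun v i => hP.free.der_apply _ _ v i
  choose K hK hKx using fun v => hP.free.exists_corner hS (hr v) fun _ => 0
  have hrdeg : ∀ v, (∀ i, v i ∈ 𝒩 (deg i + 1)) → ∀ n, ∀ y ∈ 𝒢 n, r v y ∈ 𝒩 (n + 1) :=
    fun v hv => (hr v).degree_one hP hg.map_mem hf.map_mem fun i => by rw [hrx]; exact hv i
  have hKdeg : ∀ v, (∀ i, v i ∈ 𝒩 (deg i + 1)) → ∀ n, ∀ y ∈ 𝒢 n, K v y ∈ 𝒩 (n + 2) :=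
    fun v hv => corner_degree hP (S := s ∘ₗ parity 𝒢) hf.map_mem hf.map_mem
      (fun n y hy => hs.map_mem n _ (parity_mem 𝒢 hy)) (hrdeg v hv) hf.map_one hf.map_one
      (hr v).map_one (hK v) (hKx v)
  obtain ⟨v, hv⟩ := exists_of_levelwise lev (fun i a => a ∈ 𝒩 (deg i + 1))
    (fun v i a => a = -s (x i) + K v (d (x i))) (fun i => ⟨0, Submodule.zero_mem _⟩)
    (by
      intro v v' i a _ hvv' ha
      rw [ha]
      congr 1
      have hlow : ∀ y ∈ Algebra.adjoin R (x '' {j | lev j < lev i}), r v y = r v' y :=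
        fun y hy => (hr v).eqOn (hr v') (fun _ _ => rfl) (fun _ _ => rfl)
          (by rintro _ ⟨j, hj, rfl⟩; rw [hrx, hrx, hvv' j hj]) hy
      exact corner_eqOn (hK v) (hK v') hf.map_one hf.map_one (hr v).map_one (hr v').map_one hlow
        (by rintro _ ⟨j, _, rfl⟩; rw [hKx, hKx]) (hP.diff_mem i))
    (by
      intro v i hv _
      refine ⟨_, ?_, rfl⟩
      refine Submodule.add_mem _ (Submodule.neg_mem _ (hs.map_mem _ _ (hP.deg_mem i))) ?_
      have hxi := hP.deg_mem i
      rcases h : deg i with _ | n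
      · rw [h] at hxi
        rw [hP.dga.map_zero_degree _ hxi, map_zero]; exact Submodule.zero_mem _
      · rw [h] at hxi
        exact hKdeg v hv n _ (hP.dga.map_mem n _ hxi))
  have hv1 : ∀ i, v i ∈ 𝒩 (deg i + 1) := fun i => (hv i).1
  have hKp := parity_map_of_degree_two (hKdeg v hv1)
  have key : ∀ q, ∀ y ∈ Algebra.adjoin R (x '' {j | lev j < q}),
      r v (d y) + dN (r v y) = g y - f y := by
    intro q
    induction q with
    | zero =>
      intro y hy
      refine homotopy_on_adjoin hP.dga hN hg.toAlgHom hf.toAlgHom (r v) (hr v) hg.map_parity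
        (parity_map_of_degree_one (hrdeg v hv1)) hg.comm_apply (fun x _ => hf.comm_apply x)
        hf.map_parity ?_ hy
      rintro _ ⟨j, hj, rfl⟩
      exact absurd hj (Nat.not_lt_zero _)
    | succ q ih =>
      -- `s + r + d K - K d` vanishes on generators, and it is multiplicative as far as `r` is known
      -- to be a homotopy
      have hW : ∀ y ∈ Algebra.adjoin R (x '' {j | lev j < q}),
          (s + r v + dN ∘ₗ K v - K v ∘ₗ d) y = 0 := by
        intro y hy
        induction hy using Algebra.adjoin_induction with
        | mem y hy =>
          obtain ⟨j, _, rfl⟩ := hy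
          simp only [LinearMap.sub_apply, LinearMap.add_apply, LinearMap.comp_apply, hKx, map_zero]
          rw [hrx, (hv j).2]
          abel
        | algebraMap c =>
          have h1 := hK v 1 1
          rw [mul_one, (hr v).map_one] at h1
          have h2 : K v 1 = 0 := by simpa [hf.map_one] using h1
          have h3 : s 1 = 0 := by
            have := hS.map_one
            rwa [LinearMap.comp_apply, parity_one] at this
          rw [Algebra.algebraMap_eq_smul_one, map_smul]
          simp [h2, h3, (hr v).map_one, hP.dga.diff_one]
        | add y z _ _ hy hz => rw [map_add, hy, hz, add_zero]
        | mul y z _ hz' hy hz =>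
          rw [corner_mul hP.dga hN hf hf hs (hr v) (hK v) hKp y z (ih z hz'), hy, hz, mul_zero,
            zero_mul, add_zero]
      intro y hy
      refine homotopy_on_adjoin hP.dga hN hg.toAlgHom hf.toAlgHom (r v) (hr v) hg.map_parity
        (parity_map_of_degree_one (hrdeg v hv1)) hg.comm_apply (fun x _ => hf.comm_apply x)
        hf.map_parity ?_ hy
      rintro _ ⟨j, hj, rfl⟩
      have hlow : d (x j) ∈ Algebra.adjoin R (x '' {k | lev k < q}) := by
        refine Algebra.adjoin_mono (Set.image_mono fun k hk => ?_) (hP.diff_mem j)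
        exact lt_of_lt_of_le hk (Nat.lt_succ_iff.1 hj)
      have h1 := hW _ hlow
      simp only [LinearMap.sub_apply, LinearMap.add_apply, LinearMap.comp_apply,
        hP.dga.diff_diff, map_zero, sub_zero] at h1
      have h2 := hs.homotopy_apply (x j)
      rw [hrx, (hv j).2, map_add, map_neg]
      have h3 : r v (d (x j)) = -s (d (x j)) - dN (K v (d (x j))) := by
        rw [← sub_eq_zero, ← h1]; abel
      rw [h3]
      change _ = g (x j) - f (x j)
      rw [← neg_sub (f (x j)), ← h2]
      abel
  refine ⟨r v, .of_generators hP hN hg hf (hr v) (fun i => by rw [hrx]; exact hv1 i) fun i => ?_⟩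
  exact key (lev i + 1) _ (Algebra.subset_adjoin ⟨i, Nat.lt_succ_self _, rfl⟩)

/-- Derivation homotopic maps out of a free algebra are joined by a single derivation homotopy. -/
theorem IsSemiFree.exists_homotopy {x : X → P} {lev deg : X → ℕ} (hP : IsSemiFree 𝒢 d x lev deg)
    (hN : IsDGA 𝒩 dN) {f g : P →ₗ[R] N} (h : DerivationHomotopic 𝒢 d 𝒩 dN f g) :
    ∃ s, IsDerivationHomotopy 𝒢 d 𝒩 dN f g s := by
  have h0 : ∀ f : P →ₗ[R] N, IsDerivationHomotopy 𝒢 d 𝒩 dN f f 0 := fun f =>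
    .of_mul (fun n y _ => Submodule.zero_mem _) (by simp) (by simp)
  have key : f = g ∨ (IsDGAMap 𝒢 d 𝒩 dN f ∧ IsDGAMap 𝒢 d 𝒩 dN g ∧
      ∃ s, IsDerivationHomotopy 𝒢 d 𝒩 dN f g s) := by
    induction h with
    | rel f g h => exact .inr h
    | refl f => exact .inl rfl
    | symm f g _ ih =>
      rcases ih with rfl | ⟨hf, hg, s, hs⟩
      · exact .inl rfl
      · exact .inr ⟨hg, hf, hP.homotopy_symm hN hf hg hs⟩
    | trans f g h _ _ ih ih' =>
      rcases ih with rfl | ⟨hf, hg, s, hs⟩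
      · exact ih'
      · rcases ih' with rfl | ⟨_, hh, t, ht⟩
        · exact .inr ⟨hf, hg, s, hs⟩
        · exact .inr ⟨hf, hh, hP.homotopy_trans hN hf hg hh hs ht⟩
  rcases key with rfl | ⟨_, _, h⟩
  · exact ⟨0, h0 _⟩
  · exact h

end SemiFree

/-! ### Lifting through weak equivalences -/

section Lifting

variable {R : Type u} [CommRing R]
variable {P : Type*} {N : Type*} {E : Type*} [Ring P] [Ring N] [Ring E]
  [Algebra R P] [Algebra R N] [Algebra R E] {X : Type*}
variable {𝒢 : ℕ → Submodule R P} [GradedAlgebra 𝒢] {𝒩 : ℕ → Submodule R N} [GradedAlgebra 𝒩]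
  {ℰ : ℕ → Submodule R E} [GradedAlgebra ℰ]
variable {d : P →ₗ[R] P} {dN : N →ₗ[R] N} {dE : E →ₗ[R] E}

theorem IsDGA.map_diff_mem (hP : IsDGA 𝒢 d) {s : P →ₗ[R] N} {Q : ℕ → Submodule R N}
    (hs : ∀ n, ∀ y ∈ 𝒢 n, s y ∈ Q (n + 1)) {n : ℕ} {y : P} (hy : y ∈ 𝒢 n) : s (d y) ∈ Q n := by
  rcases n with _ | n
  · rw [hP.map_zero_degree y hy, map_zero]; exact Submodule.zero_mem _
  · exact hs n _ (hP.map_mem n y hy)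

/-- If the image of `d y` is a boundary, then it bounds a homogeneous element. -/
theorem IsDGA.diff_proj (hP : IsDGA 𝒢 d) (hE : IsDGA ℰ dE) {u : P →ₗ[R] E}
    (hu : ∀ n, ∀ y ∈ 𝒢 n, u y ∈ ℰ n) {n : ℕ} {y : P} (hy : y ∈ 𝒢 n) {e : E}
    (he : dE e = u (d y)) : dE (GradedAlgebra.proj ℰ n e) = u (d y) := by
  rcases n with _ | n
  · rw [hP.map_zero_degree y hy, map_zero, hE.map_zero_degree _ (proj_mem ℰ 0 e)]
  · rw [← proj_map_of_degree_neg_one hE.map_zero_degree hE.map_mem, he,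
      proj_of_mem ℰ (hu n _ (hP.map_mem n y hy))]

theorem IsDGA.diff_proj_of_mem (hE : IsDGA ℰ dE) {n : ℕ} {c : E} (hc : c ∈ ℰ n) {e : E}
    (he : dE e = c) : dE (GradedAlgebra.proj ℰ (n + 1) e) = c := by
  rw [← proj_map_of_degree_neg_one hE.map_zero_degree hE.map_mem, he, proj_of_mem ℰ hc]

/-- A weak equivalence is injective on homotopy classes of maps out of a semifree algebra. The
homotopy `s` is built together with a map `K` of degree two with `φ s - σ = d K - K d`. -/
theorem IsSemiFree.homotopy_of_weakEquiv {x : X → P} {lev deg : X → ℕ}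
    (hP : IsSemiFree 𝒢 d x lev deg) (hE : IsDGA ℰ dE) (hN : IsDGA 𝒩 dN) {φ : E →ₗ[R] N}
    (hφ : IsDGAMap ℰ dE 𝒩 dN φ) (hw : IsWeakEquiv dE dN φ) {u v : P →ₗ[R] E}
    (hu : IsDGAMap 𝒢 d ℰ dE u) (hv : IsDGAMap 𝒢 d ℰ dE v) {σ : P →ₗ[R] N}
    (hσ : IsDerivationHomotopy 𝒢 d 𝒩 dN (φ ∘ₗ u) (φ ∘ₗ v) σ) :
    ∃ s, IsDerivationHomotopy 𝒢 d ℰ dE u v s := by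
  have hφu := hφ.comp hu
  have hφv := hφ.comp hv
  let s : (X → E × N) → P →ₗ[R] E := fun a =>
    hP.free.der (hu.toAlgHom.comp (parityHom 𝒢)) hv.toAlgHom fun i => (a i).1
  let K : (X → E × N) → P →ₗ[R] N := fun a =>
    hP.free.der hφu.toAlgHom hφv.toAlgHom fun i => (a i).2
  have hs : ∀ a, IsTwistedDer (hu.toAlgHom.comp (parityHom 𝒢)) hv.toAlgHom (s a) := fun a =>
    hP.free.isTwistedDer_der _ _ _
  have hK : ∀ a, IsTwistedDer hφu.toAlgHom hφv.toAlgHom (K a) := fun a =>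
    hP.free.isTwistedDer_der _ _ _
  have hsx : ∀ a i, s a (x i) = (a i).1 := fun a i => hP.free.der_apply _ _ _ i
  have hKx : ∀ a i, K a (x i) = (a i).2 := fun a i => hP.free.der_apply _ _ _ i
  let T : X → E × N → Prop := fun i a => a.1 ∈ ℰ (deg i + 1) ∧ a.2 ∈ 𝒩 (deg i + 2)
  let Good : (X → E × N) → X → E × N → Prop := fun a i b =>
    s a (d (x i)) + dE b.1 = u (x i) - v (x i) ∧ dN b.2 - K a (d (x i)) = φ b.1 - σ (x i)
  have hsdeg : ∀ a, (∀ i, T i (a i)) → ∀ n, ∀ y ∈ 𝒢 n, s a y ∈ ℰ (n + 1) := fun a ha =>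
    (hs a).degree_one hP hu.map_mem hv.map_mem fun i => by rw [hsx]; exact (ha i).1
  have hKdeg : ∀ a, (∀ i, T i (a i)) → ∀ n, ∀ y ∈ 𝒢 n, K a y ∈ 𝒩 (n + 2) := fun a ha => by
    refine hP.free.der_mem hP.deg_mem (hK a) (fun n => 𝒩 (n + 2)) ?_ ?_ fun i => ?_
    · intro m n y hy z hz
      have := SetLike.mul_mem_graded (hφu.map_mem m _ hy) hz
      rwa [← add_assoc] at this
    · intro m n z hz y hy
      have := SetLike.mul_mem_graded hz (hφv.map_mem n _ hy)
      rwa [show m + 2 + n = m + n + 2 by omega] at this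
    · rw [hKx]; exact (ha i).2
  obtain ⟨a, ha⟩ := exists_of_levelwise lev T Good
    (fun i => ⟨0, Submodule.zero_mem _, Submodule.zero_mem _⟩)
    (by
      intro a a' i b _ haa' hb
      have hlow : ∀ y ∈ Algebra.adjoin R (x '' {j | lev j < lev i}),
          s a y = s a' y ∧ K a y = K a' y := fun y hy =>
        ⟨(hs a).eqOn (hs a') (fun _ _ => rfl) (fun _ _ => rfl)
          (by rintro _ ⟨j, hj, rfl⟩; rw [hsx, hsx, haa' j hj]) hy,
        (hK a).eqOn (hK a') (fun _ _ => rfl) (fun _ _ => rfl)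
          (by rintro _ ⟨j, hj, rfl⟩; rw [hKx, hKx, haa' j hj]) hy⟩
      have h := hlow _ (hP.diff_mem i)
      simp only [Good] at hb ⊢
      rwa [← h.1, ← h.2])
    (by
      intro a i haT haG
      have hsp := parity_map_of_degree_one (hsdeg a haT)
      have hKp := parity_map_of_degree_two (hKdeg a haT)
      have hlow : ∀ y ∈ Algebra.adjoin R (x '' {j | lev j < lev i}),
          s a (d y) + dE (s a y) = u y - v y := fun y hy =>
        homotopy_on_adjoin hP.dga hE hu.toAlgHom hv.toAlgHom (s a) (hs a) hu.map_parity hsp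
          hu.comm_apply (fun x _ => hv.comm_apply x) hv.map_parity
          (by rintro _ ⟨j, hj, rfl⟩; rw [hsx]; exact (haG j hj).1) hy
      have hW : IsTwistedDer (hφu.toAlgHom.comp (parityHom 𝒢)) hφv.toAlgHom
          (φ ∘ₗ s a - σ - (dN ∘ₗ K a - K a ∘ₗ d)) := by
        intro y z
        have e1 : ∀ y z, K a (y * z) = φ (u y) * K a z + K a y * φ (v z) := hK a
        have e2 : ∀ y z, s a (y * z) = u (parity 𝒢 y) * s a z + s a y * v z := hs a
        have e3 : ∀ y z, σ (y * z) = φ (u (parity 𝒢 y)) * σ z + σ y * φ (v z) := hσ.map_mul'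
        simp only [LinearMap.sub_apply, LinearMap.comp_apply, AlgHom.comp_apply, parityHom_apply,
          IsDGAMap.toAlgHom_apply, e1, e2, e3, hP.dga.diff_mul, map_add, hφ.map_mul, hN.diff_mul,
          hφ.map_parity, hu.map_parity, hKp, ← hφ.comm_apply, ← hu.comm_apply, ← hv.comm_apply,
          mul_sub, sub_mul]
        abel
      have hW0 : ∀ y ∈ Algebra.adjoin R (x '' {j | lev j < lev i}),
          φ (s a y) - σ y - (dN (K a y) - K a (d y)) = 0 := fun y hy =>
        hW.eq_zero (by
          rintro _ ⟨j, hj, rfl⟩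
          simp only [LinearMap.sub_apply, LinearMap.comp_apply]
          rw [hsx, hKx, (haG j hj).2, sub_self]) hy
      have h1 := hlow _ (hP.diff_mem i)
      have h2 := hW0 _ (hP.diff_mem i)
      rw [hP.dga.diff_diff, map_zero, zero_add] at h1
      rw [hP.dga.diff_diff, map_zero, sub_zero] at h2
      have hxi := hP.deg_mem i
      obtain ⟨e, k, he, hk⟩ := hw.cone (a := u (x i) - v (x i) - s a (d (x i)))
        (b := σ (x i) - K a (d (x i)))
        (by rw [map_sub, map_sub, h1, hu.comm_apply, hv.comm_apply, sub_self])
        (by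
          have h3 := hσ.homotopy_apply (x i)
          simp only [LinearMap.comp_apply] at h3
          rw [map_sub, map_sub, ← h3, map_sub]
          have h4 : φ (s a (d (x i))) = σ (d (x i)) + dN (K a (d (x i))) := by
            rw [← sub_eq_zero, ← h2]; abel
          rw [h4]; abel)
      have hc : u (x i) - v (x i) - s a (d (x i)) ∈ ℰ (deg i) :=
        Submodule.sub_mem _ (Submodule.sub_mem _ (hu.map_mem _ _ hxi) (hv.map_mem _ _ hxi))
          (hP.dga.map_diff_mem (Q := ℰ) (hsdeg a haT) hxi)
      refine ⟨(GradedAlgebra.proj ℰ (deg i + 1) e, GradedAlgebra.proj 𝒩 (deg i + 2) k),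
        ⟨proj_mem _ _ _, proj_mem _ _ _⟩, ?_, ?_⟩
      · dsimp only
        rw [hE.diff_proj_of_mem hc he, add_sub_cancel]
      · dsimp only
        have h5 : dN k = φ e - (σ (x i) - K a (d (x i))) := by rw [← hk, sub_sub_cancel]
        have h6 : K a (d (x i)) ∈ 𝒩 (deg i + 1) :=
          hP.dga.map_diff_mem (Q := fun n => 𝒩 (n + 1)) (hKdeg a haT) hxi
        rw [← proj_map_of_degree_neg_one hN.map_zero_degree hN.map_mem, h5, map_sub, map_sub,
          proj_of_mem 𝒩 (hσ.map_mem _ _ hxi), proj_of_mem 𝒩 h6,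
          proj_map_of_degree_zero hφ.map_mem]
        abel)
  refine ⟨s a, .of_generators hP hE hu hv (hs a) (fun i => by rw [hsx]; exact (ha i).1.1) ?_⟩
  intro i
  rw [hsx]
  exact (ha i).2.1

theorem IsSemiFree.homotopic_of_weakEquiv {x : X → P} {lev deg : X → ℕ}
    (hP : IsSemiFree 𝒢 d x lev deg) (hE : IsDGA ℰ dE) (hN : IsDGA 𝒩 dN) {φ : E →ₗ[R] N}
    (hφ : IsDGAMap ℰ dE 𝒩 dN φ) (hw : IsWeakEquiv dE dN φ) {u v : P →ₗ[R] E}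
    (hu : IsDGAMap 𝒢 d ℰ dE u) (hv : IsDGAMap 𝒢 d ℰ dE v)
    (h : DerivationHomotopic 𝒢 d 𝒩 dN (φ ∘ₗ u) (φ ∘ₗ v)) :
    DerivationHomotopic 𝒢 d ℰ dE u v := by
  obtain ⟨σ, hσ⟩ := hP.exists_homotopy hN h
  obtain ⟨s, hs⟩ := hP.homotopy_of_weakEquiv hE hN hφ hw hu hv hσ
  exact .of_homotopy hu hv hs

/-- Lifting a map `g` through `φ` up to a derivation homotopy, one level of generators at a time.
The predicate `T` records what the lift and the homotopy are required to satisfy on generators. -/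
theorem IsSemiFree.exists_lift {x : X → P} {lev deg : X → ℕ} (hP : IsSemiFree 𝒢 d x lev deg)
    (hE : IsDGA ℰ dE) (hN : IsDGA 𝒩 dN) {φ : E →ₗ[R] N} (hφ : IsDGAMap ℰ dE 𝒩 dN φ)
    {g : P →ₗ[R] N} (hg : IsDGAMap 𝒢 d 𝒩 dN g) (T : X → E → N → Prop)
    (hT0 : ∀ i, ∃ e t, T i e t)
    (hTdeg : ∀ i e t, T i e t → e ∈ ℰ (deg i) ∧ t ∈ 𝒩 (deg i + 1))
    (step : ∀ i (u : P →ₐ[R] E) (s : P →ₗ[R] N), (∀ j, T j (u (x j)) (s (x j))) →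
      (∀ y z, s (y * z) = g (parity 𝒢 y) * s z + s y * φ (u z)) →
      (∀ n, ∀ y ∈ 𝒢 n, u y ∈ ℰ n) → (∀ n, ∀ y ∈ 𝒢 n, s y ∈ 𝒩 (n + 1)) →
      dE (u (d (x i))) = 0 → dN (s (d (x i))) = g (d (x i)) - φ (u (d (x i))) →
      ∃ e t, T i e t ∧ dE e = u (d (x i)) ∧ dN t = g (x i) - s (d (x i)) - φ e) :
    ∃ (u : P →ₗ[R] E) (s : P →ₗ[R] N), IsDGAMap 𝒢 d ℰ dE u ∧
      IsDerivationHomotopy 𝒢 d 𝒩 dN g (φ ∘ₗ u) s ∧ ∀ j, T j (u (x j)) (s (x j)) := by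
  let u : (X → E × N) → P →ₐ[R] E := fun a => hP.free.lift fun i => (a i).1
  have hux : ∀ a i, u a (x i) = (a i).1 := fun a i => hP.free.lift_apply _ i
  let s : (X → E × N) → P →ₗ[R] N := fun a =>
    hP.free.der (hg.toAlgHom.comp (parityHom 𝒢)) (hφ.toAlgHom.comp (u a)) fun i => (a i).2
  have hs : ∀ a, IsTwistedDer (hg.toAlgHom.comp (parityHom 𝒢)) (hφ.toAlgHom.comp (u a)) (s a) :=
    fun a => hP.free.isTwistedDer_der _ _ _
  have hsx : ∀ a i, s a (x i) = (a i).2 := fun a i => hP.free.der_apply _ _ _ i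
  let T' : X → E × N → Prop := fun i a => T i a.1 a.2
  let Good : (X → E × N) → X → E × N → Prop := fun a i b =>
    dE b.1 = u a (d (x i)) ∧ dN b.2 = g (x i) - s a (d (x i)) - φ b.1
  have hudeg : ∀ a, (∀ i, T' i (a i)) → ∀ n, ∀ y ∈ 𝒢 n, u a y ∈ ℰ n := fun a ha =>
    hP.free.hom_mem hP.deg_mem (u a) ℰ (SetLike.one_mem_graded ℰ)
      (fun m n y hy z hz => SetLike.mul_mem_graded hy hz)
      fun i => by rw [hux]; exact (hTdeg i _ _ (ha i)).1
  have hsdeg : ∀ a, (∀ i, T' i (a i)) → ∀ n, ∀ y ∈ 𝒢 n, s a y ∈ 𝒩 (n + 1) := fun a ha =>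
    (hs a).degree_one hP hg.map_mem (fun n y hy => hφ.map_mem n _ (hudeg a ha n y hy))
      fun i => by rw [hsx]; exact (hTdeg i _ _ (ha i)).2
  obtain ⟨a, ha⟩ := exists_of_levelwise lev T' Good
    (fun i => by
      obtain ⟨e, t, h⟩ := hT0 i
      exact ⟨(e, t), h⟩)
    (by
      intro a a' i b _ haa' hb
      have hu' : ∀ y ∈ x '' {j | lev j < lev i}, u a y = u a' y := by
        rintro _ ⟨j, hj, rfl⟩; rw [hux, hux, haa' j hj]
      have h1 := algHom_eqOn_adjoin hu' (hP.diff_mem i)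
      have h2 := (hs a).eqOn (hs a') (fun _ _ => rfl)
        (fun y hy => by simp only [AlgHom.comp_apply, hu' y hy])
        (by rintro _ ⟨j, hj, rfl⟩; rw [hsx, hsx, haa' j hj]) (hP.diff_mem i)
      simp only [Good] at hb ⊢
      rwa [← h1, ← h2])
    (by
      intro a i haT haG
      have hup : ∀ y, parity ℰ (u a y) = u a (parity 𝒢 y) :=
        parity_map_of_degree_zero (f := (u a).toLinearMap) (hudeg a haT)
      have hlow : ∀ y ∈ Algebra.adjoin R (x '' {j | lev j < lev i}), u a (d y) = dE (u a y) :=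
        fun y hy => chain_on_adjoin hP.dga.diff_mul hE (u a) hup
          (by rintro _ ⟨j, hj, rfl⟩; rw [hux]; exact (haG j hj).1.symm) hy
      have hlow' : ∀ y ∈ Algebra.adjoin R (x '' {j | lev j < lev i}),
          s a (d y) + dN (s a y) = g y - φ (u a y) := fun y hy =>
        homotopy_on_adjoin hP.dga hN hg.toAlgHom (hφ.toAlgHom.comp (u a)) (s a) (hs a)
          hg.map_parity (parity_map_of_degree_one (hsdeg a haT)) hg.comm_apply
          (by
            rintro _ ⟨j, hj, rfl⟩
            simp only [AlgHom.comp_apply, IsDGAMap.toAlgHom_apply]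
            rw [hlow _ (Algebra.subset_adjoin ⟨j, hj, rfl⟩), hφ.comm_apply])
          (fun y => by
            simp only [AlgHom.comp_apply, IsDGAMap.toAlgHom_apply]
            rw [hφ.map_parity, hup])
          (by
            rintro _ ⟨j, hj, rfl⟩
            simp only [AlgHom.comp_apply, IsDGAMap.toAlgHom_apply]
            rw [hsx, (haG j hj).2, hux]
            abel) hy
      obtain ⟨e, t, h1, h2, h3⟩ := step i (u a) (s a)
        (fun j => by rw [hux, hsx]; exact haT j) (hs a) (hudeg a haT) (hsdeg a haT)
        (by rw [← hlow _ (hP.diff_mem i), hP.dga.diff_diff, map_zero])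
        (by
          have := hlow' _ (hP.diff_mem i)
          rwa [hP.dga.diff_diff, map_zero, zero_add] at this)
      exact ⟨(e, t), h1, h2, h3⟩)
  have haT : ∀ i, T' i (a i) := fun i => (ha i).1
  have hudga : IsDGAMap 𝒢 d ℰ dE (u a).toLinearMap :=
    .of_generators hP hE (u a) (fun i => hudeg a haT _ _ (hP.deg_mem i)) fun i => by
      rw [hux]; exact (ha i).2.1.symm
  refine ⟨(u a).toLinearMap, s a, hudga, .of_generators hP hN hg (hφ.comp hudga) (hs a)
    (fun i => hsdeg a haT _ _ (hP.deg_mem i)) fun i => ?_, fun j => ?_⟩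
  · rw [hsx, (ha i).2.2]
    simp only [LinearMap.comp_apply, AlgHom.toLinearMap_apply]
    rw [hux]
    abel
  · rw [AlgHom.toLinearMap_apply, hux, hsx]
    exact haT j

/-- A weak equivalence is surjective on homotopy classes of maps out of a semifree algebra. -/
theorem IsSemiFree.lift_of_weakEquiv {x : X → P} {lev deg : X → ℕ}
    (hP : IsSemiFree 𝒢 d x lev deg) (hE : IsDGA ℰ dE) (hN : IsDGA 𝒩 dN) {φ : E →ₗ[R] N}
    (hφ : IsDGAMap ℰ dE 𝒩 dN φ) (hw : IsWeakEquiv dE dN φ) {g : P →ₗ[R] N}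
    (hg : IsDGAMap 𝒢 d 𝒩 dN g) :
    ∃ u, IsDGAMap 𝒢 d ℰ dE u ∧ DerivationHomotopic 𝒢 d 𝒩 dN g (φ ∘ₗ u) := by
  obtain ⟨u, s, hu, hs, _⟩ := hP.exists_lift hE hN hφ hg
    (fun i e t => e ∈ ℰ (deg i) ∧ t ∈ 𝒩 (deg i + 1))
    (fun i => ⟨0, 0, Submodule.zero_mem _, Submodule.zero_mem _⟩) (fun _ _ _ h => h)
    (by
      intro i u s _ _ hu hs h1 h2
      have hxi := hP.deg_mem i
      obtain ⟨e, t, he, ht⟩ := hw.cone (b := g (x i) - s (d (x i))) h1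
        (by rw [map_sub, h2, ← hg.comm_apply, sub_sub_cancel])
      refine ⟨GradedAlgebra.proj ℰ (deg i) e, -GradedAlgebra.proj 𝒩 (deg i + 1) t,
        ⟨proj_mem _ _ _, Submodule.neg_mem _ (proj_mem _ _ _)⟩,
        hP.dga.diff_proj hE (u := u.toLinearMap) hu hxi he, ?_⟩
      have hm : g (x i) - s (d (x i)) ∈ 𝒩 (deg i) := Submodule.sub_mem _ (hg.map_mem _ _ hxi)
        (hP.dga.map_diff_mem (Q := 𝒩) hs hxi)
      have h3 : dN t = φ e - (g (x i) - s (d (x i))) := by rw [← ht, sub_sub_cancel]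
      rw [map_neg, ← proj_map_of_degree_neg_one hN.map_zero_degree hN.map_mem, h3, map_sub,
        proj_of_mem 𝒩 hm, proj_map_of_degree_zero hφ.map_mem]
      abel)
  exact ⟨u, hu, .of_homotopy hg (hφ.comp hu) hs⟩

end Lifting

/-! ### Resolution filtrations -/

section Filtration

variable {R : Type u} [CommRing R] {E : Type*} [AddCommGroup E] [Module R E]

/-- The sum of the pieces of degree less than `q`. -/
def fil (Q : ℕ → Submodule R E) (q : ℕ) : Submodule R E := ⨆ i, ⨆ _ : i < q, Q i

variable {Q : ℕ → Submodule R E}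

theorem le_fil {i q : ℕ} (h : i < q) : Q i ≤ fil Q q := le_iSup₂_of_le i h le_rfl

theorem fil_le {q : ℕ} {V : Submodule R E} (h : ∀ i < q, Q i ≤ V) : fil Q q ≤ V := iSup₂_le h

theorem fil_mono : Monotone (fil Q) := fun _ _ h => fil_le fun _ hi => le_fil (hi.trans_le h)

theorem fil_zero : fil Q 0 = ⊥ := le_bot_iff.1 (fil_le fun i hi => absurd hi (Nat.not_lt_zero i))

theorem fil_one : fil Q 1 = Q 0 := le_antisymm
  (fil_le fun i hi => by rw [Nat.lt_one_iff.1 hi]) (le_fil zero_lt_one)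

theorem map_fil {M : Type*} [AddCommGroup M] [Module R M] {f : E →ₗ[R] M} {q : ℕ}
    {V : Submodule R M} (h : ∀ i < q, ∀ x ∈ Q i, f x ∈ V) {z : E} (hz : z ∈ fil Q q) : f z ∈ V :=
  (fil_le (V := V.comap f) fun i hi x hx => h i hi x hx) hz

theorem iSup_add_two_le (q : ℕ) : (⨆ i, ⨆ _ : i + 2 ≤ q, Q i) = fil Q (q - 1) := by
  refine le_antisymm (iSup₂_le fun i hi => le_fil (by omega)) (fil_le fun i hi => ?_)
  exact le_iSup₂_of_le (f := fun i (_ : i + 2 ≤ q) => Q i) i (by omega) le_rfl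

/-- `Q` is a grading with projections `pr`. -/
structure IsGradingBy (Q : ℕ → Submodule R E) (pr : ℕ → E →ₗ[R] E) : Prop where
  mem : ∀ j z, pr j z ∈ Q j
  same : ∀ j, ∀ z ∈ Q j, pr j z = z
  ne : ∀ i j, ∀ z ∈ Q i, i ≠ j → pr j z = 0
  sum : ∀ z, ∃ n, ∀ m ≥ n, ∑ j ∈ Finset.range m, pr j z = z

theorem IsGradingBy.exhaust {pr : ℕ → E →ₗ[R] E} (h : IsGradingBy Q pr) (z : E) :
    ∃ q, z ∈ fil Q q := by
  obtain ⟨n, hn⟩ := h.sum z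
  refine ⟨n, ?_⟩
  rw [← hn n le_rfl]
  exact Submodule.sum_mem _ fun j hj => le_fil (Finset.mem_range.1 hj) (h.mem j z)

theorem IsGradingBy.pr_fil {pr : ℕ → E →ₗ[R] E} (h : IsGradingBy Q pr) {q j : ℕ} (hj : q ≤ j)
    {z : E} (hz : z ∈ fil Q q) : pr j z = 0 :=
  (Submodule.mem_bot R).1 (map_fil (V := ⊥) (fun i hi x hx => by
    rw [h.ne i j x hx (by omega)]; exact Submodule.zero_mem _) hz)

theorem IsGradingBy.sub_pr_mem {pr : ℕ → E →ₗ[R] E} (h : IsGradingBy Q pr) {q : ℕ}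
    {z : E} (hz : z ∈ fil Q (q + 1)) : z - pr q z ∈ fil Q q :=
  map_fil (f := LinearMap.id - pr q) (fun i hi x hx => by
    simp only [LinearMap.sub_apply, LinearMap.id_apply]
    rcases Nat.lt_succ_iff_lt_or_eq.1 hi with hi | rfl
    · rw [h.ne i q x hx hi.ne, sub_zero]; exact le_fil hi hx
    · rw [h.same _ x hx, sub_self]; exact Submodule.zero_mem _) hz

/-- A filtration of a complex like that of a perturbed resolution by resolution degree, `F q` being
the part of degree less than `q`. The condition `exact` says that the leading terms form a complex
that is exact in positive degrees: if the leading term of `z`, of degree `q + 1`, is a cycle, then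
the boundary of an element of degree `q + 2` cancels it. -/
structure IsResFiltration (d : E →ₗ[R] E) (F : ℕ → Submodule R E) : Prop where
  zero : F 0 = ⊥
  mono : Monotone F
  exhaust : ∀ e, ∃ q, e ∈ F q
  exact : ∀ q, ∀ z ∈ F (q + 2), d z ∈ F q → ∃ w ∈ F (q + 3), z - d w ∈ F (q + 1)

theorem isResFiltration_of_grading {pr : ℕ → E →ₗ[R] E} (hQ : IsGradingBy Q pr) {d h : E →ₗ[R] E}
    (hd : ∀ q, ∀ z ∈ Q (q + 1), d z ∈ Q q) (hd0 : ∀ z ∈ Q 0, d z = 0)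
    (hex : ∀ q, ∀ z ∈ Q (q + 1), d z = 0 → ∃ w ∈ Q (q + 2), d w = z)
    (hh : ∀ q, ∀ z ∈ Q q, h z ∈ fil Q (q - 1)) : IsResFiltration (d + h) (fil Q) where
  zero := fil_zero
  mono := fil_mono
  exhaust := hQ.exhaust
  exact := by
    have hfil : ∀ q, ∀ z ∈ fil Q (q + 1), (d + h) z ∈ fil Q q := by
      intro q z hz
      refine map_fil (fun i hi x hx => ?_) hz
      rw [LinearMap.add_apply]
      refine Submodule.add_mem _ ?_ (fil_mono (by omega) (hh i x hx))
      rcases i with _ | i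
      · rw [hd0 x hx]; exact Submodule.zero_mem _
      · exact le_fil (by omega) (hd i x hx)
    intro q z hz hdz
    have h1 := hQ.sub_pr_mem hz
    have h2 : d (pr (q + 1) z) = 0 := by
      have e : d (pr (q + 1) z) = (d + h) z - (d + h) (z - pr (q + 1) z) - h (pr (q + 1) z) := by
        simp only [LinearMap.add_apply, map_sub]; abel
      rw [← hQ.same q _ (hd q _ (hQ.mem (q + 1) z)), e]
      refine hQ.pr_fil le_rfl (Submodule.sub_mem _ (Submodule.sub_mem _ hdz (hfil q _ h1)) ?_)
      exact hh (q + 1) _ (hQ.mem _ z)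
    obtain ⟨w, hw, hdw⟩ := hex q _ (hQ.mem (q + 1) z) h2
    refine ⟨w, le_fil (by omega) hw, ?_⟩
    rw [LinearMap.add_apply, hdw, ← sub_sub]
    exact Submodule.sub_mem _ h1 (hh (q + 2) w hw)

/-- A cycle is homologous to an element of degree zero. For this, `d ∘ d = 0` is needed only up to
the degree of the cycle, which matters while a differential is under construction. -/
theorem IsResFiltration.reduce {d : E →ₗ[R] E} {F : ℕ → Submodule R E} (hF : IsResFiltration d F)
    (r : ℕ) (hdd : ∀ w ∈ F (r + 1), d (d w) = 0) {z : E} (hz : z ∈ F r) (hdz : d z = 0) :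
    ∃ w ∈ F (r + 1), z - d w ∈ F 1 := by
  induction r generalizing z with
  | zero =>
    rw [hF.zero, Submodule.mem_bot] at hz
    exact ⟨0, Submodule.zero_mem _, by rw [hz, map_zero, sub_zero]; exact Submodule.zero_mem _⟩
  | succ r ih =>
    rcases r with _ | q
    · exact ⟨0, Submodule.zero_mem _, by rwa [map_zero, sub_zero]⟩
    · obtain ⟨w, hw, hw'⟩ := hF.exact q z hz (by rw [hdz]; exact Submodule.zero_mem _)
      obtain ⟨w₂, hw₂, hw₂'⟩ := ih (fun w hw => hdd w (hF.mono (by omega) hw)) hw'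
        (by rw [map_sub, hdz, hdd w hw, sub_zero])
      exact ⟨w + w₂, Submodule.add_mem _ hw (hF.mono (by omega) hw₂), by
        rwa [map_add, ← sub_sub]⟩

/-- A boundary of degree less than `q` bounds an element of degree at most `q`. -/
theorem IsResFiltration.exists_bound {d : E →ₗ[R] E} {F : ℕ → Submodule R E}
    (hF : IsResFiltration d F) (hdd : ∀ w, d (d w) = 0) {q : ℕ} {w : E} (hz : d w ∈ F q) :
    ∃ w' ∈ F (q + 1), d w' = d w := by
  rcases q with _ | q
  · rw [hF.zero, Submodule.mem_bot] at hz
    exact ⟨0, Submodule.zero_mem _, by rw [map_zero, hz]⟩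
  · obtain ⟨r, hr⟩ := hF.exhaust w
    induction r generalizing w with
    | zero => exact ⟨w, hF.mono (Nat.zero_le _) hr, rfl⟩
    | succ r ih =>
      by_cases h : r + 1 ≤ q + 2
      · exact ⟨w, hF.mono h hr, rfl⟩
      · obtain ⟨r', rfl⟩ : ∃ r', r = r' + 1 := ⟨r - 1, by omega⟩
        obtain ⟨w₁, _, hw₁⟩ := hF.exact r' w hr (hF.mono (by omega) hz)
        obtain ⟨w', hw', e⟩ := ih (w := w - d w₁) (by rwa [map_sub, hdd, sub_zero]) hw₁
        exact ⟨w', hw', by rw [e, map_sub, hdd, sub_zero]⟩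

end Filtration

/-! ### Lifting with a prescribed leading term -/

section FilteredLift

variable {R : Type u} [CommRing R]
variable {P : Type*} {N : Type*} {E : Type*} [Ring P] [Ring N] [Ring E]
  [Algebra R P] [Algebra R N] [Algebra R E] {X : Type*}
variable {𝒢 : ℕ → Submodule R P} [GradedAlgebra 𝒢] {𝒩 : ℕ → Submodule R N} [GradedAlgebra 𝒩]
  {ℰ : ℕ → Submodule R E} [GradedAlgebra ℰ]
variable {d : P →ₗ[R] P} {dN : N →ₗ[R] N} {dE : E →ₗ[R] E}

theorem fil_mul_mem {Q : ℕ → Submodule R E}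
    (hQ : ∀ i j, ∀ a ∈ Q i, ∀ b ∈ Q j, a * b ∈ Q (i + j)) {m n q : ℕ} {a b : E}
    (h : ∀ i < m, ∀ j < n, i + j < q) (ha : a ∈ fil Q m) (hb : b ∈ fil Q n) :
    a * b ∈ fil Q q :=
  map_fil (f := LinearMap.mulRight R b) (fun i hi a ha =>
    map_fil (f := LinearMap.mulLeft R a) (fun j hj b hb => le_fil (h i hi j hj) (hQ i j a ha b hb))
      hb) ha

/-- `π` is a projection of the complex `(E, dE)` onto the kernel of the algebra map `κ`. -/
structure IsKernelProjection {C : Type*} [Ring C] [Algebra R C] (ℰ : ℕ → Submodule R E)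
    (dE : E →ₗ[R] E) (κ : E →ₐ[R] C) (π : E →ₗ[R] E) : Prop where
  map_proj : ∀ e, κ (π e) = 0
  eq_self : ∀ e, κ e = 0 → π e = e
  comm : ∀ e, π (dE e) = dE (π e)
  map_mem : ∀ n, ∀ e ∈ ℰ n, π e ∈ ℰ n

/-- Lifting a map `g` through a weak equivalence `φ` up to a derivation homotopy, such that the lift
has a prescribed leading term `L` for the resolution filtration, and agrees with `L` after `κ`. -/
theorem IsSemiFree.filtered_lift {x : X → P} {lev deg : X → ℕ} (hP : IsSemiFree 𝒢 d x lev deg)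
    (hE : IsDGA ℰ dE) (hN : IsDGA 𝒩 dN) {φ : E →ₗ[R] N} (hφ : IsDGAMap ℰ dE 𝒩 dN φ)
    (hw : IsWeakEquiv dE dN φ) {g : P →ₗ[R] N} (hg : IsDGAMap 𝒢 d 𝒩 dN g)
    {res : ℕ → Submodule R P} [GradedAlgebra res] (hres : ∀ i, x i ∈ res (lev i))
    (hdres : ∀ q, ∀ y ∈ res q, d y ∈ fil res q)
    {Q : ℕ → Submodule R E} (hF : IsResFiltration dE (fil Q)) (hQ1 : 1 ∈ Q 0)
    (hQ : ∀ i j, ∀ a ∈ Q i, ∀ b ∈ Q j, a * b ∈ Q (i + j))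
    (hQproj : ∀ q n, ∀ e ∈ Q q, GradedAlgebra.proj ℰ n e ∈ Q q)
    (L : P →ₐ[R] E) (hLdeg : ∀ n, ∀ y ∈ 𝒢 n, L y ∈ ℰ n) (hLres : ∀ q, ∀ y ∈ res q, L y ∈ Q q)
    (hLd : ∀ q, ∀ y ∈ res (q + 1), L (d y) - dE (L y) ∈ fil Q q)
    (hLd0 : ∀ y ∈ res 0, dE (L y) = 0)
    (hbase : ∀ y ∈ res 0, ∃ t, dN t = g y - φ (L y))
    {C C' : Type*} [Ring C] [Algebra R C] [Ring C'] [Algebra R C']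
    {κ : E →ₐ[R] C} {π : E →ₗ[R] E} (hπ : IsKernelProjection ℰ dE κ π)
    (hπQ : ∀ q, ∀ e ∈ Q q, π e ∈ Q q)
    {κN : N →ₐ[R] C'} {πN : N →ₗ[R] N} (hπN : IsKernelProjection 𝒩 dN κN πN)
    (hφπ : ∀ e, πN (φ e) = φ (π e)) (hκL : ∀ y, κ (L (d y)) = κ (dE (L y)))
    (hκN : ∀ y, κN (g y) = κN (φ (L y))) :
    ∃ u s, IsDGAMap 𝒢 d ℰ dE u ∧ IsDerivationHomotopy 𝒢 d 𝒩 dN g (φ ∘ₗ u) s ∧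
      (∀ q, ∀ y ∈ res q, u y - L y ∈ fil Q q) ∧ ∀ y, κ (u y) = κ (L y) := by
  have hκφ : ∀ e, κ e = 0 → κN (φ e) = 0 := fun e he => by
    rw [← hπ.eq_self e he, ← hφπ, hπN.map_proj]
  have hFproj : ∀ q n, ∀ e ∈ fil Q q, GradedAlgebra.proj ℰ n e ∈ fil Q q := fun q n e he =>
    map_fil (fun i hi e he => le_fil hi (hQproj i n e he)) he
  have hFπ : ∀ q, ∀ e ∈ fil Q q, π e ∈ fil Q q := fun q e he =>
    map_fil (fun i hi e he => le_fil hi (hπQ i e he)) he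
  -- the conditions on generators extend to all elements
  have hfilt : ∀ u : P →ₐ[R] E, (∀ j, u (x j) - L (x j) ∈ fil Q (lev j)) →
      ∀ q, ∀ y ∈ res q, u y - L y ∈ fil Q q := by
    intro u hu
    have hu1 : ∀ q, ∀ y ∈ res q, u y ∈ fil Q (q + 1) := by
      refine hP.free.hom_mem hres u (fun q => fil Q (q + 1)) (le_fil zero_lt_one hQ1) ?_ ?_
      · exact fun m n y hy z hz => fil_mul_mem hQ (fun i hi j hj => by omega) hy hz
      · intro i
        have := Submodule.add_mem _ (fil_mono (Nat.le_succ _) (hu i))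
          (le_fil (Nat.lt_succ_self _) (hLres _ _ (hres i)))
        rwa [sub_add_cancel] at this
    have hder : IsTwistedDer L u (u.toLinearMap - L.toLinearMap) := fun y z => by
      simp only [LinearMap.sub_apply, AlgHom.toLinearMap_apply, map_mul, mul_sub, sub_mul]; abel
    refine hP.free.der_mem hres hder (fil Q) ?_ ?_ hu
    · exact fun m n y hy z hz => fil_mul_mem hQ (fun i hi j hj => by omega)
        (le_fil (Nat.lt_succ_self _) (hLres m y hy)) hz
    · exact fun m n z hz y hy => fil_mul_mem hQ (fun i hi j hj => by omega) hz (hu1 n y hy)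
  have hκu : ∀ u : P →ₐ[R] E, (∀ j, κ (u (x j)) = κ (L (x j))) → ∀ y, κ (u y) = κ (L y) :=
    fun u hu y => DFunLike.congr_fun
      (hP.free.hom_ext (a := κ.comp u) (b := κ.comp L) hu) y
  obtain ⟨u, s, hu, hs, hT⟩ := hP.exists_lift hE hN hφ hg
    (fun i e t => e ∈ ℰ (deg i) ∧ t ∈ 𝒩 (deg i + 1) ∧ e - L (x i) ∈ fil Q (lev i) ∧
      κ e = κ (L (x i)) ∧ κN t = 0)
    (fun i => ⟨L (x i), 0, hLdeg _ _ (hP.deg_mem i), Submodule.zero_mem _,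
      by rw [sub_self]; exact Submodule.zero_mem _, rfl, map_zero _⟩)
    (fun _ _ _ h => ⟨h.1, h.2.1⟩)
    (by
      intro i u s hT hsmul hu hs h1 h2
      have hxi := hP.deg_mem i
      have hfu := hfilt u fun j => (hT j).2.2.1
      have hκu' := hκu u fun j => (hT j).2.2.2.1
      have hκs : ∀ y, κN (s y) = 0 := by
        have hder : IsTwistedDer (κN.comp (hg.toAlgHom.comp (parityHom 𝒢)))
            ((κN.comp hφ.toAlgHom).comp u) (κN.toLinearMap ∘ₗ s) := fun y z => by
          simp [hsmul]
        intro y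
        refine hder.eq_zero (S := Set.range x) ?_ (by rw [hP.free.adjoin_eq_top]; trivial)
        rintro _ ⟨j, rfl⟩
        exact (hT j).2.2.2.2
      -- a correction `w` to the leading term that solves the two equations
      obtain ⟨w, t, hwF, hw1, hw2⟩ : ∃ w t, w ∈ fil Q (lev i) ∧
          dE w = u (d (x i)) - dE (L (x i)) ∧ dN t = g (x i) - s (d (x i)) - φ (L (x i)) - φ w := by
        rcases hq : lev i with _ | q
        · have hx0 : x i ∈ res 0 := hq ▸ hres i
          have hdx : d (x i) = 0 := by
            have := hdres 0 _ hx0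
            rwa [fil_zero, Submodule.mem_bot] at this
          obtain ⟨t, ht⟩ := hbase _ hx0
          refine ⟨0, t, Submodule.zero_mem _, ?_, ?_⟩
          · rw [map_zero, hdx, map_zero, hLd0 _ hx0, sub_zero]
          · rw [ht, hdx, map_zero, map_zero, sub_zero, sub_zero]
        · have hxq : x i ∈ res (q + 1) := hq ▸ hres i
          obtain ⟨hφd, hinj, hsurj⟩ := isWeakEquiv_iff.1 hw
          obtain ⟨e₀, he₀⟩ := hinj _ (g (x i) - s (d (x i))) h1
            (by rw [map_sub, h2, ← hg.comm_apply, sub_sub_cancel])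
          have hc : dE (e₀ - L (x i)) ∈ fil Q q := by
            rw [map_sub, he₀]
            have h3 : u (d (x i)) - L (d (x i)) ∈ fil Q q :=
              map_fil (f := u.toLinearMap - L.toLinearMap)
                (fun j hj y hy => fil_mono (Nat.lt_succ_iff.1 hj) (hfu j y hy)) (hdres _ _ hxq)
            have := Submodule.add_mem _ h3 (hLd q _ hxq)
            rwa [sub_add_sub_cancel] at this
          obtain ⟨w, hwF, hdw⟩ := hF.exists_bound hE.diff_diff hc
          rw [map_sub, he₀] at hdw
          obtain ⟨y₀, t₀, hy₀, hm⟩ := hsurj (g (x i) - s (d (x i)) - φ (L (x i)) - φ w) (by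
            rw [map_sub, map_sub, map_sub, h2, ← hg.comm_apply, ← hφd, ← hφd, hdw, map_sub]
            abel)
          obtain ⟨r, hr⟩ := hF.exhaust y₀
          obtain ⟨b, _, hb⟩ := hF.reduce r (fun w _ => hE.diff_diff w) hr hy₀
          refine ⟨w + (y₀ - dE b), t₀ + φ b, Submodule.add_mem _ hwF (fil_mono (by omega) hb),
            ?_, ?_⟩
          · rw [map_add, map_sub, hE.diff_diff, hy₀, hdw, sub_zero, add_zero]
          · rw [map_add, map_add, map_sub, ← sub_sub, hm, hφd]; abel
      -- pass to homogeneous components, and to the kernels of `κ` and `κN`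
      have hLi := hLdeg _ _ hxi
      have hw1' : dE (GradedAlgebra.proj ℰ (deg i) w) = u (d (x i)) - dE (L (x i)) := by
        have h3 : dE (w + L (x i)) = u.toLinearMap (d (x i)) := by
          rw [map_add, hw1, sub_add_cancel]; rfl
        have := hP.dga.diff_proj hE (u := u.toLinearMap) hu hxi h3
        rw [map_add, proj_of_mem ℰ hLi, map_add] at this
        rw [eq_sub_iff_add_eq, this]; rfl
      have hw2' : dN (GradedAlgebra.proj 𝒩 (deg i + 1) t) =
          g (x i) - s (d (x i)) - φ (L (x i)) - φ (GradedAlgebra.proj ℰ (deg i) w) := by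
        rw [← proj_map_of_degree_neg_one hN.map_zero_degree hN.map_mem, hw2, map_sub, map_sub,
          map_sub, proj_of_mem 𝒩 (hg.map_mem _ _ hxi),
          proj_of_mem 𝒩 (hP.dga.map_diff_mem (Q := 𝒩) hs hxi),
          proj_of_mem 𝒩 (hφ.map_mem _ _ hLi), proj_map_of_degree_zero hφ.map_mem]
      refine ⟨L (x i) + π (GradedAlgebra.proj ℰ (deg i) w), πN (GradedAlgebra.proj 𝒩 (deg i + 1) t),
        ⟨Submodule.add_mem _ hLi (hπ.map_mem _ _ (proj_mem _ _ _)),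
          hπN.map_mem _ _ (proj_mem _ _ _), ?_, ?_, hπN.map_proj _⟩, ?_, ?_⟩
      · rw [add_sub_cancel_left]
        exact hFπ _ _ (hFproj _ _ _ hwF)
      · rw [map_add, hπ.map_proj, add_zero]
      · rw [map_add, ← hπ.comm, hw1', hπ.eq_self, add_sub_cancel]
        rw [map_sub, hκu', hκL, sub_self]
      · rw [← hπN.comm, hw2', map_sub, hφπ, hπN.eq_self, map_add, ← sub_sub]
        rw [map_sub, map_sub, hκs, sub_zero, hκN, sub_self])
  refine ⟨u, s, hu, hs, hfilt hu.toAlgHom fun j => (hT j).2.2.1,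
    hκu hu.toAlgHom fun j => (hT j).2.2.2.1⟩

end FilteredLift

/-! ### Resolutions and their perturbations -/

section Resolution

variable {R : Type u} [CommRing R] {E : Type*} [AddCommGroup E] [Module R E]
  {N : Type*} [AddCommGroup N] [Module R N]

/-- `φ : (E, d) → N` is a resolution of the module `N` by the complex `E`, graded by `Q` (with
projections `pr`): the differential has degree `-1` and `φ` induces an isomorphism in homology. -/
structure IsResolution (Q : ℕ → Submodule R E) (pr : ℕ → E →ₗ[R] E) (d : E →ₗ[R] E)
    (φ : E →ₗ[R] N) : Prop where
  grading : IsGradingBy Q pr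
  diff_mem : ∀ q, ∀ z ∈ Q (q + 1), d z ∈ Q q
  diff_zero : ∀ z ∈ Q 0, d z = 0
  map_pos : ∀ q, ∀ z ∈ Q (q + 1), φ z = 0
  map_diff : ∀ z, φ (d z) = 0
  exact : ∀ z, d z = 0 → φ z = 0 → ∃ w, d w = z
  surj : Function.Surjective φ

variable {Q : ℕ → Submodule R E} {pr : ℕ → E →ₗ[R] E} {d h : E →ₗ[R] E} {φ : E →ₗ[R] N}

theorem IsGradingBy.induction (hQ : IsGradingBy Q pr) {p : E → Prop} (h0 : p 0)
    (hom : ∀ q, ∀ z ∈ Q q, p z) (add : ∀ y z, p y → p z → p (y + z)) (z : E) : p z := by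
  obtain ⟨n, hn⟩ := hQ.sum z
  rw [← hn n le_rfl]
  exact Finset.sum_induction _ p add h0 fun j _ => hom j _ (hQ.mem j z)

theorem IsGradingBy.pr_diff (hQ : IsGradingBy Q pr) (hd : ∀ q, ∀ z ∈ Q (q + 1), d z ∈ Q q)
    (hd0 : ∀ z ∈ Q 0, d z = 0) (q : ℕ) (z : E) : pr q (d z) = d (pr (q + 1) z) := by
  induction z using hQ.induction with
  | h0 => simp
  | add y z hy hz => rw [map_add, map_add, hy, hz, map_add, map_add]
  | hom i z hz =>
    rcases i with _ | i
    · rw [hd0 z hz, hQ.ne 0 _ z hz (by omega), map_zero, map_zero]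
    · by_cases hi : i = q
      · rw [hi] at hz
        rw [hQ.same _ _ (hd _ z hz), hQ.same _ _ hz]
      · rw [hQ.ne i q _ (hd i z hz) hi, hQ.ne _ _ z hz (by omega), map_zero]

theorem IsGradingBy.map_pr_zero (hQ : IsGradingBy Q pr) (hφ : ∀ q, ∀ z ∈ Q (q + 1), φ z = 0)
    (z : E) : φ (pr 0 z) = φ z := by
  induction z using hQ.induction with
  | h0 => simp
  | add y z hy hz => rw [map_add, map_add, hy, hz, map_add]
  | hom i z hz =>
    rcases i with _ | i
    · rw [hQ.same 0 z hz]
    · rw [hφ i z hz, hQ.ne _ _ z hz (by omega), map_zero]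

theorem isGradingBy_proj {A : Type*} [Ring A] [Algebra R A] (𝒜 : ℕ → Submodule R A)
    [GradedAlgebra 𝒜] : IsGradingBy 𝒜 (GradedAlgebra.proj 𝒜) where
  mem := fun _ _ => proj_mem _ _ _
  same := fun _ _ hz => proj_of_mem _ hz
  ne := fun _ _ _ hz hij => proj_of_mem_ne _ hz hij
  sum := sum_proj 𝒜

namespace IsResolution

theorem isResFiltration (hE : IsResolution Q pr d φ) (hh : ∀ q, ∀ z ∈ Q q, h z ∈ fil Q (q - 1)) :
    IsResFiltration (d + h) (fil Q) := by
  refine isResFiltration_of_grading hE.grading hE.diff_mem hE.diff_zero (fun q z hz hdz => ?_) hh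
  obtain ⟨w, hw⟩ := hE.exact z hdz (hE.map_pos q z hz)
  refine ⟨pr (q + 2) w, hE.grading.mem _ _, ?_⟩
  rw [← hE.grading.pr_diff hE.diff_mem hE.diff_zero, hw, hE.grading.same _ _ hz]

theorem exists_zero (hE : IsResolution Q pr d φ) (n : N) : ∃ y ∈ Q 0, φ y = n := by
  obtain ⟨z, rfl⟩ := hE.surj n
  exact ⟨pr 0 z, hE.grading.mem 0 z, hE.grading.map_pr_zero hE.map_pos z⟩

theorem perturbation_zero (hh : ∀ q, ∀ z ∈ Q q, h z ∈ fil Q (q - 1))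
    {z : E} (hz : z ∈ fil Q 2) : h z = 0 := by
  have := map_fil (f := h) (V := ⊥) (fun i hi x hx => by
    have := hh i x hx
    rwa [show i - 1 = 0 by omega, fil_zero] at this) hz
  exact (Submodule.mem_bot R).1 this

theorem diff_zero_of_perturbation (hE : IsResolution Q pr d φ)
    (hh : ∀ q, ∀ z ∈ Q q, h z ∈ fil Q (q - 1)) {y : E} (hy : y ∈ Q 0) : (d + h) y = 0 := by
  rw [LinearMap.add_apply, hE.diff_zero y hy,
    perturbation_zero hh (le_fil zero_lt_two hy), add_zero]

/-- The kernel of `φ` in degree zero consists of boundaries, also for a perturbed differential. -/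
theorem exists_diff_eq (hE : IsResolution Q pr d φ) (hh : ∀ q, ∀ z ∈ Q q, h z ∈ fil Q (q - 1))
    {y : E} (hy : y ∈ Q 0) (hφ : φ y = 0) : ∃ w, (d + h) w = y := by
  obtain ⟨w, hw⟩ := hE.exact y (hE.diff_zero y hy) hφ
  refine ⟨pr 1 w, ?_⟩
  rw [LinearMap.add_apply, perturbation_zero hh (le_fil one_lt_two (hE.grading.mem 1 w)),
    ← hE.grading.pr_diff hE.diff_mem hE.diff_zero, hw, hE.grading.same 0 y hy, add_zero]

/-- Boundaries of degree zero for a perturbed differential are in the kernel of `φ`. -/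
theorem map_eq_zero (hE : IsResolution Q pr d φ) (hh : ∀ q, ∀ z ∈ Q q, h z ∈ fil Q (q - 1))
    (hdd : ∀ w, (d + h) ((d + h) w) = 0) {w : E} (hy : (d + h) w ∈ Q 0) : φ ((d + h) w) = 0 := by
  obtain ⟨w', hw', e⟩ := (hE.isResFiltration hh).exists_bound hdd (q := 1) (by rwa [fil_one])
  rw [← e, LinearMap.add_apply, perturbation_zero hh hw', add_zero, hE.map_diff]

/-- A cycle for a perturbed differential is homologous to an element of degree zero. -/
theorem exists_homologous (hE : IsResolution Q pr d φ) (hh : ∀ q, ∀ z ∈ Q q, h z ∈ fil Q (q - 1))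
    (hdd : ∀ w, (d + h) ((d + h) w) = 0) {z : E} (hz : (d + h) z = 0) :
    ∃ y ∈ Q 0, ∃ w, (d + h) w = z - y := by
  obtain ⟨r, hr⟩ := hE.grading.exhaust z
  obtain ⟨w, _, hw⟩ := (hE.isResFiltration hh).reduce r (fun w _ => hdd w) hr hz
  rw [fil_one] at hw
  exact ⟨_, hw, w, by rw [sub_sub_cancel]⟩

theorem map_eq_of_homologous (hE : IsResolution Q pr d φ) (hh : ∀ q, ∀ z ∈ Q q, h z ∈ fil Q (q - 1))
    (hdd : ∀ w, (d + h) ((d + h) w) = 0) {y y' w : E} (hy : y ∈ Q 0) (hy' : y' ∈ Q 0)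
    (hw : (d + h) w = y - y') : φ y = φ y' := by
  have := hE.map_eq_zero hh hdd (w := w) (by rw [hw]; exact Submodule.sub_mem _ hy hy')
  rwa [hw, map_sub, sub_eq_zero] at this

end IsResolution

end Resolution

/-! ### The resolution grading of the tensor square -/

section TensorRes

variable {R : Type u} [CommRing R] {A : Type*} [Ring A] [Algebra R A]
  {𝒜 : ℕ → Submodule R A} [GradedAlgebra 𝒜] {ℛ : ℕ → Submodule R A} [GradedAlgebra ℛ]

/-- The projection of `A ⊗ A` onto the part of resolution degree `q`. -/
def tensorProj (𝒜 ℛ : ℕ → Submodule R A) [GradedAlgebra 𝒜] [GradedAlgebra ℛ] (q : ℕ) :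
    (𝒜 ᵍ⊗[R] 𝒜) →ₗ[R] (𝒜 ᵍ⊗[R] 𝒜) :=
  ∑ p ∈ Finset.HasAntidiagonal.antidiagonal q,
    tensorMap (GradedAlgebra.proj ℛ p.1) (GradedAlgebra.proj ℛ p.2)

theorem tensorProj_tmul {i j q : ℕ} {a b : A} (ha : a ∈ ℛ i) (hb : b ∈ ℛ j) :
    tensorProj 𝒜 ℛ q (a ᵍ⊗ₜ[R] b) = if i + j = q then a ᵍ⊗ₜ[R] b else 0 := by
  rw [tensorProj, LinearMap.sum_apply]
  split_ifs with h
  · rw [Finset.sum_eq_single (i, j)]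
    · rw [tensorMap_tmul, proj_of_mem ℛ ha, proj_of_mem ℛ hb]
    · rintro ⟨k, l⟩ _ hne
      rw [tensorMap_tmul]
      by_cases hk : i = k
      · rw [proj_of_mem_ne ℛ hb (fun hl => hne (by rw [hk, hl])), tmul_zero_right]
      · rw [proj_of_mem_ne ℛ ha hk, tmul_zero_left]
    · exact fun h' => absurd (Finset.HasAntidiagonal.mem_antidiagonal.2 h) h'
  · refine Finset.sum_eq_zero ?_
    rintro ⟨k, l⟩ hkl
    rw [Finset.HasAntidiagonal.mem_antidiagonal] at hkl
    rw [tensorMap_tmul]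
    by_cases hk : i = k
    · rw [proj_of_mem_ne ℛ hb (fun hl => h (by rw [hk, hl]; exact hkl)), tmul_zero_right]
    · rw [proj_of_mem_ne ℛ ha hk, tmul_zero_left]

theorem tensor_res_induction (ℛ : ℕ → Submodule R A) [GradedAlgebra ℛ]
    {p : 𝒜 ᵍ⊗[R] 𝒜 → Prop} (h0 : p 0)
    (tmul : ∀ i j, ∀ a ∈ ℛ i, ∀ b ∈ ℛ j, p (a ᵍ⊗ₜ[R] b)) (add : ∀ x y, p x → p y → p (x + y))
    (t : 𝒜 ᵍ⊗[R] 𝒜) : p t := by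
  induction t using tensor_induction with
  | h0 => exact h0
  | add x y hx hy => exact add x y hx hy
  | tmul a b =>
    induction a using homogeneous_induction ℛ with
    | h0 => rwa [tmul_zero_left]
    | add x y hx hy => rw [tmul_add_left]; exact add _ _ hx hy
    | hom i a ha =>
      induction b using homogeneous_induction ℛ with
      | h0 => rwa [tmul_zero_right]
      | add x y hx hy => rw [tmul_add_right]; exact add _ _ hx hy
      | hom j b hb => exact tmul i j a ha b hb

theorem isGradingBy_tensorProj (𝒜 ℛ : ℕ → Submodule R A) [GradedAlgebra 𝒜] [GradedAlgebra ℛ] :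
    IsGradingBy (tensorDeg 𝒜 𝒜 ℛ ℛ) (tensorProj 𝒜 ℛ) where
  mem := by
    intro q t
    induction t using tensor_res_induction ℛ with
    | h0 => rw [map_zero]; exact Submodule.zero_mem _
    | add x y hx hy => rw [map_add]; exact Submodule.add_mem _ hx hy
    | tmul i j a ha b hb =>
      rw [tensorProj_tmul ha hb]
      split_ifs with h
      · rw [← h]; exact tmul_mem _ _ ha hb
      · exact Submodule.zero_mem _
  same := by
    intro q t ht
    rw [← sub_eq_zero, ← Submodule.mem_bot R]
    refine tensor_map_mem (f := tensorProj 𝒜 ℛ q - LinearMap.id) (fun i j hij a ha b hb => ?_) ht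
    rw [LinearMap.sub_apply, tensorProj_tmul ha hb, if_pos hij, LinearMap.id_apply, sub_self]
    exact Submodule.zero_mem _
  ne := by
    intro q q' t ht hq
    rw [← Submodule.mem_bot R]
    refine tensor_map_mem (f := tensorProj 𝒜 ℛ q') (fun i j hij a ha b hb => ?_) ht
    rw [tensorProj_tmul ha hb, if_neg (by omega)]
    exact Submodule.zero_mem _
  sum := by
    intro t
    induction t using tensor_res_induction ℛ with
    | h0 => exact ⟨0, fun m _ => by simp⟩
    | add x y hx hy =>
      obtain ⟨n, hn⟩ := hx
      obtain ⟨n', hn'⟩ := hy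
      refine ⟨max n n', fun m hm => ?_⟩
      simp only [map_add, Finset.sum_add_distrib]
      rw [hn m (by omega), hn' m (by omega)]
    | tmul i j a ha b hb =>
      refine ⟨i + j + 1, fun m hm => ?_⟩
      rw [Finset.sum_eq_single (i + j), tensorProj_tmul ha hb, if_pos rfl]
      · intro k _ hk
        rw [tensorProj_tmul ha hb, if_neg hk.symm]
      · exact fun h => absurd (Finset.mem_range.2 (by omega)) h

theorem tmul_fil_left {p j q : ℕ} (h : ∀ k < p, k + j < q) {a b : A} (ha : a ∈ fil ℛ p)
    (hb : b ∈ ℛ j) : (a ᵍ⊗ₜ[R] b : 𝒜 ᵍ⊗[R] 𝒜) ∈ fil (tensorDeg 𝒜 𝒜 ℛ ℛ) q :=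
  map_fil (f := ((GradedTensorProduct.of R 𝒜 𝒜).toLinearMap ∘ₗ
      (TensorProduct.mk R A A).flip b)) (fun k hk _ hx => le_fil (h k hk) (tmul_mem _ _ hx hb)) ha

theorem tmul_fil_right {p j q : ℕ} (h : ∀ k < p, j + k < q) {a b : A} (ha : a ∈ ℛ j)
    (hb : b ∈ fil ℛ p) : (a ᵍ⊗ₜ[R] b : 𝒜 ᵍ⊗[R] 𝒜) ∈ fil (tensorDeg 𝒜 𝒜 ℛ ℛ) q :=
  map_fil (f := ((GradedTensorProduct.of R 𝒜 𝒜).toLinearMap ∘ₗ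
      TensorProduct.mk R A A a)) (fun k hk _ hx => le_fil (h k hk) (tmul_mem _ _ ha hx)) hb

/-- Elements of resolution degree `q` are sums of bihomogeneous ones. -/
theorem bihomogeneous_induction (hbi : ∀ q n, ∀ x ∈ ℛ q, GradedAlgebra.proj 𝒜 n x ∈ ℛ q)
    {q : ℕ} {p : A → Prop} (h0 : p 0) (hom : ∀ n, ∀ x ∈ 𝒜 n, x ∈ ℛ q → p x)
    (add : ∀ x y, p x → p y → p (x + y)) {x : A} (hx : x ∈ ℛ q) : p x := by
  obtain ⟨n, hn⟩ := sum_proj 𝒜 x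
  rw [← hn n le_rfl]
  exact Finset.sum_induction _ p add h0 fun j _ => hom j _ (proj_mem _ _ _) (hbi q j x hx)

theorem tensorDeg_induction (hbi : ∀ q n, ∀ x ∈ ℛ q, GradedAlgebra.proj 𝒜 n x ∈ ℛ q)
    {q : ℕ} {p : 𝒜 ᵍ⊗[R] 𝒜 → Prop} (h0 : p 0)
    (tmul : ∀ i j m n, i + j = q → ∀ a ∈ ℛ i, a ∈ 𝒜 m → ∀ b ∈ ℛ j, b ∈ 𝒜 n → p (a ᵍ⊗ₜ[R] b))
    (add : ∀ x y, p x → p y → p (x + y)) {t : 𝒜 ᵍ⊗[R] 𝒜} (ht : t ∈ tensorDeg 𝒜 𝒜 ℛ ℛ q) :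
    p t := by
  have key : ∀ i j, i + j = q → ∀ a ∈ ℛ i, ∀ b ∈ ℛ j, p (a ᵍ⊗ₜ[R] b) := by
    intro i j hij a ha b hb
    refine bihomogeneous_induction hbi (p := fun a => p (a ᵍ⊗ₜ[R] b))
      (by rwa [tmul_zero_left]) (fun m a ham ha => ?_)
      (fun x y hx hy => by rw [tmul_add_left]; exact add _ _ hx hy) ha
    refine bihomogeneous_induction hbi (p := fun b => p (a ᵍ⊗ₜ[R] b))
      (by rwa [tmul_zero_right]) (fun n b hbn hb => ?_)
      (fun x y hx hy => by rw [tmul_add_right]; exact add _ _ hx hy) hb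
    exact tmul i j m n hij a ha ham b hb hbn
  induction ht using Submodule.span_induction with
  | zero => exact h0
  | add x y _ _ hx hy => exact add x y hx hy
  | mem x hx =>
    obtain ⟨i, j, hij, a, ha, b, hb, rfl⟩ := hx
    exact key i j hij a ha b hb
  | smul r x hx _ =>
    -- a multiple of a sum of tensors is a sum of tensors
    have : ∀ x ∈ tensorDeg 𝒜 𝒜 ℛ ℛ q, ∀ r : R, p (r • x) := by
      intro x hx
      induction hx using Submodule.span_induction with
      | zero => intro r; rwa [smul_zero]
      | add x y _ _ hx hy => intro r; rw [smul_add]; exact add _ _ (hx r) (hy r)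
      | smul s x _ hx => intro r; rw [smul_smul]; exact hx _
      | mem x hx =>
        obtain ⟨i, j, hij, a, ha, b, hb, rfl⟩ := hx
        intro r
        rw [← tmul_smul_left]
        exact key i j hij _ (Submodule.smul_mem _ r ha) b hb
    exact this x hx r

theorem tensorDeg_mul_mem (hbi : ∀ q n, ∀ x ∈ ℛ q, GradedAlgebra.proj 𝒜 n x ∈ ℛ q) (q q' : ℕ) :
    ∀ s ∈ tensorDeg 𝒜 𝒜 ℛ ℛ q, ∀ t ∈ tensorDeg 𝒜 𝒜 ℛ ℛ q',
      s * t ∈ tensorDeg 𝒜 𝒜 ℛ ℛ (q + q') := by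
  intro s hs t ht
  refine tensorDeg_induction hbi (p := fun s => s * t ∈ _)
    (by rw [zero_mul]; exact Submodule.zero_mem _) (fun i j m n hij a ha ham b hb hbn => ?_)
    (fun x y hx hy => by rw [add_mul]; exact Submodule.add_mem _ hx hy) hs
  refine tensorDeg_induction hbi (p := fun t => a ᵍ⊗ₜ[R] b * t ∈ _)
    (by rw [mul_zero]; exact Submodule.zero_mem _) (fun i' j' m' n' hij' a' ha' ham' b' hb' _ => ?_)
    (fun x y hx hy => by rw [mul_add]; exact Submodule.add_mem _ hx hy) ht
  rw [tmul_mul_tmul a hbn ham' b', show q + q' = (i + i') + (j + j') by omega]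
  exact Submodule.smul_mem _ _
    (tmul_mem _ _ (SetLike.GradedMul.mul_mem ha ha') (SetLike.GradedMul.mul_mem hb hb'))

theorem tensorDeg_proj_mem (hbi : ∀ q n, ∀ x ∈ ℛ q, GradedAlgebra.proj 𝒜 n x ∈ ℛ q) (q n : ℕ) :
    ∀ t ∈ tensorDeg 𝒜 𝒜 ℛ ℛ q,
      GradedAlgebra.proj (tensorGr 𝒜 𝒜) n t ∈ tensorDeg 𝒜 𝒜 ℛ ℛ q := by
  intro t ht
  refine tensorDeg_induction hbi (p := fun t => GradedAlgebra.proj (tensorGr 𝒜 𝒜) n t ∈ _)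
    (by rw [map_zero]; exact Submodule.zero_mem _) (fun i j m k hij a ha ham b hb hbn => ?_)
    (fun x y hx hy => by rw [map_add]; exact Submodule.add_mem _ hx hy) ht
  have hm : (a ᵍ⊗ₜ[R] b : 𝒜 ᵍ⊗[R] 𝒜) ∈ tensorGr 𝒜 𝒜 (m + k) := tmul_mem _ _ ham hbn
  by_cases h : m + k = n
  · rw [proj_of_mem _ (h ▸ hm), ← hij]; exact tmul_mem _ _ ha hb
  · rw [proj_of_mem_ne _ hm h]; exact Submodule.zero_mem _

theorem parity_res_mem (hbi : ∀ q n, ∀ x ∈ ℛ q, GradedAlgebra.proj 𝒜 n x ∈ ℛ q) {q : ℕ} {x : A}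
    (hx : x ∈ ℛ q) : parity 𝒜 x ∈ ℛ q :=
  bihomogeneous_induction hbi (p := fun x => parity 𝒜 x ∈ ℛ q)
    (by rw [map_zero]; exact Submodule.zero_mem _)
    (fun n x hx hx' => by rw [parity_of_mem 𝒜 hx]; exact Submodule.smul_mem _ _ hx')
    (fun x y hx hy => by rw [map_add]; exact Submodule.add_mem _ hx hy) hx

theorem tensorDiff_add (d h : A →ₗ[R] A) :
    tensorDiff 𝒜 𝒜 (d + h) (d + h) = tensorDiff 𝒜 𝒜 d d + tensorDiff 𝒜 𝒜 h h := by
  refine tensor_ext _ _ fun i j a b => ?_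
  rw [LinearMap.add_apply, tensorDiff_tmul, tensorDiff_tmul, tensorDiff_tmul, LinearMap.add_apply,
    LinearMap.add_apply, tmul_add_left, tmul_add_right]
  abel

theorem tensorDiff_fil_mem (hbi : ∀ q n, ∀ x ∈ ℛ q, GradedAlgebra.proj 𝒜 n x ∈ ℛ q)
    {h : A →ₗ[R] A} (hh : ∀ q, ∀ z ∈ ℛ q, h z ∈ fil ℛ (q - 1)) (q : ℕ) :
    ∀ t ∈ tensorDeg 𝒜 𝒜 ℛ ℛ q, tensorDiff 𝒜 𝒜 h h t ∈ fil (tensorDeg 𝒜 𝒜 ℛ ℛ) (q - 1) := by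
  intro t ht
  refine tensor_map_mem (f := tensorDiff 𝒜 𝒜 h h) (fun i j hij a ha b hb => ?_) ht
  rw [tensorDiff_tmul]
  exact Submodule.add_mem _ (tmul_fil_left (fun k hk => by omega) (hh i a ha) hb)
    (tmul_fil_right (fun k hk => by omega) (parity_res_mem hbi ha) (hh j b hb))

/-- The tensor square of a resolution of a flat graded algebra. -/
theorem IsResolution.tensor {H : Type*} [Ring H] [Algebra R H] {ℋ : ℕ → Submodule R H}
    [GradedAlgebra ℋ] [Module.Flat R H] [Module.Flat R A]
    (hbi : ∀ q n, ∀ x ∈ ℛ q, GradedAlgebra.proj 𝒜 n x ∈ ℛ q) {d : A →ₗ[R] A} {φ : A →ₗ[R] H}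
    (hA : IsDGA 𝒜 d) (hφ : IsDGAMap 𝒜 d ℋ 0 φ) (hw : IsWeakEquiv d 0 φ)
    (hr : IsResolution ℛ (GradedAlgebra.proj ℛ) d φ) :
    IsResolution (tensorDeg 𝒜 𝒜 ℛ ℛ) (tensorProj 𝒜 ℛ) (tensorDiff 𝒜 𝒜 d d)
      (tensorMap φ φ : (𝒜 ᵍ⊗[R] 𝒜) →ₗ[R] (ℋ ᵍ⊗[R] ℋ)) := by
  have hH : IsDGA ℋ (0 : H →ₗ[R] H) :=
    ⟨fun _ _ _ => Submodule.zero_mem _, fun _ _ => rfl, rfl, fun _ _ _ _ => by simp⟩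
  have hH0 : tensorDiff ℋ ℋ (0 : H →ₗ[R] H) 0 = 0 := tensor_ext _ _ fun i j a b => by
    rw [tensorDiff_tmul]
    simp [tmul_zero_left, tmul_zero_right]
  have hww := IsWeakEquiv.tensor hφ hφ hw hw hA hA hH hH
  rw [hH0] at hww
  obtain ⟨h1, h2, h3⟩ := isWeakEquiv_iff.1 hww
  refine ⟨isGradingBy_tensorProj 𝒜 ℛ, ?_, ?_, ?_, h1, fun z hz hz' => h2 z 0 hz hz', ?_⟩
  · intro q t ht
    refine tensor_map_mem (f := tensorDiff 𝒜 𝒜 d d) (fun i j hij a ha b hb => ?_) ht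
    rw [tensorDiff_tmul]
    refine Submodule.add_mem _ ?_ ?_
    · rcases i with _ | i
      · rw [hr.diff_zero a ha, tmul_zero_left]; exact Submodule.zero_mem _
      · rw [show q = i + j by omega]; exact tmul_mem _ _ (hr.diff_mem i a ha) hb
    · rcases j with _ | j
      · rw [hr.diff_zero b hb, tmul_zero_right]; exact Submodule.zero_mem _
      · rw [show q = i + j by omega]
        exact tmul_mem _ _ (parity_res_mem hbi ha) (hr.diff_mem j b hb)
  · intro t ht
    rw [← Submodule.mem_bot R]
    refine tensor_map_mem (f := tensorDiff 𝒜 𝒜 d d) (fun i j hij a ha b hb => ?_) ht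
    obtain rfl : i = 0 := by omega
    obtain rfl : j = 0 := by omega
    rw [tensorDiff_tmul, hr.diff_zero a ha, hr.diff_zero b hb, tmul_zero_left, tmul_zero_right,
      add_zero]
    exact Submodule.zero_mem _
  · intro q t ht
    rw [← Submodule.mem_bot R]
    refine tensor_map_mem (f := tensorMap φ φ) (fun i j hij a ha b hb => ?_) ht
    rw [tensorMap_tmul]
    rcases i with _ | i
    · obtain rfl : j = q + 1 := by omega
      rw [hr.map_pos q b hb, tmul_zero_right]; exact Submodule.zero_mem _
    · rw [hr.map_pos i a ha, tmul_zero_left]; exact Submodule.zero_mem _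
  · intro t
    obtain ⟨a, b, _, h⟩ := h3 t rfl
    exact ⟨a, by rw [h, LinearMap.zero_apply, add_zero]⟩

end TensorRes

/-! ### Homology of perturbed Hopf resolutions -/

theorem IsDGA.homologous_mul {R : Type u} [CommRing R] {A : Type*} [Ring A] [Algebra R A]
    {𝒜 : ℕ → Submodule R A} [GradedAlgebra 𝒜] {d : A →ₗ[R] A} (hA : IsDGA 𝒜 d) {y z y' z' : A}
    (hz : d z = 0) (hz' : d z' = 0) (h : ∃ w, d w = z - y) (h' : ∃ w, d w = z' - y') :
    ∃ w, d w = z * z' - y * y' := by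
  obtain ⟨w, hw⟩ := h
  obtain ⟨w', hw'⟩ := h'
  have hy : d (parity 𝒜 y) = 0 := by
    have : d y = 0 := by
      have e : y = z - d w := by rw [hw, sub_sub_cancel]
      rw [e, map_sub, hz, hA.diff_diff, sub_zero]
    rw [← neg_eq_zero, ← hA.parity_diff, this, map_zero]
  refine ⟨w * z' + parity 𝒜 y * w', ?_⟩
  rw [map_add, hA.diff_mul, hA.diff_mul, hz', hy, parity_parity, hw, hw']
  noncomm_ring

theorem exists_equiv_of_ker_eq {R : Type*} [CommRing R] {M N K : Type*} [AddCommGroup M]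
    [AddCommGroup N] [AddCommGroup K] [Module R M] [Module R N] [Module R K] {f : M →ₗ[R] N}
    {g : M →ₗ[R] K} (hf : Function.Surjective f) (hg : Function.Surjective g)
    (h : LinearMap.ker f = LinearMap.ker g) : ∃ e : N ≃ₗ[R] K, ∀ x, e (f x) = g x := by
  refine ⟨(f.quotKerEquivOfSurjective hf).symm ≪≫ₗ Submodule.quotEquivOfEq _ _ h ≪≫ₗ
    g.quotKerEquivOfSurjective hg, fun x => ?_⟩
  have : (f.quotKerEquivOfSurjective hf).symm (f x) = Submodule.Quotient.mk x := by
    rw [LinearEquiv.symm_apply_eq]; rfl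
  simp only [LinearEquiv.trans_apply, this]
  rfl

namespace HopfResolution

variable {R : Type u} [CommRing R] {H : Type w} [Ring H] [Algebra R H]
  {ℋ : ℕ → Submodule R H} [GradedAlgebra ℋ] {ΔH : H →ₗ[R] (ℋ ᵍ⊗[R] ℋ)}
  (S : HopfResolution.{u, v, w} ℋ ΔH)

theorem proj_res_mem (q n : ℕ) (x : S.carrier) (hx : x ∈ S.res q) :
    GradedAlgebra.proj S.gr n x ∈ S.res q := by
  have h := proj_map_of_degree_zero (𝒜 := S.gr) (ℬ := S.gr) (f := GradedAlgebra.proj S.res q)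
    (fun n x hx => S.bigraded n x hx q) n x
  rw [proj_of_mem S.res hx] at h
  rw [h]
  exact proj_mem _ _ _

/-- Any differential that lowers the resolution degree makes a Hopf resolution semifree. -/
theorem exists_semiFree : ∃ (X : Type v) (x : X → S.carrier) (lev deg : X → ℕ),
    (∀ i, x i ∈ S.res (lev i)) ∧ ∀ D : S.carrier →ₗ[R] S.carrier, IsDGA S.gr D →
      (∀ q, ∀ y ∈ S.res q, D y ∈ fil S.res q) → IsSemiFree S.gr D x lev deg := by
  obtain ⟨X, x, hx, hfree⟩ := S.free
  choose lev deg hx using hx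
  refine ⟨X, x, lev, deg, fun i => (hx i).1, fun D hD hDres =>
    ⟨hfree, hD, fun i => (hx i).2, fun i => ?_⟩⟩
  exact fil_le (V := Subalgebra.toSubmodule (Algebra.adjoin R (x '' {j | lev j < lev i})))
    (fun j hj y hy => IsFreeOn.mem_adjoin hfree (fun i => (hx i).1) hj hy) (hDres _ _ (hx i).1)

theorem isResolution :
    IsResolution S.res (GradedAlgebra.proj S.res) S.diff S.ρ.toLinearMap := by
  obtain ⟨h1, h2, h3⟩ := isWeakEquiv_iff.1 S.ρ_weak
  refine ⟨isGradingBy_proj _, S.diff_res, S.diff_res_zero, fun q z hz => S.ρ_res _ (by omega) z hz,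
    h1, fun z hz hz' => h2 z 0 hz hz', fun t => ?_⟩
  obtain ⟨a, b, _, h⟩ := h3 t rfl
  exact ⟨a, by rw [h, LinearMap.zero_apply, add_zero]⟩

theorem isResolution_tensor [Module.Flat R H] :
    IsResolution (tensorDeg S.gr S.gr S.res S.res) (tensorProj S.gr S.res)
      (tensorDiff S.gr S.gr S.diff S.diff)
      (tensorMap S.ρ.toLinearMap S.ρ.toLinearMap : (S.gr ᵍ⊗[R] S.gr) →ₗ[R] (ℋ ᵍ⊗[R] ℋ)) :=
  have := S.isHah.flat
  S.isResolution.tensor S.proj_res_mem S.isHah.dga S.ρ_map S.ρ_weak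

theorem exists_homogeneous {n : ℕ} {x : H} (hx : x ∈ ℋ n) :
    ∃ y ∈ S.res 0, y ∈ S.gr n ∧ S.ρ y = x := by
  obtain ⟨y, hy, h⟩ := S.isResolution.exists_zero x
  refine ⟨GradedAlgebra.proj S.gr n y, S.proj_res_mem 0 n y hy, proj_mem _ _ _, ?_⟩
  have := proj_map_of_degree_zero (ℬ := ℋ) (S.ρ_map.map_mem) n y
  rw [h, proj_of_mem ℋ hx] at this
  exact this.symm

/-- `d + h` is a differential, and `h` lowers the resolution degree by at least two. -/
structure IsDiffPerturbation (S : HopfResolution.{u, v, w} ℋ ΔH) (h : S.carrier →ₗ[R] S.carrier) :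
    Prop where
  h_fil : ∀ q, ∀ z ∈ S.res q, h z ∈ fil S.res (q - 1)
  dga : IsDGA S.gr (S.diff + h)

/-- `f` induces `i` in homology, where the homology of a perturbed resolution is identified with `H`
by `[y] ↦ ρ y` for `y` of resolution degree zero. -/
def Represents (S : HopfResolution.{u, v, w} ℋ ΔH) {A : Type*} [Ring A] [Algebra R A]
    {dA : A →ₗ[R] A} (f : S.carrier →ₗ[R] A) (i : H ≃ₗ[R] Homology dA) : Prop :=
  ∀ y ∈ S.res 0, ∃ z : LinearMap.ker dA, (z : A) = f y ∧ Homology.mk dA z = i (S.ρ y)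

variable {S}

namespace IsDiffPerturbation

variable {h : S.carrier →ₗ[R] S.carrier}

theorem diff_fil (m : S.IsDiffPerturbation h) (q : ℕ) (y : S.carrier) (hy : y ∈ S.res q) :
    (S.diff + h) y ∈ fil S.res q := by
  rw [LinearMap.add_apply]
  refine Submodule.add_mem _ ?_ (fil_mono (by omega) (m.h_fil q y hy))
  rcases q with _ | q
  · rw [S.diff_res_zero y hy]; exact Submodule.zero_mem _
  · exact le_fil (Nat.lt_succ_self _) (S.diff_res q y hy)

theorem diff_of_mem (m : S.IsDiffPerturbation h) {y : S.carrier} (hy : y ∈ S.res 0) :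
    (S.diff + h) y = 0 :=
  S.isResolution.diff_zero_of_perturbation m.h_fil hy

theorem isResFiltration (m : S.IsDiffPerturbation h) : IsResFiltration (S.diff + h) (fil S.res) :=
  S.isResolution.isResFiltration m.h_fil

theorem th_fil (m : S.IsDiffPerturbation h) : ∀ q, ∀ t ∈ tensorDeg S.gr S.gr S.res S.res q,
    tensorDiff S.gr S.gr h h t ∈ fil (tensorDeg S.gr S.gr S.res S.res) (q - 1) :=
  tensorDiff_fil_mem S.proj_res_mem m.h_fil

theorem isResFiltration_tensor (m : S.IsDiffPerturbation h) [Module.Flat R H] :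
    IsResFiltration (tensorDiff S.gr S.gr (S.diff + h) (S.diff + h))
      (fil (tensorDeg S.gr S.gr S.res S.res)) := by
  rw [tensorDiff_add]
  exact S.isResolution_tensor.isResFiltration m.th_fil

theorem tdiff_tdiff (m : S.IsDiffPerturbation h) (w : S.gr ᵍ⊗[R] S.gr) :
    tensorDiff S.gr S.gr (S.diff + h) (S.diff + h)
      (tensorDiff S.gr S.gr (S.diff + h) (S.diff + h) w) = 0 :=
  (m.dga.tensor m.dga).diff_diff w

theorem exists_homologous (m : S.IsDiffPerturbation h) {z : S.carrier} (hz : (S.diff + h) z = 0) :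
    ∃ y ∈ S.res 0, ∃ w, (S.diff + h) w = z - y :=
  S.isResolution.exists_homologous m.h_fil m.dga.diff_diff hz

theorem exists_diff_eq (m : S.IsDiffPerturbation h) {y : S.carrier} (hy : y ∈ S.res 0)
    (h' : S.ρ y = 0) : ∃ w, (S.diff + h) w = y :=
  S.isResolution.exists_diff_eq m.h_fil hy h'

theorem exists_diff_eq_sub (m : S.IsDiffPerturbation h) {y y' : S.carrier} (hy : y ∈ S.res 0)
    (hy' : y' ∈ S.res 0) (h' : S.ρ y = S.ρ y') : ∃ w, (S.diff + h) w = y - y' :=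
  m.exists_diff_eq (Submodule.sub_mem _ hy hy') (by rw [map_sub, h', sub_self])

theorem ρ_eq (m : S.IsDiffPerturbation h) {y y' w : S.carrier} (hy : y ∈ S.res 0)
    (hy' : y' ∈ S.res 0) (hw : (S.diff + h) w = y - y') : S.ρ y = S.ρ y' :=
  S.isResolution.map_eq_of_homologous m.h_fil m.dga.diff_diff hy hy' hw

theorem ρρ_eq (m : S.IsDiffPerturbation h) [Module.Flat R H] {y y' w : S.gr ᵍ⊗[R] S.gr}
    (hy : y ∈ tensorDeg S.gr S.gr S.res S.res 0) (hy' : y' ∈ tensorDeg S.gr S.gr S.res S.res 0)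
    (hw : tensorDiff S.gr S.gr (S.diff + h) (S.diff + h) w = y - y') :
    (tensorMap S.ρ.toLinearMap S.ρ.toLinearMap y : ℋ ᵍ⊗[R] ℋ) =
      tensorMap S.ρ.toLinearMap S.ρ.toLinearMap y' := by
  refine S.isResolution_tensor.map_eq_of_homologous m.th_fil (fun w => ?_) hy hy' (w := w) ?_
  · rw [← tensorDiff_add]; exact m.tdiff_tdiff w
  · rw [← tensorDiff_add]; exact hw

theorem exists_represents_id (m : S.IsDiffPerturbation h) : ∃ i : H ≃ₗ[R] Homology (S.diff + h),
    S.Represents (LinearMap.id : S.carrier →ₗ[R] S.carrier) i := by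
  let c : S.res 0 →ₗ[R] LinearMap.ker (S.diff + h) :=
    LinearMap.codRestrict _ (S.res 0).subtype fun y => m.diff_of_mem y.2
  obtain ⟨i, hi⟩ := exists_equiv_of_ker_eq (f := S.ρ.toLinearMap ∘ₗ (S.res 0).subtype)
    (g := Homology.mk (S.diff + h) ∘ₗ c)
    (fun x => by
      obtain ⟨y, hy, h⟩ := S.isResolution.exists_zero x
      exact ⟨⟨y, hy⟩, h⟩)
    (fun x => by
      obtain ⟨z, rfl⟩ := Homology.mk_surjective _ x
      obtain ⟨y, hy, w, hw⟩ := m.exists_homologous z.2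
      refine ⟨⟨y, hy⟩, (Homology.mk_eq_mk.2 ⟨w, hw⟩).symm⟩)
    (by
      ext y
      rw [LinearMap.mem_ker, LinearMap.mem_ker]
      change S.ρ y = 0 ↔ Homology.mk (S.diff + h) (c y) = 0
      rw [Homology.mk_eq_zero]
      constructor
      · exact fun h => m.exists_diff_eq y.2 h
      · rintro ⟨w, hw⟩
        have hw' : (S.diff + h) w = y - 0 := by rw [sub_zero]; exact hw
        rw [m.ρ_eq y.2 (Submodule.zero_mem _) hw', map_zero])
  exact ⟨i, fun y hy => ⟨c ⟨y, hy⟩, rfl, (hi ⟨y, hy⟩).symm⟩⟩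

/-- A map that induces an isomorphism `H ≃ H(A)` is a weak equivalence. -/
theorem isWeakEquiv_of_represents (m : S.IsDiffPerturbation h) {A : Type*} [Ring A] [Algebra R A]
    {dA : A →ₗ[R] A}
    {f : S.carrier →ₗ[R] A} (hf : ∀ x, f ((S.diff + h) x) = dA (f x)) {i : H ≃ₗ[R] Homology dA}
    (hi : S.Represents f i) : IsWeakEquiv (S.diff + h) dA f := by
  refine isWeakEquiv_iff.2 ⟨hf, fun a b ha hab => ?_, fun b hb => ?_⟩
  · obtain ⟨y, hy, w, hw⟩ := m.exists_homologous ha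
    obtain ⟨z, hz, hz'⟩ := hi y hy
    have h0 : Homology.mk dA z = 0 := Homology.mk_eq_zero.2 ⟨b - f w, by
      rw [map_sub, ← hab, ← hf, hw, map_sub, sub_sub_cancel, hz]⟩
    rw [h0, eq_comm, map_eq_zero_iff _ i.injective] at hz'
    obtain ⟨w', hw'⟩ := m.exists_diff_eq hy hz'
    exact ⟨w + w', by rw [map_add, hw, hw', sub_add_cancel]⟩
  · obtain ⟨x, hx⟩ := i.surjective (Homology.mk dA ⟨b, hb⟩)
    obtain ⟨y, hy, rfl⟩ := S.isResolution.exists_zero x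
    obtain ⟨z, hz, hz'⟩ := hi y hy
    obtain ⟨w, hw⟩ := Homology.mk_eq_mk.1 (hx.symm.trans hz'.symm)
    refine ⟨y, w, m.diff_of_mem hy, ?_⟩
    rw [hw, hz, add_sub_cancel]

/-- A weak equivalence induces an isomorphism `H ≃ H(A)`. -/
theorem exists_represents (m : S.IsDiffPerturbation h) {A : Type*} [Ring A] [Algebra R A]
    {dA : A →ₗ[R] A}
    {f : S.carrier →ₗ[R] A} (hf : IsWeakEquiv (S.diff + h) dA f) :
    ∃ i : H ≃ₗ[R] Homology dA, S.Represents f i := by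
  obtain ⟨i, hi⟩ := m.exists_represents_id
  obtain ⟨hc, hb⟩ := hf
  refine ⟨i ≪≫ₗ LinearEquiv.ofBijective _ hb, fun y hy => ?_⟩
  obtain ⟨z, hz, hz'⟩ := hi y hy
  refine ⟨⟨f y, ?_⟩, rfl, ?_⟩
  · rw [LinearMap.mem_ker, ← LinearMap.comp_apply, ← hc, LinearMap.comp_apply, m.diff_of_mem hy,
      map_zero]
  · rw [LinearEquiv.trans_apply, ← hz', LinearEquiv.ofBijective_apply]
    refine congrArg (Homology.mk dA) (Subtype.ext ?_)
    exact (congrArg f hz).symm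

end IsDiffPerturbation

namespace Perturbation

variable (m : S.Perturbation)

/-- The perturbed differential. -/
abbrev diff : S.carrier →ₗ[R] S.carrier := S.diff + m.h

/-- The perturbed coproduct. -/
abbrev comul : S.carrier →ₗ[R] (S.gr ᵍ⊗[R] S.gr) := S.comul + m.ν

theorem h_fil (q : ℕ) (z : S.carrier) (hz : z ∈ S.res q) : m.h z ∈ fil S.res (q - 1) :=
  iSup_add_two_le (Q := S.res) q ▸ m.h_res q z hz

theorem ν_fil (q : ℕ) (z : S.carrier) (hz : z ∈ S.res q) :
    m.ν z ∈ fil (tensorDeg S.gr S.gr S.res S.res) q := m.ν_res q z hz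

theorem isDiff : S.IsDiffPerturbation m.h := ⟨m.h_fil, m.isHah.dga⟩

theorem comul_of_mem {y : S.carrier} (hy : y ∈ S.res 0) : m.comul y = S.comul y := by
  have := m.ν_fil 0 y hy
  rw [fil_zero, Submodule.mem_bot] at this
  rw [LinearMap.add_apply, this, add_zero]

/-- The differential of the tensor square. -/
abbrev tdiff : (S.gr ᵍ⊗[R] S.gr) →ₗ[R] (S.gr ᵍ⊗[R] S.gr) := tensorDiff S.gr S.gr m.diff m.diff

theorem exists_tensor_of_represents {A : Type*} [Ring A] [Algebra R A] {𝒜 : ℕ → Submodule R A}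
    [GradedAlgebra 𝒜] {dA : A →ₗ[R] A} {f : S.carrier →ₗ[R] A} {i : H ≃ₗ[R] Homology dA}
    (hi : S.Represents f i) {T : S.gr ᵍ⊗[R] S.gr} (hT : T ∈ tensorDeg S.gr S.gr S.res S.res 0) :
    ∃ t : LinearMap.ker dA ⊗[R] LinearMap.ker dA,
      GradedTensorProduct.of R 𝒜 𝒜
        (TensorProduct.map (LinearMap.ker dA).subtype (LinearMap.ker dA).subtype t) =
        tensorMap f f T ∧
      TensorProduct.map (Homology.mk dA) (Homology.mk dA) t =
        TensorProduct.map i.toLinearMap i.toLinearMap ((GradedTensorProduct.of R ℋ ℋ).symm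
          (tensorMap S.ρ.toLinearMap S.ρ.toLinearMap T)) := by
  induction hT using Submodule.span_induction with
  | zero => exact ⟨0, by simp, by simp⟩
  | add x y _ _ hx hy =>
    obtain ⟨t, h1, h2⟩ := hx
    obtain ⟨t', h1', h2'⟩ := hy
    exact ⟨t + t', by rw [map_add, map_add, map_add, h1, h1'],
      by rw [map_add, map_add, map_add, map_add, h2, h2']⟩
  | smul r x _ hx =>
    obtain ⟨t, h1, h2⟩ := hx
    exact ⟨r • t, by rw [map_smul, map_smul, map_smul, h1],
      by rw [map_smul, map_smul, map_smul, map_smul, h2]⟩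
  | mem x hx =>
    obtain ⟨j, k, hjk, a, ha, b, hb, rfl⟩ := hx
    obtain rfl : j = 0 := by omega
    obtain rfl : k = 0 := by omega
    obtain ⟨z, hz, hz'⟩ := hi a ha
    obtain ⟨z', hz1, hz1'⟩ := hi b hb
    refine ⟨z ⊗ₜ z', ?_, ?_⟩
    · rw [TensorProduct.map_tmul, tensorMap_tmul, ← hz, ← hz1]; rfl
    · rw [TensorProduct.map_tmul, hz', hz1', tensorMap_tmul]; rfl

theorem comul_mem_zero {y : S.carrier} (hy : y ∈ S.res 0) :
    m.comul y ∈ tensorDeg S.gr S.gr S.res S.res 0 := by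
  rw [m.comul_of_mem hy]; exact S.comul_res 0 y hy

theorem ρρ_comul {y : S.carrier} (hy : y ∈ S.res 0) :
    tensorMap S.ρ.toLinearMap S.ρ.toLinearMap (m.comul y) = ΔH (S.ρ y) := by
  rw [m.comul_of_mem hy]; exact LinearMap.congr_fun S.ρ_comul y

/-- The homology of a perturbed resolution is `H`. -/
theorem isHopfIso {i : H ≃ₗ[R] Homology m.diff}
    (hi : S.Represents (LinearMap.id : S.carrier →ₗ[R] S.carrier) i) :
    IsHopfIso S.gr ℋ ΔH m.diff m.comul i where
  map_mem n x hx := by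
    obtain ⟨y, hy, hyn, rfl⟩ := S.exists_homogeneous hx
    obtain ⟨z, hz, hz'⟩ := hi y hy
    exact ⟨z, by rw [hz]; exact hyn, hz'⟩
  map_one z hz := by
    obtain ⟨z', h, h'⟩ := hi 1 (SetLike.one_mem_graded S.res)
    rw [map_one] at h'
    rw [← h', Subtype.ext (hz.trans h.symm)]
  map_mul x x' z z' z'' hz hz' hz'' := by
    obtain ⟨y, hy, rfl⟩ := S.isResolution.exists_zero x
    obtain ⟨y', hy', rfl⟩ := S.isResolution.exists_zero x'
    obtain ⟨c, hc, hc1⟩ := hi y hy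
    obtain ⟨c', hc', hc1'⟩ := hi y' hy'
    obtain ⟨c'', hc'', hc1''⟩ := hi (y * y')
      (by simpa using SetLike.GradedMul.mul_mem (A := S.res) hy hy')
    rw [map_mul] at hc1''
    refine Eq.trans (Homology.mk_eq_mk.2 ?_) hc1''
    rw [hz'', hc'']
    have h := Homology.mk_eq_mk.1 (hz.trans hc1.symm)
    have h' := Homology.mk_eq_mk.1 (hz'.trans hc1'.symm)
    rw [hc] at h
    rw [hc'] at h'
    exact m.isHah.dga.homologous_mul z.2 z'.2 h h'
  map_comul x := by
    obtain ⟨y, hy, rfl⟩ := S.isResolution.exists_zero x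
    obtain ⟨z, hz, hz'⟩ := hi y hy
    obtain ⟨t, ht, ht'⟩ := exists_tensor_of_represents (𝒜 := S.gr) hi (m.comul_mem_zero hy)
    refine ⟨z, t, hz', ?_, ?_⟩
    · rw [ht', m.ρρ_comul hy]; rfl
    · rw [ht, tensorMap_id, hz]
      simp only [LinearMap.id_apply]
      rw [sub_self]
      exact Submodule.zero_mem _

theorem hasHomology : m.toHah.HasHomology ℋ ΔH := by
  obtain ⟨i, hi⟩ := m.isDiff.exists_represents_id
  exact ⟨i, m.isHopfIso hi⟩

end Perturbation

theorem Induces.exists_represents {m' : S.Perturbation} {α : H ≃ₐ[R] H}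
    {k : S.carrier →ₗ[R] S.carrier} (h : Induces m' α k) {i : H ≃ₗ[R] Homology m'.diff}
    (hi : S.Represents (LinearMap.id : S.carrier →ₗ[R] S.carrier) i) :
    S.Represents k (α.toLinearEquiv ≪≫ₗ i) := by
  intro x hx
  obtain ⟨y, hy, h1, w, hw⟩ := h x hx
  obtain ⟨z, hz, hz'⟩ := hi y hy
  have hk : m'.diff (k x) = 0 := by
    have e : k x = y + m'.diff w := by rw [hw, add_sub_cancel]
    rw [e, map_add, m'.isDiff.diff_of_mem hy, m'.isHah.dga.diff_diff, add_zero]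
  refine ⟨⟨k x, hk⟩, rfl, ?_⟩
  rw [LinearEquiv.trans_apply]
  change _ = i (α (S.ρ x))
  rw [← h1, ← hz']
  exact Homology.mk_eq_mk.2 ⟨w, by rw [hw, hz]; rfl⟩

theorem Induces.of_represents {m' : S.Perturbation} {α : H ≃ₐ[R] H}
    {k : S.carrier →ₗ[R] S.carrier} {i : H ≃ₗ[R] Homology m'.diff}
    (hi : S.Represents (LinearMap.id : S.carrier →ₗ[R] S.carrier) i)
    (h : S.Represents k (α.toLinearEquiv ≪≫ₗ i)) : Induces m' α k := by
  intro x hx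
  obtain ⟨z, hz, hz'⟩ := h x hx
  obtain ⟨y, hy, h1⟩ := S.isResolution.exists_zero (α (S.ρ x))
  obtain ⟨c, hc, hc'⟩ := hi y hy
  obtain ⟨w, hw⟩ := Homology.mk_eq_mk.1 (hz'.trans (hc'.trans (congrArg i h1)).symm)
  exact ⟨y, hy, h1, w, by rw [hz, hc] at hw; exact hw⟩

end HopfResolution

/-! ### Künneth classes and induced automorphisms -/

section Kunneth

variable {R : Type u} [CommRing R]

theorem ker_map_mkQ {M : Type*} [AddCommGroup M] [Module R M] (B : Submodule R M) :
    LinearMap.ker (TensorProduct.map B.mkQ B.mkQ) =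
      LinearMap.range (LinearMap.lTensor M B.subtype) ⊔
        LinearMap.range (LinearMap.rTensor M B.subtype) :=
  TensorProduct.map_ker (LinearMap.exact_subtype_mkQ B) B.mkQ_surjective
    (LinearMap.exact_subtype_mkQ B) B.mkQ_surjective

/-- A sum of products of cycles whose Künneth class vanishes is a boundary. -/
theorem exists_tensorDiff_eq {A : Type*} [Ring A] [Algebra R A] {𝒜 : ℕ → Submodule R A}
    [GradedAlgebra 𝒜] {d : A →ₗ[R] A} (hA : IsDGA 𝒜 d) (t : LinearMap.ker d ⊗[R] LinearMap.ker d)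
    (ht : TensorProduct.map (Homology.mk d) (Homology.mk d) t = 0) :
    ∃ w, tensorDiff 𝒜 𝒜 d d w = GradedTensorProduct.of R 𝒜 𝒜
      (TensorProduct.map (LinearMap.ker d).subtype (LinearMap.ker d).subtype t) := by
  rw [← LinearMap.mem_ker] at ht
  have ht := ker_map_mkQ ((LinearMap.range d).submoduleOf (LinearMap.ker d)) ▸ ht
  let c : LinearMap.ker d ⊗[R] LinearMap.ker d →ₗ[R] (𝒜 ᵍ⊗[R] 𝒜) :=
    (GradedTensorProduct.of R 𝒜 𝒜).toLinearMap ∘ₗ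
      TensorProduct.map (LinearMap.ker d).subtype (LinearMap.ker d).subtype
  suffices h : LinearMap.range (LinearMap.lTensor (LinearMap.ker d)
      ((LinearMap.range d).submoduleOf (LinearMap.ker d)).subtype) ⊔
      LinearMap.range (LinearMap.rTensor (LinearMap.ker d)
      ((LinearMap.range d).submoduleOf (LinearMap.ker d)).subtype) ≤
      (LinearMap.range (tensorDiff 𝒜 𝒜 d d)).comap c from h ht
  refine sup_le ?_ ?_
  · rintro _ ⟨t, rfl⟩
    induction t using TensorProduct.induction_on with
    | zero => rw [map_zero]; exact Submodule.zero_mem _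
    | add x y hx hy => rw [map_add]; exact Submodule.add_mem _ hx hy
    | tmul z b =>
      obtain ⟨⟨b, hb⟩, w, hw⟩ := b
      change d w = b at hw
      have hz : d (parity 𝒜 z.1) = 0 := by
        rw [← neg_eq_zero, ← hA.parity_diff, z.2, map_zero]
      refine ⟨parity 𝒜 z.1 ᵍ⊗ₜ[R] w, ?_⟩
      rw [tensorDiff_tmul, hz, tmul_zero_left, parity_parity, zero_add, hw]
      rfl
  · rintro _ ⟨t, rfl⟩
    induction t using TensorProduct.induction_on with
    | zero => rw [map_zero]; exact Submodule.zero_mem _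
    | add x y hx hy => rw [map_add]; exact Submodule.add_mem _ hx hy
    | tmul b z =>
      obtain ⟨⟨b, hb⟩, w, hw⟩ := b
      change d w = b at hw
      have hz : d z.1 = 0 := z.2
      refine ⟨w ᵍ⊗ₜ[R] z.1, ?_⟩
      rw [tensorDiff_tmul, hz, tmul_zero_right, add_zero, hw]
      rfl

variable {H : Type w} [Ring H] [Algebra R H] {ℋ : ℕ → Submodule R H} [GradedAlgebra ℋ]
  {ΔH : H →ₗ[R] (ℋ ᵍ⊗[R] ℋ)}

theorem mem_hopfAut_of_map_mem {α : H ≃ₐ[R] H} (h : ∀ n, ∀ x ∈ ℋ n, α x ∈ ℋ n)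
    (hΔ : ∀ x, ΔH (α x) = tensorMap α.toLinearMap α.toLinearMap (ΔH x)) : α ∈ hopfAut ℋ ΔH := by
  refine ⟨fun n x => ⟨fun hx => ?_, h n x⟩, hΔ⟩
  have e := proj_map_of_degree_zero (𝒜 := ℋ) (ℬ := ℋ) (f := α.toLinearMap) h n x
  rw [AlgEquiv.toLinearMap_apply, proj_of_mem ℋ hx] at e
  rw [α.injective e]
  exact proj_mem _ _ _

theorem IsHopfIso.precomp_aut {A : Type*} [Ring A] [Algebra R A] {𝒜 : ℕ → Submodule R A}
    [GradedAlgebra 𝒜] {d : A →ₗ[R] A} {ψ : A →ₗ[R] (𝒜 ᵍ⊗[R] 𝒜)} {i : H ≃ₗ[R] Homology d}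
    (hi : IsHopfIso 𝒜 ℋ ΔH d ψ i) {α : H ≃ₐ[R] H} (hα : α ∈ hopfAut ℋ ΔH) :
    IsHopfIso 𝒜 ℋ ΔH d ψ (α.toLinearEquiv ≪≫ₗ i) where
  map_mem n x hx := hi.map_mem n (α x) ((hα.1 n x).2 hx)
  map_one z hz := by
    rw [hi.map_one z hz, LinearEquiv.trans_apply]
    exact congrArg i (_root_.map_one α).symm
  map_mul x y z z' z'' hz hz' hz'' := by
    rw [hi.map_mul (α x) (α y) z z' z'' hz hz' hz'', LinearEquiv.trans_apply]
    exact congrArg i (_root_.map_mul α x y).symm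
  map_comul x := by
    obtain ⟨z, t, h1, h2, h3⟩ := hi.map_comul (α x)
    refine ⟨z, t, h1, ?_, h3⟩
    rw [h2, hα.2]
    have : TensorProduct.map (α.toLinearEquiv ≪≫ₗ i).toLinearMap
        (α.toLinearEquiv ≪≫ₗ i).toLinearMap =
        TensorProduct.map i.toLinearMap i.toLinearMap ∘ₗ
          TensorProduct.map α.toLinearMap α.toLinearMap := by
      rw [← TensorProduct.map_comp]; rfl
    rw [this]
    rfl

end Kunneth

namespace HopfResolution

variable {R : Type u} [CommRing R] {H : Type w} [Ring H] [Algebra R H]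
  {ℋ : ℕ → Submodule R H} [GradedAlgebra ℋ] {ΔH : H →ₗ[R] (ℋ ᵍ⊗[R] ℋ)}
  {S : HopfResolution.{u, v, w} ℋ ΔH}

/-- On the part of resolution degree zero, a map that induces an isomorphism of Hopf algebras in
homology commutes with the coproducts up to boundaries. -/
theorem Represents.exists_tensorDiff_eq {A : Type*} [Ring A] [Algebra R A]
    {𝒜 : ℕ → Submodule R A} [GradedAlgebra 𝒜] {dA : A →ₗ[R] A} (hA : IsDGA 𝒜 dA)
    {ψ : A →ₗ[R] (𝒜 ᵍ⊗[R] 𝒜)} (hψ : IsDGAMap 𝒜 dA (tensorGr 𝒜 𝒜) (tensorDiff 𝒜 𝒜 dA dA) ψ)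
    {i : H ≃ₗ[R] Homology dA} (hi : IsHopfIso 𝒜 ℋ ΔH dA ψ i) {f : S.carrier →ₗ[R] A}
    (hf : S.Represents f i) {y : S.carrier} (hy : y ∈ S.res 0) :
    ∃ w, tensorDiff 𝒜 𝒜 dA dA w = ψ (f y) - tensorMap f f (S.comul y) := by
  obtain ⟨z, t, h1, h2, w, hw⟩ := hi.map_comul (S.ρ y)
  obtain ⟨c, hc, hc'⟩ := hf y hy
  obtain ⟨t', ht', h2'⟩ := Perturbation.exists_tensor_of_represents (𝒜 := 𝒜) hf (S.comul_res 0 y hy)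
  obtain ⟨w', hw'⟩ := Homology.mk_eq_mk.1 (hc'.trans h1.symm)
  obtain ⟨w'', hw''⟩ := HopfPert.exists_tensorDiff_eq hA (t - t') (by
    have e : tensorMap S.ρ.toLinearMap S.ρ.toLinearMap (S.comul y) = ΔH (S.ρ y) :=
      LinearMap.congr_fun S.ρ_comul y
    rw [map_sub, h2, h2', e, sub_self])
  refine ⟨ψ w' + w + w'', ?_⟩
  rw [map_add, map_add, ← hψ.comm_apply, hw', hw, hw'', ← ht', map_sub, map_sub, map_sub, hc]
  abel

variable {m m' : S.Perturbation}

theorem exists_tensor_homologous {k : S.carrier →ₗ[R] S.carrier}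
    (hk : IsDGAMap S.gr m.diff S.gr m'.diff k) {α : H →ₗ[R] H}
    (hα : ∀ y ∈ S.res 0, ∃ y' ∈ S.res 0, S.ρ y' = α (S.ρ y) ∧ ∃ w, m'.diff w = k y - y')
    {T : S.gr ᵍ⊗[R] S.gr} (hT : T ∈ tensorDeg S.gr S.gr S.res S.res 0) :
    ∃ T' ∈ tensorDeg S.gr S.gr S.res S.res 0, (∃ w, m'.tdiff w = tensorMap k k T - T') ∧
      (tensorMap S.ρ.toLinearMap S.ρ.toLinearMap T' : ℋ ᵍ⊗[R] ℋ) =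
        tensorMap α α (tensorMap S.ρ.toLinearMap S.ρ.toLinearMap T : ℋ ᵍ⊗[R] ℋ) := by
  induction hT using Submodule.span_induction with
  | zero => exact ⟨0, Submodule.zero_mem _, ⟨0, by simp⟩, by simp⟩
  | add x y _ _ hx hy =>
    obtain ⟨t, h0, ⟨w, hw⟩, h2⟩ := hx
    obtain ⟨t', h0', ⟨w', hw'⟩, h2'⟩ := hy
    refine ⟨t + t', Submodule.add_mem _ h0 h0', ⟨w + w', ?_⟩, ?_⟩
    · rw [map_add, map_add, hw, hw']; abel
    · simp only [map_add, h2, h2']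
  | smul r x _ hx =>
    obtain ⟨t, h0, ⟨w, hw⟩, h2⟩ := hx
    refine ⟨r • t, Submodule.smul_mem _ r h0, ⟨r • w, ?_⟩, ?_⟩
    · rw [map_smul, map_smul, hw, smul_sub]
    · simp only [map_smul, h2]
  | mem x hx =>
    obtain ⟨p, q, hpq, a, ha, b, hb, rfl⟩ := hx
    obtain rfl : p = 0 := by omega
    obtain rfl : q = 0 := by omega
    obtain ⟨a', ha', h1, w, hw⟩ := hα a ha
    obtain ⟨b', hb', h2, w', hw'⟩ := hα b hb
    refine ⟨a' ᵍ⊗ₜ[R] b', tmul_mem (i := 0) (j := 0) _ _ ha' hb',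
      ⟨w ᵍ⊗ₜ[R] k b + parity S.gr a' ᵍ⊗ₜ[R] w', ?_⟩, ?_⟩
    · have hkb : m'.diff (k b) = 0 := by rw [← hk.comm_apply, m.isDiff.diff_of_mem hb, map_zero]
      have ha0 : m'.diff (parity S.gr a') = 0 :=
        m'.isDiff.diff_of_mem (parity_res_mem S.proj_res_mem ha')
      rw [map_add, tensorDiff_tmul, tensorDiff_tmul, hkb, ha0, tmul_zero_left, tmul_zero_right,
        parity_parity, hw, hw', tensorMap_tmul, tmul_sub_left, tmul_sub_right]
      abel
    · change S.ρ a' ᵍ⊗ₜ[R] S.ρ b' = α (S.ρ a) ᵍ⊗ₜ[R] α (S.ρ b)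
      rw [h1, h2]

/-- A weak equivalence between perturbed resolutions induces an automorphism of `H`. -/
theorem exists_induces [Module.Flat R H] {k : S.carrier →ₗ[R] S.carrier}
    (hk : IsHahMap S.gr S.gr m.diff m.comul m'.diff m'.comul k)
    (hw : IsWeakEquiv m.diff m'.diff k) :
    ∃ α ∈ hopfAut ℋ ΔH, Induces m' α k := by
  obtain ⟨i, hi⟩ := m.isDiff.exists_represents hw
  obtain ⟨i', hi'⟩ := m'.isDiff.exists_represents_id
  -- the induced map in terms of representatives of resolution degree zero
  let a : H ≃ₗ[R] H := i ≪≫ₗ i'.symm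
  have ha : ∀ y ∈ S.res 0, ∀ y' ∈ S.res 0, (∃ w, m'.diff w = k y - y') → a (S.ρ y) = S.ρ y' := by
    rintro y hy y' hy' ⟨w, hw⟩
    obtain ⟨z, hz, h1⟩ := hi y hy
    obtain ⟨z', hz', h1'⟩ := hi' y' hy'
    rw [LinearEquiv.trans_apply, LinearEquiv.symm_apply_eq, ← h1, ← h1', Homology.mk_eq_mk]
    exact ⟨w, by rw [hw, hz, hz']; rfl⟩
  have hex : ∀ y ∈ S.res 0, ∃ y' ∈ S.res 0, S.ρ y' = a (S.ρ y) ∧ ∃ w, m'.diff w = k y - y' := by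
    intro y hy
    obtain ⟨y', hy', w, hw⟩ := m'.isDiff.exists_homologous (z := k y)
      (by rw [← hk.isDGAMap.comm_apply, m.isDiff.diff_of_mem hy, map_zero])
    exact ⟨y', hy', (ha y hy y' hy' ⟨w, hw⟩).symm, w, hw⟩
  have hcyc : ∀ y ∈ S.res 0, m'.diff (k y) = 0 := fun y hy => by
    rw [← hk.isDGAMap.comm_apply, m.isDiff.diff_of_mem hy, map_zero]
  let α : H ≃ₐ[R] H := AlgEquiv.ofLinearEquiv a
    (by
      have := ha 1 (SetLike.one_mem_graded S.res) 1 (SetLike.one_mem_graded S.res)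
        ⟨0, by rw [hk.isDGAMap.map_one, sub_self, map_zero]⟩
      rwa [map_one] at this)
    (by
      intro x x'
      obtain ⟨y, hy, rfl⟩ := S.isResolution.exists_zero x
      obtain ⟨y', hy', rfl⟩ := S.isResolution.exists_zero x'
      obtain ⟨c, hc, h1, h2⟩ := hex y hy
      obtain ⟨c', hc', h1', h2'⟩ := hex y' hy'
      have := ha (y * y') (by simpa using SetLike.GradedMul.mul_mem (A := S.res) hy hy') (c * c')
        (by simpa using SetLike.GradedMul.mul_mem (A := S.res) hc hc') (by
          rw [hk.isDGAMap.map_mul]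
          exact m'.isHah.dga.homologous_mul (hcyc y hy) (hcyc y' hy') h2 h2')
      rw [map_mul S.ρ, map_mul S.ρ, h1, h1'] at this
      exact this)
  refine ⟨α, mem_hopfAut_of_map_mem (fun n x hx => ?_) (fun x => ?_), fun y hy => ?_⟩
  · obtain ⟨y, hy, hyn, rfl⟩ := S.exists_homogeneous hx
    obtain ⟨y', hy', _, w, hw⟩ := hex y hy
    have h := ha y hy (GradedAlgebra.proj S.gr n y') (S.proj_res_mem 0 n y' hy')
      ⟨GradedAlgebra.proj S.gr (n + 1) w, by
        rw [← proj_map_of_degree_neg_one m'.isHah.dga.map_zero_degree m'.isHah.dga.map_mem, hw,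
          map_sub, proj_of_mem S.gr (hk.isDGAMap.map_mem n y hyn)]⟩
    change a (S.ρ y) ∈ ℋ n
    rw [h]
    exact S.ρ_map.map_mem n _ (proj_mem _ _ _)
  · obtain ⟨y, hy, rfl⟩ := S.isResolution.exists_zero x
    obtain ⟨y', hy', h1, w, hw⟩ := hex y hy
    obtain ⟨T, hT, ⟨w', hw'⟩, hT'⟩ := exists_tensor_homologous hk.isDGAMap (α := a.toLinearMap)
      hex (m.comul_mem_zero hy)
    obtain ⟨w'', hw''⟩ := hk.comul.homologous y (m.isDiff.diff_of_mem hy)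
    rw [m.ρρ_comul hy] at hT'
    refine Eq.trans ?_ hT'
    have e : α (S.ρ.toLinearMap y) = S.ρ y' := h1.symm
    rw [e, ← m'.ρρ_comul hy']
    refine m'.isDiff.ρρ_eq (w := w' + w'' - m'.comul w) (m'.comul_mem_zero hy') hT ?_
    rw [map_sub, map_add, ← m'.isHah.comul.comm_apply]
    change _ + m'.tdiff w'' - m'.comul (m'.diff w) = _
    rw [hw, hw', hw'', map_sub]
    simp only [LinearMap.comp_apply]
    abel
  · obtain ⟨y', hy', h1, w, hw⟩ := hex y hy
    exact ⟨y', hy', h1, w, hw⟩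

end HopfResolution

/-! ### Counits -/

section Counit

variable {R : Type u} [CommRing R] {A : Type*} [Ring A] [Algebra R A] {𝒜 : ℕ → Submodule R A}
  [GradedAlgebra 𝒜] {B : Type*} [Ring B] [Algebra R B] {ℬ : ℕ → Submodule R B} [GradedAlgebra ℬ]

/-- The map `ε ⊗ 1 : A ⊗ B → B`. -/
def counitLeft (𝒜 : ℕ → Submodule R A) [GradedAlgebra 𝒜] (ℬ : ℕ → Submodule R B) [GradedAlgebra ℬ]
    (ε : A →ₐ[R] R) : (𝒜 ᵍ⊗[R] ℬ) →ₗ[R] B :=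
  (TensorProduct.lid R B).toLinearMap ∘ₗ TensorProduct.map ε.toLinearMap LinearMap.id ∘ₗ
    (GradedTensorProduct.of R 𝒜 ℬ).symm.toLinearMap

/-- The map `1 ⊗ ε : A ⊗ B → A`. -/
def counitRight (𝒜 : ℕ → Submodule R A) [GradedAlgebra 𝒜] (ℬ : ℕ → Submodule R B) [GradedAlgebra ℬ]
    (ε : B →ₐ[R] R) : (𝒜 ᵍ⊗[R] ℬ) →ₗ[R] A :=
  (TensorProduct.rid R A).toLinearMap ∘ₗ TensorProduct.map LinearMap.id ε.toLinearMap ∘ₗ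
    (GradedTensorProduct.of R 𝒜 ℬ).symm.toLinearMap

theorem counitLeft_tmul (ε : A →ₐ[R] R) (a : A) (b : B) :
    counitLeft 𝒜 ℬ ε (a ᵍ⊗ₜ[R] b) = ε a • b := rfl

theorem counitRight_tmul (ε : B →ₐ[R] R) (a : A) (b : B) :
    counitRight 𝒜 ℬ ε (a ᵍ⊗ₜ[R] b) = ε b • a := rfl

theorem counit_parity {ε : A →ₐ[R] R} (hε : ∀ n, n ≠ 0 → ∀ x ∈ 𝒜 n, ε x = 0) (x : A) :
    ε (parity 𝒜 x) = ε x := by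
  induction x using homogeneous_induction 𝒜 with
  | h0 => rw [map_zero]
  | add x y hx hy => rw [map_add, map_add, map_add, hx, hy]
  | hom n x hx =>
    rw [parity_of_mem 𝒜 hx, map_smul]
    rcases n with _ | n
    · rw [pow_zero, one_smul]
    · rw [hε (n + 1) (by omega) x hx, smul_zero]

theorem counitLeft_tensorDiff {dA : A →ₗ[R] A} {dB : B →ₗ[R] B} {ε : A →ₐ[R] R}
    (hε : ∀ n, n ≠ 0 → ∀ x ∈ 𝒜 n, ε x = 0) (hd : ∀ x, ε (dA x) = 0) (t : 𝒜 ᵍ⊗[R] ℬ) :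
    counitLeft 𝒜 ℬ ε (tensorDiff 𝒜 ℬ dA dB t) = dB (counitLeft 𝒜 ℬ ε t) := by
  induction t using tensor_induction with
  | h0 => simp
  | add x y hx hy => simp only [map_add, hx, hy]
  | tmul a b =>
    rw [tensorDiff_tmul, map_add, counitLeft_tmul, counitLeft_tmul, counitLeft_tmul, hd,
      counit_parity hε, zero_smul, zero_add, map_smul]

theorem counitRight_tensorDiff {dA : A →ₗ[R] A} {dB : B →ₗ[R] B} {ε : B →ₐ[R] R}
    (hd : ∀ x, ε (dB x) = 0) (t : 𝒜 ᵍ⊗[R] ℬ) :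
    counitRight 𝒜 ℬ ε (tensorDiff 𝒜 ℬ dA dB t) = dA (counitRight 𝒜 ℬ ε t) := by
  induction t using tensor_induction with
  | h0 => simp
  | add x y hx hy => simp only [map_add, hx, hy]
  | tmul a b =>
    rw [tensorDiff_tmul, map_add, counitRight_tmul, counitRight_tmul, counitRight_tmul, hd,
      zero_smul, add_zero, map_smul]

theorem counitLeft_mul {ε : A →ₐ[R] R} (hε : ∀ n, n ≠ 0 → ∀ x ∈ 𝒜 n, ε x = 0) (s t : 𝒜 ᵍ⊗[R] ℬ) :
    counitLeft 𝒜 ℬ ε (s * t) = counitLeft 𝒜 ℬ ε s * counitLeft 𝒜 ℬ ε t := by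
  induction s using tensor_homogeneous_induction with
  | h0 => simp
  | add x y hx hy => simp only [map_add, add_mul, hx, hy]
  | tmul i j a ha b hb =>
    induction t using tensor_homogeneous_induction with
    | h0 => simp
    | add x y hx hy => simp only [map_add, mul_add, hx, hy]
    | tmul k l a' ha' b' hb' =>
      rw [tmul_mul_tmul a hb ha' b', map_smul, counitLeft_tmul, counitLeft_tmul, counitLeft_tmul,
        map_mul, smul_mul_smul_comm]
      rcases k with _ | k
      · rw [mul_zero, pow_zero, one_smul]
      · rw [hε (k + 1) (by omega) a' ha', mul_zero, zero_smul, smul_zero]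

theorem counitRight_mul {ε : B →ₐ[R] R} (hε : ∀ n, n ≠ 0 → ∀ x ∈ ℬ n, ε x = 0) (s t : 𝒜 ᵍ⊗[R] ℬ) :
    counitRight 𝒜 ℬ ε (s * t) = counitRight 𝒜 ℬ ε s * counitRight 𝒜 ℬ ε t := by
  induction s using tensor_homogeneous_induction with
  | h0 => simp
  | add x y hx hy => simp only [map_add, add_mul, hx, hy]
  | tmul i j a ha b hb =>
    induction t using tensor_homogeneous_induction with
    | h0 => simp
    | add x y hx hy => simp only [map_add, mul_add, hx, hy]
    | tmul k l a' ha' b' hb' =>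
      rw [tmul_mul_tmul a hb ha' b', map_smul, counitRight_tmul, counitRight_tmul,
        counitRight_tmul, map_mul, smul_mul_smul_comm]
      rcases j with _ | j
      · rw [zero_mul, pow_zero, one_smul]
      · rw [hε (j + 1) (by omega) b hb, zero_mul, zero_smul, smul_zero]

variable {H : Type w} [Ring H] [Algebra R H] {ℋ : ℕ → Submodule R H} [GradedAlgebra ℋ]
  {ΔH : H →ₗ[R] (ℋ ᵍ⊗[R] ℋ)}

/-- The counit of a Hopf algebra up to homotopy induces the counit of its homology: it induces a
left counit, and this agrees with any right counit. -/
theorem IsHopfIso.counit_eq {d : A →ₗ[R] A} {ψ : A →ₗ[R] (𝒜 ᵍ⊗[R] 𝒜)} {i : H ≃ₗ[R] Homology d}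
    (hi : IsHopfIso 𝒜 ℋ ΔH d ψ i) {ε : A →ₐ[R] R} (hε : IsCounit 𝒜 d ψ ε) {εH : H →ₐ[R] R}
    (hεH : IsCounit ℋ 0 ΔH εH) {x : H} {z : LinearMap.ker d} (hz : Homology.mk d z = i x) :
    ε z = εH x := by
  let q : Homology d →ₗ[R] R := Submodule.liftQ _ (ε.toLinearMap ∘ₗ (LinearMap.ker d).subtype) (by
    rintro ⟨y, hy⟩ ⟨w, hw⟩
    rw [LinearMap.mem_ker]
    change d w = y at hw
    change ε y = 0
    rw [← hw, hε.map_diff])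
  let e : H →ₗ[R] R := q ∘ₗ i.toLinearMap
  have hq : ∀ z : LinearMap.ker d, q (Homology.mk d z) = ε z := fun z => rfl
  have key : ∀ x, TensorProduct.lid R H (TensorProduct.map e LinearMap.id
      ((GradedTensorProduct.of R ℋ ℋ).symm (ΔH x))) = x := by
    intro x
    obtain ⟨z, t, h1, h2, w, hw⟩ := hi.map_comul x
    let c : LinearMap.ker d ⊗[R] LinearMap.ker d →ₗ[R] LinearMap.ker d :=
      (TensorProduct.lid R _).toLinearMap ∘ₗ
        TensorProduct.map (ε.toLinearMap ∘ₗ (LinearMap.ker d).subtype) LinearMap.id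
    have e1 : ∀ t, i (TensorProduct.lid R H (TensorProduct.map e LinearMap.id t)) =
        TensorProduct.lid R _ (TensorProduct.map q LinearMap.id
          (TensorProduct.map i.toLinearMap i.toLinearMap t)) := by
      intro t
      induction t using TensorProduct.induction_on with
      | zero => simp
      | add x y hx hy => simp only [map_add, hx, hy]
      | tmul a b => simp [e]
    have e2 : ∀ t, Homology.mk d (c t) = TensorProduct.lid R _ (TensorProduct.map q LinearMap.id
        (TensorProduct.map (Homology.mk d) (Homology.mk d) t)) := by
      intro t
      induction t using TensorProduct.induction_on with
      | zero => simp
      | add x y hx hy => simp only [map_add, hx, hy]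
      | tmul a b => rfl
    have e3 : ∀ t, (c t : A) = counitLeft 𝒜 𝒜 ε (GradedTensorProduct.of R 𝒜 𝒜
        (TensorProduct.map (LinearMap.ker d).subtype (LinearMap.ker d).subtype t)) := by
      intro t
      induction t using TensorProduct.induction_on with
      | zero => simp
      | add x y hx hy =>
        simp only [map_add]
        rw [← hx, ← hy]
        rfl
      | tmul a b => rfl
    apply i.injective
    rw [e1, ← h2, ← e2, ← h1, Homology.mk_eq_mk]
    refine ⟨-counitLeft 𝒜 𝒜 ε w, ?_⟩
    have hl : counitLeft 𝒜 𝒜 ε (ψ z) = z := hε.left z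
    rw [map_neg, ← counitLeft_tensorDiff hε.map_pos_degree hε.map_diff, hw, map_sub, hl, ← e3,
      neg_sub]
  have comm : ∀ t : H ⊗[R] H, εH (TensorProduct.lid R H (TensorProduct.map e LinearMap.id t)) =
      e (TensorProduct.rid R H (TensorProduct.map LinearMap.id εH.toLinearMap t)) := by
    intro t
    induction t using TensorProduct.induction_on with
    | zero => simp
    | add x y hx hy => simp only [map_add, hx, hy]
    | tmul a b =>
      change εH (e a • b) = e (εH b • a)
      rw [map_smul, map_smul, smul_eq_mul, smul_eq_mul, mul_comm]
  have := comm ((GradedTensorProduct.of R ℋ ℋ).symm (ΔH x))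
  rw [key, hεH.right] at this
  rw [this, ← hq, hz]
  rfl

end Counit

namespace HopfResolution

variable {R : Type u} [CommRing R] {H : Type w} [Ring H] [Algebra R H]
  {ℋ : ℕ → Submodule R H} [GradedAlgebra ℋ] {ΔH : H →ₗ[R] (ℋ ᵍ⊗[R] ℋ)}
  (S : HopfResolution.{u, v, w} ℋ ΔH)

/-- The resolution itself, as a perturbation. -/
def zeroPerturbation : S.Perturbation where
  h := 0
  ν := 0
  h_res := fun _ _ _ => Submodule.zero_mem _
  ν_res := fun _ _ _ => Submodule.zero_mem _
  isHah := by rw [add_zero, add_zero]; exact S.isHah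

/-- The counit of a Hopf resolution is induced by that of `H`. -/
theorem counit_eq {ε : S.carrier →ₐ[R] R} (hε : IsCounit S.gr S.diff S.comul ε) {εH : H →ₐ[R] R}
    (hεH : IsCounit ℋ 0 ΔH εH) (y : S.carrier) : ε y = εH (S.ρ y) := by
  induction y using homogeneous_induction S.res with
  | h0 => rw [map_zero, map_zero, map_zero]
  | add x y hx hy => rw [map_add, map_add, map_add, hx, hy]
  | hom q y hy =>
    rcases q with _ | q
    · obtain ⟨i, hi⟩ := S.zeroPerturbation.isDiff.exists_represents_id
      obtain ⟨z, hz, hz'⟩ := hi y hy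
      have h : IsCounit S.gr S.zeroPerturbation.diff S.zeroPerturbation.comul ε := by
        change IsCounit S.gr (S.diff + 0) (S.comul + 0) ε
        rwa [add_zero, add_zero]
      rw [← (S.zeroPerturbation.isHopfIso hi).counit_eq h hεH hz', hz]
      rfl
    · rw [S.ρ_res (q + 1) (by omega) y hy, map_zero]
      refine bihomogeneous_induction S.proj_res_mem (p := fun y => ε y = 0) (map_zero ε)
        (fun n y hn hy => ?_) (fun x y hx hy => by rw [map_add, hx, hy, add_zero]) hy
      rcases n with _ | n
      · -- in total degree zero, elements of positive resolution degree are boundaries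
        obtain ⟨w, hw⟩ := S.isResolution.exact y (S.isHah.dga.map_zero_degree y hn)
          (S.isResolution.map_pos q y hy)
        rw [← hw, hε.map_diff]
      · exact hε.map_pos_degree (n + 1) (by omega) y hn

end HopfResolution

/-! ### Perturbing the differential to a model of a given algebra -/

namespace HopfResolution

variable {R : Type u} [CommRing R] {H : Type w} [Ring H] [Algebra R H]
  {ℋ : ℕ → Submodule R H} [GradedAlgebra ℋ] {ΔH : H →ₗ[R] (ℋ ᵍ⊗[R] ℋ)}
  {S : HopfResolution.{u, v, w} ℋ ΔH}
  {A : Type*} [Ring A] [Algebra R A] {𝒜 : ℕ → Submodule R A} [GradedAlgebra 𝒜] {dA : A →ₗ[R] A}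
  {ψ : A →ₗ[R] (𝒜 ᵍ⊗[R] 𝒜)} {i : H ≃ₗ[R] Homology dA} {X : Type*} {x : X → S.carrier}
  {lev deg : X → ℕ}

theorem represents_of_generators (hA : IsDGA 𝒜 dA) (hi : IsHopfIso 𝒜 ℋ ΔH dA ψ i)
    (hfree : IsFreeOn R x) (hres : ∀ j, x j ∈ S.res (lev j)) (f : S.carrier →ₐ[R] A)
    (hf : ∀ j, lev j = 0 →
      ∃ z : LinearMap.ker dA, (z : A) = f (x j) ∧ Homology.mk dA z = i (S.ρ (x j))) :
    S.Represents f.toLinearMap i := by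
  intro y hy
  have hy' := hfree.mem_adjoin hres zero_lt_one hy
  clear hy
  change ∃ z : LinearMap.ker dA, (z : A) = f y ∧ Homology.mk dA z = i (S.ρ y)
  induction hy' using Algebra.adjoin_induction with
  | mem y hy =>
    obtain ⟨j, hj, rfl⟩ := hy
    exact hf j (Nat.lt_one_iff.1 hj)
  | algebraMap r =>
    let z : LinearMap.ker dA := ⟨1, hA.diff_one⟩
    refine ⟨r • z, ?_, ?_⟩
    · rw [AlgHom.commutes, Algebra.algebraMap_eq_smul_one]; rfl
    · rw [map_smul, hi.map_one z rfl, AlgHom.commutes, Algebra.algebraMap_eq_smul_one, map_smul]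
  | add y y' _ _ hy hy' =>
    obtain ⟨z, h1, h2⟩ := hy
    obtain ⟨z', h1', h2'⟩ := hy'
    exact ⟨z + z', by rw [map_add, ← h1, ← h1']; rfl, by rw [map_add, h2, h2', map_add, map_add]⟩
  | mul y y' _ _ hy hy' =>
    obtain ⟨z, h1, h2⟩ := hy
    obtain ⟨z', h1', h2'⟩ := hy'
    have hzz : dA (z * z') = 0 := by
      rw [hA.diff_mul, LinearMap.mem_ker.1 z.2, LinearMap.mem_ker.1 z'.2, zero_mul, mul_zero,
        add_zero]
    refine ⟨⟨z * z', hzz⟩, by rw [map_mul, ← h1, ← h1'], ?_⟩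
    rw [map_mul]
    exact hi.map_mul _ _ z z' _ h2 h2' rfl

/-- `lowerGr 𝒢 n` is the part of degree `n - 1`, which is zero for `n = 0`. -/
def lowerGr (𝒢 : ℕ → Submodule R S.carrier) : ℕ → Submodule R S.carrier
  | 0 => ⊥
  | n + 1 => 𝒢 n

theorem mul_lowerGr_mem {m n : ℕ} {y z : S.carrier} (hy : y ∈ S.gr m)
    (hz : z ∈ lowerGr S.gr n) : y * z ∈ lowerGr S.gr (m + n) := by
  rcases n with _ | n
  · rw [(Submodule.mem_bot R).1 hz, mul_zero]; exact Submodule.zero_mem _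
  · exact SetLike.GradedMul.mul_mem (A := S.gr) hy hz

theorem lowerGr_mul_mem {m n : ℕ} {y z : S.carrier} (hz : z ∈ lowerGr S.gr m) (hy : y ∈ S.gr n) :
    z * y ∈ lowerGr S.gr (m + n) := by
  rcases m with _ | m
  · rw [(Submodule.mem_bot R).1 hz, zero_mul]; exact Submodule.zero_mem _
  · rw [Nat.succ_add]; exact SetLike.GradedMul.mul_mem (A := S.gr) hz hy

theorem der_fil (hfree : IsFreeOn R x) (hres : ∀ j, x j ∈ S.res (lev j)) {θ : X → S.carrier}
    (hθ : ∀ j, θ j ∈ fil S.res (lev j - 1)) (q : ℕ) (z : S.carrier) (hz : z ∈ S.res q) :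
    hfree.der (parityHom S.gr) (AlgHom.id R _) θ z ∈ fil S.res (q - 1) := by
  refine hfree.der_mem hres (hfree.isTwistedDer_der _ _ θ) (fun q => fil S.res (q - 1)) ?_ ?_
    (fun j => by rw [hfree.der_apply]; exact hθ j) q z hz
  · intro m n y hy z hz
    exact map_fil (f := LinearMap.mulLeft R (parityHom S.gr y)) (fun k hk b hb =>
      le_fil (show m + k < m + n - 1 by omega)
        (SetLike.GradedMul.mul_mem (parity_res_mem S.proj_res_mem hy) hb)) hz
  · intro m n z hz y hy
    exact map_fil (f := LinearMap.mulRight R y) (fun k hk b hb =>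
      le_fil (show k + n < m + n - 1 by omega) (SetLike.GradedMul.mul_mem hb hy)) hz

/-- The perturbation of the differential with values `θ` on generators is a derivation of degree
`-1`. -/
theorem der_lowerGr (hfree : IsFreeOn R x) (hdeg : ∀ j, x j ∈ S.gr (deg j)) {θ : X → S.carrier}
    (hθ : ∀ j, θ j ∈ lowerGr S.gr (deg j)) (n : ℕ) (z : S.carrier) (hz : z ∈ S.gr n) :
    (S.diff + hfree.der (parityHom S.gr) (AlgHom.id R _) θ) z ∈ lowerGr S.gr n := by
  rw [LinearMap.add_apply]
  refine Submodule.add_mem _ ?_ (hfree.der_mem hdeg (hfree.isTwistedDer_der _ _ θ) (lowerGr S.gr)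
    (fun m n y hy z hz => mul_lowerGr_mem (parity_mem S.gr hy) hz)
    (fun m n z hz y hy => lowerGr_mul_mem hz hy)
    (fun j => by rw [hfree.der_apply]; exact hθ j) n z hz)
  rcases n with _ | n
  · rw [S.isHah.dga.map_zero_degree z hz]; exact Submodule.zero_mem _
  · exact S.isHah.dga.map_mem n z hz

theorem diff_add_der_mul (hfree : IsFreeOn R x) (θ : X → S.carrier) (y z : S.carrier) :
    (S.diff + hfree.der (parityHom S.gr) (AlgHom.id R _) θ) (y * z) =
      (S.diff + hfree.der (parityHom S.gr) (AlgHom.id R _) θ) y * z +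
        parity S.gr y * (S.diff + hfree.der (parityHom S.gr) (AlgHom.id R _) θ) z := by
  have h := hfree.isTwistedDer_der (parityHom S.gr) (AlgHom.id R _) θ y z
  change _ = parity S.gr y * _ + _ * z at h
  simp only [LinearMap.add_apply]
  rw [h, S.isHah.dga.diff_mul, mul_add, add_mul]
  abel

/-- The square of a derivation of degree `-1` is a derivation, so it vanishes if it does on
generators. -/
theorem diff_diff_of_mem_adjoin {D : S.carrier →ₗ[R] S.carrier}
    (hmul : ∀ y z, D (y * z) = D y * z + parity S.gr y * D z)
    (hdeg : ∀ n, ∀ y ∈ S.gr n, D y ∈ lowerGr S.gr n) {Z : Set S.carrier}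
    (hZ : ∀ y ∈ Z, D (D y) = 0) {y : S.carrier} (hy : y ∈ Algebra.adjoin R Z) : D (D y) = 0 := by
  have hpar : ∀ y, parity S.gr (D y) = -D (parity S.gr y) :=
    parity_map_of_degree_neg_one (fun y hy => (Submodule.mem_bot R).1 (hdeg 0 y hy))
      (fun n y hy => hdeg (n + 1) y hy)
  have : IsTwistedDer (AlgHom.id R _) (AlgHom.id R _) (D ∘ₗ D) := fun y z => by
    simp only [LinearMap.comp_apply, AlgHom.id_apply, hmul, map_add, hpar, parity_parity]
    noncomm_ring
  exact this.eq_zero hZ hy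

/-- There are a perturbation of the differential of a Hopf resolution of `H(A)` and a map of the
perturbed resolution to `A` that realizes the isomorphism in homology. Both are constructed on the
generators, by induction on the resolution degree. -/
theorem exists_diffPerturbation (S : HopfResolution.{u, v, w} ℋ ΔH) (hA : IsDGA 𝒜 dA)
    (hi : IsHopfIso 𝒜 ℋ ΔH dA ψ i) {εA : A →ₐ[R] R} (hεA : ∀ n, n ≠ 0 → ∀ a ∈ 𝒜 n, εA a = 0)
    {ε : S.carrier →ₐ[R] R} {εH : H →ₐ[R] R} (hερ : ∀ y, ε y = εH (S.ρ y))
    (hεi : ∀ (y : H) (z : LinearMap.ker dA), Homology.mk dA z = i y → εA z = εH y) :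
    ∃ (h : S.carrier →ₗ[R] S.carrier) (f : S.carrier →ₗ[R] A), S.IsDiffPerturbation h ∧
      IsDGAMap S.gr (S.diff + h) 𝒜 dA f ∧ S.Represents f i ∧ ∀ y, εA (f y) = ε y := by
  obtain ⟨X, x, lev, deg, hres, hsf⟩ := S.exists_semiFree
  have hsf0 := hsf S.diff S.isHah.dga (fun q y hy => by
    rcases q with _ | q
    · rw [S.diff_res_zero y hy]; exact Submodule.zero_mem _
    · exact le_fil (Nat.lt_succ_self _) (S.diff_res q y hy))
  have hfree := hsf0.free
  have hdeg := hsf0.deg_mem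
  -- a generator is sent to `a`, and the differential is changed by `θ` on it
  let T : X → S.carrier × A → Prop := fun j p =>
    p.1 ∈ fil S.res (lev j - 1) ∧ p.1 ∈ lowerGr S.gr (deg j) ∧ p.2 ∈ 𝒜 (deg j) ∧
      εA p.2 = ε (x j) ∧
      (lev j = 0 → ∃ z : LinearMap.ker dA, (z : A) = p.2 ∧ Homology.mk dA z = i (S.ρ (x j)))
  let D : (X → S.carrier × A) → S.carrier →ₗ[R] S.carrier := fun v =>
    S.diff + hfree.der (parityHom S.gr) (AlgHom.id R _) fun j => (v j).1
  let f : (X → S.carrier × A) → S.carrier →ₐ[R] A := fun v => hfree.lift fun j => (v j).2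
  have hDx : ∀ v j, D v (x j) = S.diff (x j) + (v j).1 := fun v j => by
    rw [LinearMap.add_apply, hfree.der_apply]
  have hfx : ∀ v j, f v (x j) = (v j).2 := fun v j => hfree.lift_apply _ j
  have hlow : ∀ {q n : ℕ} {y : S.carrier}, q ≤ n → y ∈ fil S.res q →
      y ∈ Algebra.adjoin R (x '' {j | lev j < n}) := fun {q n y} hq hy =>
    fil_le (V := Subalgebra.toSubmodule (Algebra.adjoin R (x '' {j | lev j < n})))
      (fun k hk y hy => hfree.mem_adjoin hres (hk.trans_le hq) hy) hy
  have hdx : ∀ j, S.diff (x j) ∈ fil S.res (lev j) := fun j => by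
    have h := hres j
    rcases hl : lev j with _ | q
    · rw [hl] at h; rw [S.diff_res_zero _ h]; exact Submodule.zero_mem _
    · rw [hl] at h; exact le_fil (Nat.lt_succ_self _) (S.diff_res q _ h)
  have hdx0 : ∀ j, deg j = 0 → S.diff (x j) = 0 := fun j hj =>
    S.isHah.dga.map_zero_degree _ (hj ▸ hdeg j)
  have hεx : ∀ j, lev j ≠ 0 → ε (x j) = 0 := fun j hj => by
    rw [hερ, S.ρ_res _ hj _ (hres j), map_zero]
  have hrep : ∀ v : X → S.carrier × A, (∀ j, T j (v j)) →
      S.Represents (f v).toLinearMap i := fun v hv =>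
    represents_of_generators hA hi hfree hres (f v) fun j hj => by
      rw [hfx]; exact (hv j).2.2.2.2 hj
  have hmul := fun v : X → S.carrier × A => diff_add_der_mul (S := S) hfree fun j => (v j).1
  have hDdeg : ∀ v : X → S.carrier × A, (∀ j, T j (v j)) →
      ∀ n, ∀ y ∈ S.gr n, D v y ∈ lowerGr S.gr n := fun v hv =>
    der_lowerGr hfree hdeg fun j => (hv j).2.1
  have hhfil : ∀ v : X → S.carrier × A, (∀ j, T j (v j)) → ∀ q, ∀ z ∈ S.res q,
      hfree.der (parityHom S.gr) (AlgHom.id R _) (fun j => (v j).1) z ∈ fil S.res (q - 1) :=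
    fun v hv => der_fil hfree hres fun j => (hv j).1
  have hfdeg : ∀ v : X → S.carrier × A, (∀ j, T j (v j)) →
      ∀ n, ∀ y ∈ S.gr n, f v y ∈ 𝒜 n := fun v hv =>
    hfree.hom_mem hdeg (f v) 𝒜 (SetLike.one_mem_graded 𝒜)
      (fun m n y hy z hz => SetLike.GradedMul.mul_mem hy hz) fun j => by
        rw [hfx]; exact (hv j).2.2.1
  have hT0 : ∀ j, ∃ p, T j p := by
    intro j
    by_cases hj : lev j = 0
    · have hρ : S.ρ (x j) ∈ ℋ (deg j) := S.ρ_map.map_mem _ _ (hdeg j)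
      obtain ⟨z, hz, hz'⟩ := hi.map_mem _ _ hρ
      exact ⟨(0, z), Submodule.zero_mem _, Submodule.zero_mem _, hz,
        by rw [hεi _ z hz', hερ], fun _ => ⟨z, rfl, hz'⟩⟩
    · exact ⟨0, Submodule.zero_mem _, Submodule.zero_mem _, Submodule.zero_mem _,
        by rw [hεx j hj]; exact map_zero εA, fun h => absurd h hj⟩
  obtain ⟨v, hv⟩ := exists_of_levelwise lev T (fun v j p =>
      D v (S.diff (x j) + p.1) = 0 ∧ f v (S.diff (x j) + p.1) = dA p.2) hT0
    (by
      intro v v' j p hp hvv' ⟨h1, h2⟩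
      have hy : S.diff (x j) + p.1 ∈ Algebra.adjoin R (x '' {k | lev k < lev j}) :=
        Subalgebra.add_mem _ (hlow le_rfl (hdx j)) (hlow (Nat.sub_le _ _) hp.1)
      constructor
      · rw [← h1]
        simp only [D, LinearMap.add_apply]
        congr 1
        refine ((hfree.isTwistedDer_der _ _ _).eqOn (hfree.isTwistedDer_der _ _ _)
          (fun _ _ => rfl) (fun _ _ => rfl) ?_ hy).symm
        rintro _ ⟨k, hk, rfl⟩
        rw [hfree.der_apply, hfree.der_apply, hvv' k hk]
      · rw [← h2]
        refine (algHom_eqOn_adjoin ?_ hy).symm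
        rintro _ ⟨k, hk, rfl⟩
        rw [hfx, hfx, hvv' k hk])
    (by
      intro v j hv hgood
      have hD0 : ∀ y ∈ S.res 0, D v y = 0 := fun y hy =>
        S.isResolution.diff_zero_of_perturbation (hhfil v hv) hy
      have hDD : ∀ y ∈ Algebra.adjoin R (x '' {k | lev k < lev j}), D v (D v y) = 0 := fun y hy =>
        diff_diff_of_mem_adjoin (hmul v) (hDdeg v hv) (by
          rintro _ ⟨k, hk, rfl⟩
          rw [hDx]; exact (hgood k hk).1) hy
      have hfD : ∀ y ∈ Algebra.adjoin R (x '' {k | lev k < lev j}), f v (D v y) = dA (f v y) :=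
        fun y hy => chain_on_adjoin (hmul v) hA (f v)
          (parity_map_of_degree_zero (f := (f v).toLinearMap) (hfdeg v hv)) (by
          rintro _ ⟨k, hk, rfl⟩
          rw [hDx, hfx]; exact (hgood k hk).2) hy
      by_cases hj : lev j = 0
      · obtain ⟨p, hp⟩ := hT0 j
        refine ⟨p, hp, ?_⟩
        have h0 : S.diff (x j) + p.1 = 0 := by
          have h1 := hdx j
          have h2 := hp.1
          rw [hj] at h1 h2
          rw [fil_zero, Submodule.mem_bot] at h1
          rw [Nat.zero_sub, fil_zero, Submodule.mem_bot] at h2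
          rw [h1, h2, add_zero]
        obtain ⟨z, hz, -⟩ := hp.2.2.2.2 hj
        have hz' : dA z = 0 := z.2
        rw [h0, map_zero, map_zero, ← hz, hz']
        exact ⟨rfl, rfl⟩
      by_cases hn : deg j = 0
      · refine ⟨0, ⟨Submodule.zero_mem _, Submodule.zero_mem _, Submodule.zero_mem _,
          by rw [hεx j hj]; exact map_zero εA, fun h => absurd h hj⟩, ?_⟩
        have h0 : S.diff (x j) + (0 : S.carrier × A).1 = 0 := by rw [hdx0 j hn]; exact add_zero _
        rw [h0, map_zero, map_zero]
        exact ⟨rfl, (map_zero dA).symm⟩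
      obtain ⟨n, hn⟩ := Nat.exists_eq_succ_of_ne_zero hn
      -- solutions that are not necessarily homogeneous
      obtain ⟨θ, a, hθ, h1, h2⟩ : ∃ θ a, θ ∈ fil S.res (lev j - 1) ∧ D v (S.diff (x j) + θ) = 0 ∧
          f v (S.diff (x j) + θ) = dA a := by
        have hdL := hlow le_rfl (hdx j)
        have hbdry : ∀ y ∈ S.res 0, (∃ b, f v y = dA b) ↔ S.ρ y = 0 := by
          intro y hy
          obtain ⟨z, hz, hz'⟩ := hrep v hv y hy
          rw [← map_eq_zero_iff _ i.injective, ← hz', Homology.mk_eq_zero, hz]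
          exact ⟨fun ⟨b, hb⟩ => ⟨b, hb.symm⟩, fun ⟨b, hb⟩ => ⟨b, hb.symm⟩⟩
        obtain ⟨q, hq⟩ := Nat.exists_eq_succ_of_ne_zero hj
        have hxj := hres j
        rw [hq] at hxj
        rcases q with _ | q
        · have hy := S.diff_res 0 _ hxj
          obtain ⟨b, hb⟩ := (hbdry _ hy).2 (S.isResolution.map_diff (x j))
          exact ⟨0, b, Submodule.zero_mem _, by rw [add_zero, hD0 _ hy], by rw [add_zero, hb]⟩
        · have hF := S.isResolution.isResFiltration (hhfil v hv)
          have hc : D v (S.diff (x j)) ∈ fil S.res q := by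
            rw [LinearMap.add_apply, S.isHah.dga.diff_diff, zero_add]
            exact hhfil v hv (q + 1) _ (S.diff_res (q + 1) _ hxj)
          have hDc : D v (D v (S.diff (x j))) = 0 := hDD _ hdL
          -- the obstruction `D v (d x)` is the boundary of an element of lower degree
          obtain ⟨θ₁, hθ₁, h1⟩ : ∃ θ₁ ∈ fil S.res (q + 1), D v (S.diff (x j) + θ₁) = 0 := by
            rcases q with _ | q
            · rw [fil_zero, Submodule.mem_bot] at hc
              exact ⟨0, Submodule.zero_mem _, by rw [add_zero, hc]⟩
            obtain ⟨w, hw, hw'⟩ := hF.reduce (q + 1)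
              (fun w hw => hDD w (hlow (by omega) hw)) hc hDc
            rw [fil_one] at hw'
            obtain ⟨w₂, hw₂⟩ := S.isResolution.exact _ (S.diff_res_zero _ hw') (by
              refine (hbdry _ hw').1 ⟨f v (S.diff (x j) - w), ?_⟩
              rw [← hfD _ (Subalgebra.sub_mem _ hdL (hlow (by omega) hw)), map_sub (D v)])
            have hw₂' : D v (GradedAlgebra.proj S.res 1 w₂) = S.diff w₂ := by
              have hp : GradedAlgebra.proj S.res 1 w₂ ∈ fil S.res 2 :=
                le_fil one_lt_two (proj_mem _ _ _)
              rw [LinearMap.add_apply, IsResolution.perturbation_zero (hhfil v hv) hp, add_zero,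
                ← S.isResolution.grading.pr_diff S.diff_res S.diff_res_zero, hw₂,
                proj_of_mem _ hw']
            refine ⟨-(w + GradedAlgebra.proj S.res 1 w₂), Submodule.neg_mem _ (Submodule.add_mem _
              hw (le_fil (by omega) (proj_mem _ _ _))), ?_⟩
            rw [map_add, map_neg, map_add, hw₂', hw₂]
            change _ + -(D v w + (D v (S.diff (x j)) - D v w)) = 0
            abel
          have hL₁ := Subalgebra.add_mem _ hdL (hlow (n := lev j) (by omega) hθ₁)
          have hcyc : dA (f v (S.diff (x j) + θ₁)) = 0 := by rw [← hfD _ hL₁, h1, map_zero]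
          -- an element of degree zero corrects the homology class of `f v (d x + θ₁)`
          obtain ⟨c, hc'⟩ := i.surjective (Homology.mk dA ⟨_, hcyc⟩)
          obtain ⟨y, hy, rfl⟩ := S.isResolution.exists_zero c
          obtain ⟨z, hz, hz'⟩ := hrep v hv y hy
          obtain ⟨b, hb⟩ := Homology.mk_eq_mk.1 (hc'.symm.trans hz'.symm)
          refine ⟨θ₁ - y, b, ?_, ?_, ?_⟩
          · rw [hq]
            exact Submodule.sub_mem _ hθ₁ (le_fil (by omega) hy)
          · rw [← add_sub_assoc, map_sub, h1, hD0 y hy, sub_zero]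
          · rw [← add_sub_assoc, map_sub, hb, hz]
            rfl
      have hdn : S.diff (x j) ∈ S.gr n :=
        S.isHah.dga.map_mem n _ (by rw [← Nat.succ_eq_add_one, ← hn]; exact hdeg j)
      refine ⟨(GradedAlgebra.proj S.gr n θ, GradedAlgebra.proj 𝒜 (n + 1) a),
        ⟨?_, ?_, ?_, ?_, fun h => absurd h hj⟩, ?_, ?_⟩
      · exact map_fil (fun k hk y hy => le_fil hk (S.proj_res_mem k n y hy)) hθ
      · rw [hn]; exact proj_mem S.gr n θ
      · rw [hn]; exact proj_mem 𝒜 (n + 1) a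
      · rw [hεx j hj]; exact hεA (n + 1) (by omega) _ (proj_mem _ _ _)
      · have e : S.diff (x j) + GradedAlgebra.proj S.gr n θ =
            GradedAlgebra.proj S.gr n (S.diff (x j) + θ) := by
          rw [map_add, proj_of_mem S.gr hdn]
        rw [e]
        rcases n with _ | n
        · exact (Submodule.mem_bot R).1 (hDdeg v hv 0 _ (proj_mem _ _ _))
        · rw [← proj_map_of_degree_neg_one (𝒜 := S.gr) (ℬ := S.gr) (d := D v)
            (fun y hy => (Submodule.mem_bot R).1 (hDdeg v hv 0 y hy))
            (fun n y hy => hDdeg v hv (n + 1) y hy), h1, map_zero]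
      · have e : S.diff (x j) + GradedAlgebra.proj S.gr n θ =
            GradedAlgebra.proj S.gr n (S.diff (x j) + θ) := by
          rw [map_add, proj_of_mem S.gr hdn]
        rw [e]
        have := proj_map_of_degree_zero (𝒜 := S.gr) (ℬ := 𝒜) (f := (f v).toLinearMap) (hfdeg v hv)
          n (S.diff (x j) + θ)
        change _ = f v _ at this
        rw [← this, ← proj_map_of_degree_neg_one hA.map_zero_degree hA.map_mem, ← h2]
        rfl)
  have hT := fun j => (hv j).1
  have hdga : IsDGA S.gr (D v) := .of_mul (fun n y hy => hDdeg v hT (n + 1) y hy)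
    (fun y hy => (Submodule.mem_bot R).1 (hDdeg v hT 0 y hy))
    (fun y => diff_diff_of_mem_adjoin (Z := Set.range x) (hmul v) (hDdeg v hT) (by
      rintro _ ⟨j, rfl⟩
      rw [hDx]; exact (hv j).2.1) (by rw [hfree.adjoin_eq_top]; trivial)) (hmul v)
  have hm : S.IsDiffPerturbation
      (hfree.der (parityHom S.gr) (AlgHom.id R _) fun j => (v j).1) := ⟨hhfil v hT, hdga⟩
  refine ⟨_, (f v).toLinearMap, hm, ?_, hrep v hT, fun y => ?_⟩
  · refine IsDGAMap.of_generators (hsf _ hm.dga hm.diff_fil) hA (f v)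
      (fun j => hfdeg v hT _ _ (hdeg j)) fun j => ?_
    change f v (D v (x j)) = dA (f v (x j))
    rw [hDx, hfx]
    exact (hv j).2.2
  · exact DFunLike.congr_fun (hfree.hom_ext (a := εA.comp (f v)) (b := ε) fun j => by
      change εA (f v (x j)) = ε (x j)
      rw [hfx]; exact (hT j).2.2.2.1) y

end HopfResolution

/-! ### Transfer of the coproduct -/

section Transfer

variable {R : Type u} [CommRing R]
variable {A : Type*} [Ring A] [Algebra R A] {𝒜 : ℕ → Submodule R A} [GradedAlgebra 𝒜]
  {dA : A →ₗ[R] A} {P : Type*} [Ring P] [Algebra R P] {𝒢 : ℕ → Submodule R P} [GradedAlgebra 𝒢]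
  {d : P →ₗ[R] P}

theorem tensorMap_tensorAssoc (f : P →ₗ[R] A) :
    (tensorMap f (tensorMap f f : (𝒢 ᵍ⊗[R] 𝒢) →ₗ[R] (𝒜 ᵍ⊗[R] 𝒜)) :
        (𝒢 ᵍ⊗[R] tensorGr 𝒢 𝒢) →ₗ[R] (𝒜 ᵍ⊗[R] tensorGr 𝒜 𝒜)) ∘ₗ tensorAssoc 𝒢 =
      tensorAssoc 𝒜 ∘ₗ tensorMap (tensorMap f f) f := by
  refine LinearMap.ext fun t => ?_
  induction t using tensor_assoc_induction with
  | h0 => simp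
  | add x y hx hy => rw [map_add, hx, hy, map_add]
  | tmul i j k a ha b hb c hc =>
    simp only [LinearMap.comp_apply, tensorAssoc_tmul, tensorMap_tmul]

theorem tensorMap_comm {f : P →ₗ[R] A} (hf : ∀ n, ∀ x ∈ 𝒢 n, f x ∈ 𝒜 n) :
    (tensorMap f f : (𝒢 ᵍ⊗[R] 𝒢) →ₗ[R] (𝒜 ᵍ⊗[R] 𝒜)) ∘ₗ
        (GradedTensorProduct.comm 𝒢 𝒢).toLinearMap =
      (GradedTensorProduct.comm 𝒜 𝒜).toLinearMap ∘ₗ tensorMap f f := by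
  refine tensor_ext _ _ fun i j a b => ?_
  have h1 := comm_tmul (𝒜 := 𝒢) (ℬ := 𝒢) a.2 b.2
  have h2 := comm_tmul (𝒜 := 𝒜) (ℬ := 𝒜) (hf i a a.2) (hf j b b.2)
  change tensorMap f f (GradedTensorProduct.comm 𝒢 𝒢 ((a : P) ᵍ⊗ₜ[R] (b : P))) =
    GradedTensorProduct.comm 𝒜 𝒜 (f a ᵍ⊗ₜ[R] f b)
  rw [h1, h2, map_smul, tensorMap_tmul]

/-- Coassociativity and cocommutativity up to homotopy are inherited by a semifree algebra along a
weak equivalence that commutes with the coproducts up to homotopy. -/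
theorem IsSemiFree.isHah_of_weakEquiv {X : Type*} {x : X → P} {lev deg : X → ℕ}
    (hP : IsSemiFree 𝒢 d x lev deg) (hflat : Module.Flat R P) {ψ : A →ₗ[R] (𝒜 ᵍ⊗[R] 𝒜)}
    (hA : IsHah 𝒜 dA ψ) {f : P →ₗ[R] A} (hf : IsDGAMap 𝒢 d 𝒜 dA f) (hw : IsWeakEquiv d dA f)
    {u : P →ₗ[R] (𝒢 ᵍ⊗[R] 𝒢)} (hu : IsDGAMap 𝒢 d (tensorGr 𝒢 𝒢) (tensorDiff 𝒢 𝒢 d d) u)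
    (hfu : DerivationHomotopic 𝒢 d (tensorGr 𝒜 𝒜) (tensorDiff 𝒜 𝒜 dA dA) (ψ ∘ₗ f)
      (tensorMap f f ∘ₗ u))
    (hε : ∃ ε : P →ₐ[R] R, IsCounit 𝒢 d u ε) : IsHah 𝒢 d u := by
  have hflatA := hA.flat
  have hff := hf.tensor hf
  have hwf : IsWeakEquiv (tensorDiff 𝒢 𝒢 d d) (tensorDiff 𝒜 𝒜 dA dA) (tensorMap f f) :=
    IsWeakEquiv.tensor hf hf hw hw hP.dga hP.dga hA.dga hA.dga
  have hP2 := hP.dga.tensor hP.dga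
  have hA2 := hA.dga.tensor hA.dga
  refine ⟨hflat, hP.dga, hu, hε, ?_, ?_⟩
  · refine hP.homotopic_of_weakEquiv (hP.dga.tensor hP2) (hA.dga.tensor hA2) (hf.tensor hff)
      (IsWeakEquiv.tensor hf hff hw hwf hP.dga hP2 hA.dga hA2)
      (isDGAMap_tensorAssoc.comp ((hu.tensor (IsDGAMap.id d)).comp hu))
      (((IsDGAMap.id d).tensor hu).comp hu) ?_
    have h1 := ((hfu.symm.tensorRight hf).precomp hu).postcomp (isDGAMap_tensorAssoc (d := dA))
    have h2 := hfu.symm.postcomp ((isDGAMap_tensorAssoc (d := dA)).comp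
      (hA.comul.tensor (IsDGAMap.id dA)))
    have h3 := hA.coassoc.precomp hf
    have h4 := hfu.postcomp ((IsDGAMap.id dA).tensor hA.comul)
    have h5 := (hfu.tensorLeft hf hP.dga).precomp hu
    have e1 : tensorMap f (tensorMap f f) ∘ₗ tensorAssoc 𝒢 ∘ₗ tensorMap u LinearMap.id ∘ₗ u =
        tensorAssoc 𝒜 ∘ₗ tensorMap (tensorMap f f ∘ₗ u) f ∘ₗ u := by
      rw [← LinearMap.comp_assoc, tensorMap_tensorAssoc, LinearMap.comp_assoc,
        ← LinearMap.comp_assoc _ _ (tensorMap (tensorMap f f) f), tensorMap_comp, LinearMap.comp_id]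
    have e2 : (tensorAssoc 𝒜 ∘ₗ (tensorMap ψ LinearMap.id :
        (𝒜 ᵍ⊗[R] 𝒜) →ₗ[R] (tensorGr 𝒜 𝒜 ᵍ⊗[R] 𝒜))) ∘ₗ tensorMap f f ∘ₗ u =
        tensorAssoc 𝒜 ∘ₗ tensorMap (ψ ∘ₗ f) f ∘ₗ u := by
      rw [LinearMap.comp_assoc, ← LinearMap.comp_assoc _ _ (tensorMap ψ LinearMap.id),
        tensorMap_comp, LinearMap.id_comp]
    have e3 : (tensorMap LinearMap.id ψ : (𝒜 ᵍ⊗[R] 𝒜) →ₗ[R] (𝒜 ᵍ⊗[R] tensorGr 𝒜 𝒜)) ∘ₗ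
        tensorMap f f ∘ₗ u = tensorMap f (ψ ∘ₗ f) ∘ₗ u := by
      rw [← LinearMap.comp_assoc, tensorMap_comp, LinearMap.id_comp]
    have e4 : (tensorMap f (tensorMap f f) :
        (𝒢 ᵍ⊗[R] tensorGr 𝒢 𝒢) →ₗ[R] (𝒜 ᵍ⊗[R] tensorGr 𝒜 𝒜)) ∘ₗ tensorMap LinearMap.id u ∘ₗ u =
        tensorMap f (tensorMap f f ∘ₗ u) ∘ₗ u := by
      rw [← LinearMap.comp_assoc, tensorMap_comp, LinearMap.comp_id]
    rw [e2] at h2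
    rw [e3] at h4
    rw [e1, e4]
    exact h1.trans (h2.trans (h3.trans (h4.trans h5)))
  · refine hP.homotopic_of_weakEquiv hP2 hA2 hff hwf ((isDGAMap_comm hP.dga hP.dga).comp hu) hu ?_
    have h1 := hfu.symm.postcomp (isDGAMap_comm hA.dga hA.dga)
    have h2 := hA.cocomm.precomp hf
    rw [← LinearMap.comp_assoc, tensorMap_comm hf.map_mem, LinearMap.comp_assoc]
    exact h1.trans (h2.trans hfu)

/-- The algebra map `(ε ⊗ 1, 1 ⊗ ε) : A ⊗ A → A × A`. -/
def counitPair {ε : A →ₐ[R] R} (hε : ∀ n, n ≠ 0 → ∀ x ∈ 𝒜 n, ε x = 0) :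
    (𝒜 ᵍ⊗[R] 𝒜) →ₐ[R] A × A :=
  AlgHom.prod
    (AlgHom.ofLinearMap (counitLeft 𝒜 𝒜 ε)
      (by rw [one_eq_tmul, counitLeft_tmul, map_one, one_smul]) (counitLeft_mul hε))
    (AlgHom.ofLinearMap (counitRight 𝒜 𝒜 ε)
      (by rw [one_eq_tmul, counitRight_tmul, map_one, one_smul]) (counitRight_mul hε))

theorem counitPair_apply {ε : A →ₐ[R] R} (hε : ∀ n, n ≠ 0 → ∀ x ∈ 𝒜 n, ε x = 0) (t : 𝒜 ᵍ⊗[R] 𝒜) :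
    counitPair hε t = (counitLeft 𝒜 𝒜 ε t, counitRight 𝒜 𝒜 ε t) := rfl

/-- The projection `a ↦ a - ε a` onto the augmentation ideal. -/
def augProj (ε : A →ₐ[R] R) : A →ₗ[R] A :=
  LinearMap.id - (Algebra.linearMap R A) ∘ₗ ε.toLinearMap

theorem augProj_apply (ε : A →ₐ[R] R) (a : A) : augProj ε a = a - ε a • 1 := by
  rw [← Algebra.algebraMap_eq_smul_one]; rfl

theorem counit_augProj (ε : A →ₐ[R] R) (a : A) : ε (augProj ε a) = 0 := by
  rw [augProj_apply, map_sub, map_smul, map_one, smul_eq_mul, mul_one, sub_self]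

theorem augProj_mem {ε : A →ₐ[R] R} (hε : ∀ n, n ≠ 0 → ∀ x ∈ 𝒜 n, ε x = 0) (n : ℕ) (x : A)
    (hx : x ∈ 𝒜 n) : augProj ε x ∈ 𝒜 n := by
  rw [augProj_apply]
  rcases n with _ | n
  · exact Submodule.sub_mem _ hx (Submodule.smul_mem _ _ (SetLike.one_mem_graded 𝒜))
  · rwa [hε (n + 1) (by omega) x hx, zero_smul, sub_zero]

theorem isKernelProjection_counitPair (hA : IsDGA 𝒜 dA) {ε : A →ₐ[R] R}
    (hε : ∀ n, n ≠ 0 → ∀ x ∈ 𝒜 n, ε x = 0) (hd : ∀ x, ε (dA x) = 0) :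
    IsKernelProjection (tensorGr 𝒜 𝒜) (tensorDiff 𝒜 𝒜 dA dA) (counitPair hε)
      (tensorMap (augProj ε) (augProj ε)) where
  map_proj e := by
    induction e using tensor_induction with
    | h0 => simp
    | add x y hx hy => simp only [map_add, hx, hy, add_zero]
    | tmul a b =>
      rw [tensorMap_tmul, counitPair_apply, counitLeft_tmul, counitRight_tmul, counit_augProj,
        counit_augProj, zero_smul, zero_smul]
      rfl
  eq_self e he := by
    have key : ∀ e : 𝒜 ᵍ⊗[R] 𝒜, tensorMap (augProj ε) (augProj ε) e =
        e - (1 : A) ᵍ⊗ₜ[R] counitLeft 𝒜 𝒜 ε e - counitRight 𝒜 𝒜 ε e ᵍ⊗ₜ[R] (1 : A) +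
          ε (counitLeft 𝒜 𝒜 ε e) • (1 : A) ᵍ⊗ₜ[R] (1 : A) := by
      intro e
      induction e using tensor_induction with
      | h0 => simp [tmul_zero_left, tmul_zero_right]
      | add x y hx hy =>
        simp only [map_add, hx, hy, tmul_add_left, tmul_add_right, add_smul]
        abel
      | tmul a b =>
        rw [tensorMap_tmul, counitLeft_tmul, counitRight_tmul, augProj_apply, augProj_apply,
          tmul_sub_left, tmul_sub_right, tmul_sub_right, tmul_smul_left, tmul_smul_left,
          tmul_smul_right, tmul_smul_right, tmul_smul_right, tmul_smul_left, map_smul, smul_smul,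
          smul_eq_mul]
        abel
    obtain ⟨h1, h2⟩ := Prod.mk.inj he
    change counitLeft 𝒜 𝒜 ε e = 0 at h1
    change counitRight 𝒜 𝒜 ε e = 0 at h2
    rw [key, h1, h2, tmul_zero_left, tmul_zero_right, map_zero, zero_smul, sub_zero, sub_zero,
      add_zero]
  comm e := by
    have h1 : ∀ a, augProj ε (dA a) = dA (augProj ε a) := fun a => by
      rw [augProj_apply, augProj_apply, hd, map_sub, map_smul, hA.diff_one, zero_smul, smul_zero]
    have h2 : ∀ a, augProj ε (parity 𝒜 a) = parity 𝒜 (augProj ε a) := fun a =>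
      (parity_map_of_degree_zero (augProj_mem hε) a).symm
    induction e using tensor_induction with
    | h0 => simp
    | add x y hx hy => simp only [map_add, hx, hy]
    | tmul a b =>
      rw [tensorDiff_tmul, map_add, tensorMap_tmul, tensorMap_tmul, tensorMap_tmul, tensorDiff_tmul,
        h1, h1, h2]
  map_mem n e he := by
    refine tensor_map_mem (f := tensorMap (augProj ε) (augProj ε))
      (fun i j hij a ha b hb => ?_) he
    exact tmul_mem_of_eq (augProj_mem hε i a ha) (augProj_mem hε j b hb) hij

end Transfer

namespace HopfResolution

variable {R : Type u} [CommRing R] {H : Type w} [Ring H] [Algebra R H]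
  {ℋ : ℕ → Submodule R H} [GradedAlgebra ℋ] {ΔH : H →ₗ[R] (ℋ ᵍ⊗[R] ℋ)}
  {A : Type*} [Ring A] [Algebra R A] {𝒜 : ℕ → Submodule R A} [GradedAlgebra 𝒜] {dA : A →ₗ[R] A}
  {ψ : A →ₗ[R] (𝒜 ᵍ⊗[R] 𝒜)} {i : H ≃ₗ[R] Homology dA} {S : HopfResolution.{u, v, w} ℋ ΔH}

/-- The coproduct of the resolution can be perturbed so that a given map `f : RH → A` commutes with
the coproducts up to homotopy. The counit does not change, as the corrections to the coproduct are
taken in the kernel of `counitPair`. -/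
theorem exists_comul_lift [Module.Flat R H] {h : S.carrier →ₗ[R] S.carrier}
    (hm : S.IsDiffPerturbation h) (hA : IsHah 𝒜 dA ψ) (hi : IsHopfIso 𝒜 ℋ ΔH dA ψ i)
    {f : S.carrier →ₗ[R] A} (hf : IsDGAMap S.gr (S.diff + h) 𝒜 dA f) (hfi : S.Represents f i)
    {ε : S.carrier →ₐ[R] R} (hε : IsCounit S.gr S.diff S.comul ε) {εA : A →ₐ[R] R}
    (hεA : IsCounit 𝒜 dA ψ εA) (hε0 : ∀ q, ∀ y ∈ S.res (q + 1), ε y = 0)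
    (hεf : ∀ y, εA (f y) = ε y) :
    ∃ (u : S.carrier →ₗ[R] (S.gr ᵍ⊗[R] S.gr)) (s : S.carrier →ₗ[R] (𝒜 ᵍ⊗[R] 𝒜)),
      IsDGAMap S.gr (S.diff + h) (tensorGr S.gr S.gr)
        (tensorDiff S.gr S.gr (S.diff + h) (S.diff + h)) u ∧
      IsDerivationHomotopy S.gr (S.diff + h) (tensorGr 𝒜 𝒜) (tensorDiff 𝒜 𝒜 dA dA) (ψ ∘ₗ f)
        (tensorMap f f ∘ₗ u) s ∧
      (∀ q, ∀ y ∈ S.res q, u y - S.comul y ∈ fil (tensorDeg S.gr S.gr S.res S.res) q) ∧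
      IsCounit S.gr (S.diff + h) u ε := by
  obtain ⟨X, x, lev, deg, hres, hsf⟩ := S.exists_semiFree
  have hP := hsf _ hm.dga hm.diff_fil
  have hw := hm.isWeakEquiv_of_represents hf.comm_apply hfi
  have hflat := S.isHah.flat
  have hflatA := hA.flat
  have hεD : ∀ y, ε ((S.diff + h) y) = 0 := fun y => by
    rw [← hεf, hf.comm_apply, hεA.map_diff]
  obtain ⟨L, hL⟩ : ∃ L : S.carrier →ₐ[R] (S.gr ᵍ⊗[R] S.gr), ∀ y, L y = S.comul y :=
    ⟨S.isHah.comul.toAlgHom, fun _ => rfl⟩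
  -- naturality of the counit maps with respect to `f`
  have hfL : ∀ t, counitLeft 𝒜 𝒜 εA (tensorMap f f t) = f (counitLeft S.gr S.gr ε t) := by
    intro t
    induction t using tensor_induction with
    | h0 => simp
    | add x y hx hy => simp only [map_add, hx, hy]
    | tmul a b => rw [tensorMap_tmul, counitLeft_tmul, counitLeft_tmul, hεf, map_smul]
  have hfR : ∀ t, counitRight 𝒜 𝒜 εA (tensorMap f f t) = f (counitRight S.gr S.gr ε t) := by
    intro t
    induction t using tensor_induction with
    | h0 => simp
    | add x y hx hy => simp only [map_add, hx, hy]
    | tmul a b => rw [tensorMap_tmul, counitRight_tmul, counitRight_tmul, hεf, map_smul]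
  have hl : ∀ y, counitLeft S.gr S.gr ε (S.comul y) = y := hε.left
  have hr : ∀ y, counitRight S.gr S.gr ε (S.comul y) = y := hε.right
  have hlA : ∀ y, counitLeft 𝒜 𝒜 εA (ψ y) = y := hεA.left
  have hrA : ∀ y, counitRight 𝒜 𝒜 εA (ψ y) = y := hεA.right
  have hLd : ∀ q, ∀ y ∈ S.res (q + 1), L ((S.diff + h) y) -
      tensorDiff S.gr S.gr (S.diff + h) (S.diff + h) (L y) ∈
        fil (tensorDeg S.gr S.gr S.res S.res) q := by
    intro q y hy
    have h0 : h y ∈ fil S.res q := hm.h_fil (q + 1) y hy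
    have h1 : S.comul (h y) ∈ fil (tensorDeg S.gr S.gr S.res S.res) q :=
      map_fil (f := S.comul) (fun k hk z hz => le_fil hk (S.comul_res k z hz)) h0
    have h2 := hm.th_fil (q + 1) _ (S.comul_res _ y hy)
    have e : L ((S.diff + h) y) -
        tensorDiff S.gr S.gr (S.diff + h) (S.diff + h) (L y) =
        S.comul (h y) - tensorDiff S.gr S.gr h h (S.comul y) := by
      rw [hL, hL, tensorDiff_add, LinearMap.add_apply, LinearMap.add_apply, map_add,
        S.isHah.comul.comm_apply, add_sub_add_left_eq_sub]
    rw [e]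
    exact Submodule.sub_mem _ h1 h2
  have hLd0 : ∀ y ∈ S.res 0,
      tensorDiff S.gr S.gr (S.diff + h) (S.diff + h) (L y) = 0 := by
    intro y hy
    rw [tensorDiff_add, hL]
    exact S.isResolution_tensor.diff_zero_of_perturbation hm.th_fil (S.comul_res 0 y hy)
  have hπQ : ∀ q, ∀ e ∈ tensorDeg S.gr S.gr S.res S.res q,
      tensorMap (augProj ε) (augProj ε) e ∈ tensorDeg S.gr S.gr S.res S.res q := by
    have hp : ∀ q, ∀ y ∈ S.res q, augProj ε y ∈ S.res q := by
      intro q y hy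
      rw [augProj_apply]
      rcases q with _ | q
      · exact Submodule.sub_mem _ hy (Submodule.smul_mem _ _ (SetLike.one_mem_graded S.res))
      · rwa [hε0 q y hy, zero_smul, sub_zero]
    intro q e he
    refine tensor_map_mem (f := tensorMap (augProj ε) (augProj ε))
      (fun k l hkl a ha b hb => ?_) he
    rw [← hkl]
    exact tmul_mem _ _ (hp k a ha) (hp l b hb)
  have hφπ : ∀ e : S.gr ᵍ⊗[R] S.gr,
      tensorMap (augProj εA) (augProj εA) (tensorMap f f e : 𝒜 ᵍ⊗[R] 𝒜) =
      (tensorMap f f (tensorMap (augProj ε) (augProj ε) e : S.gr ᵍ⊗[R] S.gr) : 𝒜 ᵍ⊗[R] 𝒜) := by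
    have hp : ∀ y, augProj εA (f y) = f (augProj ε y) := fun y => by
      rw [augProj_apply, augProj_apply, hεf, map_sub, map_smul, hf.map_one]
    intro e
    induction e using tensor_induction with
    | h0 => simp
    | add x y hx hy => simp only [map_add, hx, hy]
    | tmul a b => simp only [tensorMap_tmul, hp]
  have hκL : ∀ y, counitPair hε.map_pos_degree (L ((S.diff + h) y)) =
      counitPair hε.map_pos_degree
        (tensorDiff S.gr S.gr (S.diff + h) (S.diff + h) (L y)) := by
    intro y
    rw [counitPair_apply, counitPair_apply, counitLeft_tensorDiff hε.map_pos_degree hεD,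
      counitRight_tensorDiff hεD, hL, hL, hl, hr, hl, hr]
  have hκN : ∀ y, counitPair hεA.map_pos_degree ((ψ ∘ₗ f) y) =
      counitPair hεA.map_pos_degree (tensorMap f f (L y) : 𝒜 ᵍ⊗[R] 𝒜) := by
    intro y
    rw [counitPair_apply, counitPair_apply, hfL, hfR, hL, hl, hr, LinearMap.comp_apply, hlA, hrA]
  obtain ⟨u, s, hu, hs, huL, huκ⟩ := hP.filtered_lift (hm.dga.tensor hm.dga) (hA.dga.tensor hA.dga)
    (hf.tensor hf) (IsWeakEquiv.tensor hf hf hw hw hm.dga hm.dga hA.dga hA.dga)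
    (hA.comul.comp hf) hres hm.diff_fil hm.isResFiltration_tensor
    (tmul_mem (i := 0) (j := 0) _ _ (SetLike.one_mem_graded S.res) (SetLike.one_mem_graded S.res))
    (tensorDeg_mul_mem S.proj_res_mem) (tensorDeg_proj_mem S.proj_res_mem) L
    (fun n y hy => by rw [hL]; exact S.isHah.comul.map_mem n y hy)
    (fun q y hy => by rw [hL]; exact S.comul_res q y hy) hLd hLd0
    (fun y hy => by rw [hL]; exact hfi.exists_tensorDiff_eq hA.dga hA.comul hi hy)
    (isKernelProjection_counitPair hm.dga hε.map_pos_degree hεD) hπQ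
    (isKernelProjection_counitPair hA.dga hεA.map_pos_degree hεA.map_diff) hφπ hκL hκN
  simp only [hL] at huL huκ
  refine ⟨u, s, hu, hs, huL, hε.map_pos_degree, hεD, fun y => ?_, fun y => ?_⟩
  · exact (congrArg Prod.fst (huκ y)).trans (hl y)
  · exact (congrArg Prod.snd (huκ y)).trans (hr y)

/-- Every Hopf algebra up to homotopy with homology `H` has a perturbed Hopf resolution of `H` as a
model. -/
theorem exists_model [Module.Flat R H] (S : HopfResolution.{u, v, w} ℋ ΔH)
    (hH : IsGradedHopf ℋ ΔH) (hA : IsHah 𝒜 dA ψ) (hi : IsHopfIso 𝒜 ℋ ΔH dA ψ i) :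
    ∃ (m : S.Perturbation) (f : S.carrier →ₗ[R] A),
      IsHahMap S.gr 𝒜 m.diff m.comul dA ψ f ∧ S.Represents f i := by
  obtain ⟨εH, hεH⟩ := hH.counit
  obtain ⟨εA, hεA⟩ := hA.counit
  obtain ⟨ε, hε⟩ := S.isHah.counit
  have hερ := S.counit_eq hε hεH
  obtain ⟨h, f, hm, hf, hfi, hεf⟩ := S.exists_diffPerturbation hA.dga hi hεA.map_pos_degree
    hερ fun y z hz => hi.counit_eq hεA hεH hz
  obtain ⟨u, s, hu, hs, huL, huc⟩ := exists_comul_lift hm hA hi hf hfi hε hεA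
    (fun q y hy => by rw [hερ, S.ρ_res (q + 1) (by omega) y hy, map_zero]) hεf
  obtain ⟨X, x, lev, deg, hres, hsf⟩ := S.exists_semiFree
  have hw := hm.isWeakEquiv_of_represents hf.comm_apply hfi
  have huf := DerivationHomotopic.of_homotopy (hA.comul.comp hf) ((hf.tensor hf).comp hu) hs
  have hhah := (hsf _ hm.dga hm.diff_fil).isHah_of_weakEquiv S.isHah.flat hA hf hw hu huf ⟨ε, huc⟩
  obtain ⟨ν, rfl⟩ : ∃ ν, u = S.comul + ν := ⟨u - S.comul, (add_sub_cancel _ _).symm⟩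
  have hν : ∀ q, ∀ y ∈ S.res q, ν y ∈ fil (tensorDeg S.gr S.gr S.res S.res) q := fun q y hy => by
    have := huL q y hy
    rwa [LinearMap.add_apply, add_sub_cancel_left] at this
  exact ⟨⟨h, ν, fun q y hy => by rw [iSup_add_two_le]; exact hm.h_fil q y hy, hν, hhah⟩, f,
    ⟨hf, huf⟩, hfi⟩

end HopfResolution

/-! ### Morphisms of Hopf algebras up to homotopy -/

/-- The algebra map to the zero ring. Its kernel is everything, so that a lift which is constrained
by it is not constrained at all. -/
def toPUnit (R : Type*) [CommRing R] (A : Type*) [Ring A] [Algebra R A] : A →ₐ[R] PUnit.{1} where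
  toFun _ := PUnit.unit
  map_one' := rfl
  map_mul' _ _ := rfl
  map_zero' := rfl
  map_add' _ _ := rfl
  commutes' _ := rfl

section HahMaps

variable {R : Type u} [CommRing R]
variable {A : Type*} {B : Type*} {C : Type*} [Ring A] [Ring B] [Ring C] [Algebra R A] [Algebra R B]
  [Algebra R C] {𝒜 : ℕ → Submodule R A} [GradedAlgebra 𝒜] {ℬ : ℕ → Submodule R B} [GradedAlgebra ℬ]
  {𝒞 : ℕ → Submodule R C} [GradedAlgebra 𝒞] {dA : A →ₗ[R] A} {dB : B →ₗ[R] B} {dC : C →ₗ[R] C}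
  {ψA : A →ₗ[R] (𝒜 ᵍ⊗[R] 𝒜)} {ψB : B →ₗ[R] (ℬ ᵍ⊗[R] ℬ)} {ψC : C →ₗ[R] (𝒞 ᵍ⊗[R] 𝒞)}

theorem IsHahMap.id (dA : A →ₗ[R] A) (ψA : A →ₗ[R] (𝒜 ᵍ⊗[R] 𝒜)) :
    IsHahMap 𝒜 𝒜 dA ψA dA ψA LinearMap.id where
  isDGAMap := .id dA
  comul := by
    rw [tensorMap_id, LinearMap.id_comp, LinearMap.comp_id]
    exact .refl _

theorem IsHahMap.comp {g : B →ₗ[R] C} (hg : IsHahMap ℬ 𝒞 dB ψB dC ψC g) {f : A →ₗ[R] B}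
    (hf : IsHahMap 𝒜 ℬ dA ψA dB ψB f) : IsHahMap 𝒜 𝒞 dA ψA dC ψC (g ∘ₗ f) where
  isDGAMap := hg.isDGAMap.comp hf.isDGAMap
  comul := by
    have h1 := hg.comul.precomp hf.isDGAMap
    have h2 := hf.comul.postcomp (hg.isDGAMap.tensor hg.isDGAMap)
    rw [LinearMap.comp_assoc] at h1
    rw [← LinearMap.comp_assoc ψA, tensorMap_comp] at h2
    exact h1.trans h2

theorem DerivationHomotopic.tensor_self {f g : A →ₗ[R] B} (hA : IsDGA 𝒜 dA)
    (hf : IsDGAMap 𝒜 dA ℬ dB f) (hg : IsDGAMap 𝒜 dA ℬ dB g)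
    (h : DerivationHomotopic 𝒜 dA ℬ dB f g) :
    DerivationHomotopic (tensorGr 𝒜 𝒜) (tensorDiff 𝒜 𝒜 dA dA) (tensorGr ℬ ℬ)
      (tensorDiff ℬ ℬ dB dB) (tensorMap f f) (tensorMap g g) :=
  (h.tensorRight hf).trans (h.tensorLeft hg hA)

theorem IsHahMap.of_homotopic (hA : IsHah 𝒜 dA ψA) (hB : IsHah ℬ dB ψB) {f g : A →ₗ[R] B}
    (hf : IsHahMap 𝒜 ℬ dA ψA dB ψB f) (hg : IsDGAMap 𝒜 dA ℬ dB g)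
    (h : DerivationHomotopic 𝒜 dA ℬ dB f g) : IsHahMap 𝒜 ℬ dA ψA dB ψB g :=
  ⟨hg, ((h.symm.postcomp hB.comul).trans hf.comul).trans
    ((h.tensor_self hA.dga hf.isDGAMap hg).precomp hA.comul)⟩

/-- A morphism of Hopf algebras up to homotopy with semifree source lifts through a weak
equivalence, up to homotopy. -/
theorem IsSemiFree.exists_hahMap_lift {X : Type*} {x : X → A} {lev deg : X → ℕ}
    (hP : IsSemiFree 𝒜 dA x lev deg) (hA : IsHah 𝒜 dA ψA) (hB : IsHah ℬ dB ψB)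
    (hC : IsHah 𝒞 dC ψC) {φ : B →ₗ[R] C} (hφ : IsHahMap ℬ 𝒞 dB ψB dC ψC φ)
    (hw : IsWeakEquiv dB dC φ) {g : A →ₗ[R] C} (hg : IsHahMap 𝒜 𝒞 dA ψA dC ψC g) :
    ∃ u, IsHahMap 𝒜 ℬ dA ψA dB ψB u ∧ DerivationHomotopic 𝒜 dA 𝒞 dC g (φ ∘ₗ u) := by
  obtain ⟨u, hu, hgu⟩ := hP.lift_of_weakEquiv hB.dga hC.dga hφ.isDGAMap hw hg.isDGAMap
  refine ⟨u, ⟨hu, ?_⟩, hgu⟩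
  have hflatB := hB.flat
  have hflatC := hC.flat
  have hφu := hφ.isDGAMap.comp hu
  refine hP.homotopic_of_weakEquiv (hB.dga.tensor hB.dga) (hC.dga.tensor hC.dga)
    (hφ.isDGAMap.tensor hφ.isDGAMap)
    (IsWeakEquiv.tensor hφ.isDGAMap hφ.isDGAMap hw hw hB.dga hB.dga hC.dga hC.dga)
    (hB.comul.comp hu) ((hu.tensor hu).comp hA.comul) ?_
  have h1 := hφ.comul.symm.precomp hu
  have h2 := (IsHahMap.of_homotopic hA hC hg hφu hgu).comul
  rw [LinearMap.comp_assoc] at h1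
  rw [← LinearMap.comp_assoc ψA, tensorMap_comp]
  exact h1.trans h2

end HahMaps

namespace HopfResolution

variable {R : Type u} [CommRing R] {H : Type w} [Ring H] [Algebra R H]
  {ℋ : ℕ → Submodule R H} [GradedAlgebra ℋ] {ΔH : H →ₗ[R] (ℋ ᵍ⊗[R] ℋ)}
  {S : HopfResolution.{u, v, w} ℋ ΔH} {m m' m'' : S.Perturbation}

theorem Perturbation.exists_semiFree (m : S.Perturbation) :
    ∃ (X : Type v) (x : X → S.carrier) (lev deg : X → ℕ), (∀ j, x j ∈ S.res (lev j)) ∧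
      IsSemiFree S.gr m.diff x lev deg := by
  obtain ⟨X, x, lev, deg, hres, h⟩ := S.exists_semiFree
  exact ⟨X, x, lev, deg, hres, h _ m.isHah.dga m.isDiff.diff_fil⟩

/-! ### The transformation relation -/

theorem IsTransform.refl (m : S.Perturbation) : IsTransform 1 m m :=
  ⟨LinearMap.id, .id _ _, fun x hx => ⟨x, hx, rfl, by
    rw [LinearMap.id_apply, sub_self]; exact Submodule.zero_mem _⟩⟩

theorem IsTransform.trans {α β : H ≃ₐ[R] H} (h : IsTransform α m m') (h' : IsTransform β m' m'') :
    IsTransform (β * α) m m'' := by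
  obtain ⟨k, hk, hkα⟩ := h
  obtain ⟨k', hk', hkβ⟩ := h'
  refine ⟨k' ∘ₗ k, hk'.comp hk, fun x hx => ?_⟩
  obtain ⟨y, hy, h1, w, hw⟩ := hkα x hx
  obtain ⟨y', hy', h1', w', hw'⟩ := hkβ y hy
  refine ⟨y', hy', by rw [h1', h1]; rfl, k' w + w', ?_⟩
  rw [map_add, ← hk'.isDGAMap.comm_apply, hw, hw', map_sub, sub_add_sub_cancel]
  rfl

theorem IsTransform.isWeakEquiv {α : H ≃ₐ[R] H} {k : S.carrier →ₗ[R] S.carrier}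
    (hk : IsHahMap S.gr S.gr m.diff m.comul m'.diff m'.comul k) (hα : Induces m' α k) :
    IsWeakEquiv m.diff m'.diff k := by
  obtain ⟨i, hi⟩ := m'.isDiff.exists_represents_id
  exact m.isDiff.isWeakEquiv_of_represents hk.isDGAMap.comm_apply (hα.exists_represents hi)

theorem IsTransform.symm {α : H ≃ₐ[R] H} (h : IsTransform α m m') : IsTransform α⁻¹ m' m := by
  obtain ⟨k, hk, hα⟩ := h
  obtain ⟨X, x, lev, deg, -, hP⟩ := m'.exists_semiFree
  obtain ⟨u, hu, hku⟩ := hP.exists_hahMap_lift m'.isHah m.isHah m'.isHah hk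
    (IsTransform.isWeakEquiv hk hα) (.id _ _)
  refine ⟨u, hu, fun x hx => ?_⟩
  obtain ⟨y, hy, w, hw⟩ := m.isDiff.exists_homologous (z := u x)
    (by rw [← hu.isDGAMap.comm_apply, m'.isDiff.diff_of_mem hx, map_zero])
  obtain ⟨y', hy', h1, w', hw'⟩ := hα y hy
  obtain ⟨w'', hw''⟩ := hku.homologous x (m'.isDiff.diff_of_mem hx)
  have h2 : S.ρ x = S.ρ y' := m'.isDiff.ρ_eq (w := w'' + k w + w') hx hy' (by
    rw [map_add, map_add, ← hk.isDGAMap.comm_apply, hw, hw', hw'', map_sub]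
    simp only [LinearMap.comp_apply, LinearMap.id_apply]
    abel)
  refine ⟨y, hy, ?_, w, hw⟩
  rw [h2, h1]
  exact (α.symm_apply_apply _).symm

theorem isDGAMap_of_equiv {p : S.carrier ≃ₐ[R] S.carrier}
    (hp : ∀ n x, p x ∈ S.gr n ↔ x ∈ S.gr n) {d d' : S.carrier →ₗ[R] S.carrier}
    (hd : ∀ x, p (d x) = d' (p x)) :
    IsDGAMap S.gr d S.gr d' p.toLinearMap ∧ IsDGAMap S.gr d' S.gr d p⁻¹.toLinearMap := by
  refine ⟨⟨map_one p, map_mul p, fun n x hx => (hp n x).2 hx, LinearMap.ext hd⟩,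
    ⟨map_one p⁻¹, map_mul p⁻¹, fun n x hx => (S.inv_gr hp n x).2 hx, LinearMap.ext fun x => ?_⟩⟩
  apply p.injective
  change p (p.symm (d' x)) = p (d (p.symm x))
  rw [hd, p.apply_symm_apply, p.apply_symm_apply]

theorem GRel.isTransform (h : S.GRel m m') : IsTransform 1 m' m := by
  obtain ⟨g, h1, -, h3⟩ := h
  obtain ⟨hp, hp'⟩ := isDGAMap_of_equiv g.p_gr (d := m'.diff) (d' := m.diff) fun x => by
    change g.p ((S.diff + m'.h) x) = _
    rw [h1]
    exact g.p.apply_symm_apply _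
  refine ⟨g.p.toLinearMap, ⟨hp, ?_⟩, fun x hx => ⟨x, hx, rfl, ?_⟩⟩
  · have ht : IsDGAMap S.gr m'.diff (tensorGr S.gr S.gr) m'.tdiff (S.transportComul m.comul g) :=
      (hp'.tensor hp').comp (m.isHah.comul.comp hp)
    have h4 := (DerivationHomotopic.of_homotopy m'.isHah.comul ht h3).symm.postcomp (hp.tensor hp)
    have e : tensorMap g.p.toLinearMap g.p.toLinearMap ∘ₗ S.transportComul m.comul g =
        m.comul ∘ₗ g.p.toLinearMap := by
      change S.sq g.p ∘ₗ S.sq g.p⁻¹ ∘ₗ m.comul ∘ₗ g.p.toLinearMap = _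
      rw [← LinearMap.comp_assoc, ← sq_mul, mul_inv_cancel, sq_one, LinearMap.id_comp]
    rw [e] at h4
    exact h4
  · have := g.p_res 0 x hx
    change _ ∈ fil S.res 0 at this
    rw [fil_zero, Submodule.mem_bot] at this
    change g.p x - x ∈ _
    rw [this]
    exact Submodule.zero_mem _

theorem bijective_of_sub_mem_fil {u : S.carrier →ₗ[R] S.carrier}
    (hu : ∀ q, ∀ y ∈ S.res q, u y - y ∈ fil S.res q) : Function.Bijective u := by
  have hu' : ∀ q, ∀ y ∈ fil S.res (q + 1), u y - y ∈ fil S.res q := fun q y hy =>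
    map_fil (f := u - LinearMap.id)
      (fun k hk z hz => fil_mono (Nat.lt_succ_iff.1 hk) (hu k z hz)) hy
  constructor
  · rw [← LinearMap.ker_eq_bot, LinearMap.ker_eq_bot']
    intro y hy
    obtain ⟨q, hq⟩ := S.isResolution.grading.exhaust y
    induction q with
    | zero => rwa [fil_zero, Submodule.mem_bot] at hq
    | succ q ih =>
      have := hu' q y hq
      rw [hy, zero_sub] at this
      exact ih (neg_neg y ▸ Submodule.neg_mem _ this)
  · intro y
    obtain ⟨q, hq⟩ := S.isResolution.grading.exhaust y
    induction q generalizing y with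
    | zero =>
      rw [fil_zero, Submodule.mem_bot] at hq
      exact ⟨0, by rw [hq, map_zero]⟩
    | succ q ih =>
      obtain ⟨z, hz⟩ := ih _ (hu' q y hq)
      exact ⟨y - z, by rw [map_sub, hz, sub_sub_cancel]⟩

/-- A morphism that induces the identity in homology is homotopic to one whose leading term is the
identity, so it comes from an element of `G_H`. -/
theorem IsTransform.gRel (h : IsTransform 1 m m') : S.GRel m' m := by
  obtain ⟨k, hk, hk1⟩ := h
  obtain ⟨X, x, lev, deg, hres, hP⟩ := m.exists_semiFree
  have hE := m'.isHah.dga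
  -- the lift has leading term the identity and is not constrained any further
  obtain ⟨u, s, hu, hs, hu1, -⟩ := hP.filtered_lift (φ := LinearMap.id) hE hE (.id _) (.id _)
    hk.isDGAMap hres m.isDiff.diff_fil m'.isDiff.isResFiltration (SetLike.one_mem_graded S.res)
    (fun i j a ha b hb => SetLike.GradedMul.mul_mem ha hb) (fun q n e he => S.proj_res_mem q n e he)
    (AlgHom.id R _) (fun _ _ hy => hy) (fun _ _ hy => hy)
    (by
      intro q y hy
      simp only [AlgHom.id_apply, LinearMap.add_apply, add_sub_add_left_eq_sub]
      exact Submodule.sub_mem _ (m.h_fil (q + 1) y hy) (m'.h_fil (q + 1) y hy))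
    (fun y hy => m'.isDiff.diff_of_mem hy)
    (by
      intro y hy
      obtain ⟨y', hy', h1, w, hw⟩ := hk1 y hy
      obtain ⟨w', hw'⟩ := m'.isDiff.exists_diff_eq_sub hy' hy h1
      exact ⟨w + w', by rw [map_add, hw, hw', sub_add_sub_cancel]; rfl⟩)
    (κ := (toPUnit R S.carrier)) (π := LinearMap.id)
    ⟨fun _ => rfl, fun _ _ => rfl, fun _ => rfl, fun _ _ h => h⟩ (fun _ _ h => h)
    (κN := (toPUnit R S.carrier)) (πN := LinearMap.id)
    ⟨fun _ => rfl, fun _ _ => rfl, fun _ => rfl, fun _ _ h => h⟩ (fun _ => rfl) (fun _ => rfl)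
    (fun _ => rfl)
  let p : S.carrier ≃ₐ[R] S.carrier := AlgEquiv.ofBijective hu.toAlgHom
    (bijective_of_sub_mem_fil hu1)
  have hp : ∀ n y, p y ∈ S.gr n ↔ y ∈ S.gr n := fun n y => by
    refine ⟨fun hy => ?_, hu.map_mem n y⟩
    have e := proj_map_of_degree_zero (𝒜 := S.gr) (ℬ := S.gr) (f := p.toLinearMap) hu.map_mem n y
    rw [AlgEquiv.toLinearMap_apply, proj_of_mem S.gr hy] at e
    rw [p.injective e]
    exact proj_mem _ _ _
  obtain ⟨hp1, hp2⟩ := isDGAMap_of_equiv hp (d := m.diff) (d' := m'.diff) hu.comm_apply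
  have hku : DerivationHomotopic S.gr m.diff S.gr m'.diff k p.toLinearMap :=
    .of_homotopy hk.isDGAMap hp1 hs
  have hpm := (hk.of_homotopic m.isHah m'.isHah hp1 hku).comul.postcomp (hp2.tensor hp2)
  have e : (tensorMap p⁻¹.toLinearMap p⁻¹.toLinearMap : (S.gr ᵍ⊗[R] S.gr) →ₗ[R] _) ∘ₗ
      tensorMap p.toLinearMap p.toLinearMap ∘ₗ m.comul = m.comul := by
    change S.sq p⁻¹ ∘ₗ S.sq p ∘ₗ m.comul = _
    rw [← LinearMap.comp_assoc, ← sq_mul, inv_mul_cancel, sq_one, LinearMap.id_comp]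
  rw [e] at hpm
  obtain ⟨r, hr⟩ := hP.exists_homotopy (m.isHah.dga.tensor m.isHah.dga) hpm.symm
  refine ⟨⟨p, r, hp, hu1, hr.map_mem⟩, ?_, ?_, ?_⟩
  · refine LinearMap.ext fun y => ?_
    change m.diff y = p.symm (m'.diff (p y))
    rw [AlgEquiv.eq_symm_apply]
    exact hu.comm_apply y
  · have e := hr.homotopy
    have e1 : S.actDiff m'.diff ⟨p, r, hp, hu1, hr.map_mem⟩ = m.diff := by
      refine LinearMap.ext fun y => ?_
      change p.symm (m'.diff (p y)) = m.diff y
      rw [AlgEquiv.symm_apply_eq]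
      exact (hu.comm_apply y).symm
    change m.comul = _
    rw [actComul, show S.diff + m'.h = m'.diff from rfl, e1, add_assoc]
    change m.comul = _ + (r ∘ₗ m.diff + _ ∘ₗ r)
    erw [e]
    exact (add_sub_cancel _ _).symm
  · exact hr

end HopfResolution

section WeakMaps

variable {R : Type u} [CommRing R] {A B C : Hah.{u, v} R}

theorem Hah.IsWeakMap.comp {f : A.carrier →ₗ[R] B.carrier} {g : B.carrier →ₗ[R] C.carrier}
    (hg : Hah.IsWeakMap B C g) (hf : Hah.IsWeakMap A B f) : Hah.IsWeakMap A C (g ∘ₗ f) :=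
  ⟨hg.1.comp hf.1, hg.2.comp hf.2⟩

theorem Hah.IsWeakMap.id (A : Hah.{u, v} R) : Hah.IsWeakMap A A LinearMap.id :=
  ⟨.id _ _, .id _⟩

end WeakMaps

namespace HopfResolution

variable {R : Type u} [CommRing R] {H : Type w} [Ring H] [Algebra R H]
  {ℋ : ℕ → Submodule R H} [GradedAlgebra ℋ] {ΔH : H →ₗ[R] (ℋ ᵍ⊗[R] ℋ)}
  {S : HopfResolution.{u, v, w} ℋ ΔH} {m m' : S.Perturbation}

/-! ### The action of the automorphism group -/

theorem mk_eq_mk_iff : D.mk S m = D.mk S m' ↔ IsTransform 1 m m' := by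
  refine ⟨fun h => ?_, fun h => (Quot.sound (IsTransform.gRel h)).symm⟩
  have hs : ∀ {m m' : S.Perturbation}, IsTransform 1 m m' → IsTransform 1 m' m := fun h =>
    inv_one (G := H ≃ₐ[R] H) ▸ h.symm
  replace h := Quot.eqvGen_exact h
  induction h with
  | rel m m' h => exact hs (GRel.isTransform h)
  | refl m => exact .refl m
  | symm m m' _ ih => exact hs ih
  | trans m m' m'' _ _ ih ih' => exact mul_one (1 : H ≃ₐ[R] H) ▸ ih.trans ih'

theorem IsTransform.mk_eq_mk {α : H ≃ₐ[R] H} {m₁ m₂ m₁' m₂' : S.Perturbation}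
    (h₁ : IsTransform α m₁ m₁') (h₂ : IsTransform α m₂ m₂') (h : D.mk S m₁ = D.mk S m₂) :
    D.mk S m₁' = D.mk S m₂' := by
  have := (h₁.symm.trans (mk_eq_mk_iff.1 h)).trans h₂
  rw [one_mul, mul_inv_cancel] at this
  exact mk_eq_mk_iff.2 this

/-- The transform is a model of `(RH, d_h, Δ_ν)` for the identification of its homology with `H`
that is twisted by `α⁻¹`. -/
theorem exists_isTransform [Module.Flat R H] (hH : IsGradedHopf ℋ ΔH) {α : H ≃ₐ[R] H}
    (hα : α ∈ hopfAut ℋ ΔH) (m : S.Perturbation) : ∃ m', IsTransform α m m' := by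
  obtain ⟨i, hi⟩ := m.isDiff.exists_represents_id
  obtain ⟨m', f, hf, hfi⟩ := S.exists_model hH m.isHah
    ((m.isHopfIso hi).precomp_aut (inv_mem hα))
  have h : IsTransform α⁻¹ m' m := ⟨f, hf, Induces.of_represents hi hfi⟩
  exact ⟨m', inv_inv α ▸ h.symm⟩

/-- The transform of a class in `D_H` under an automorphism of `H`. -/
def transform [Module.Flat R H] (hH : IsGradedHopf ℋ ΔH) (α : hopfAut ℋ ΔH) : S.D → S.D :=
  Quot.lift (fun m => D.mk S (exists_isTransform hH α.2 m).choose) fun m m' h =>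
    IsTransform.mk_eq_mk (exists_isTransform hH α.2 m).choose_spec
      (exists_isTransform hH α.2 m').choose_spec (Quot.sound h)

theorem transform_mk_eq_iff [Module.Flat R H] (hH : IsGradedHopf ℋ ΔH) (α : hopfAut ℋ ΔH) :
    transform hH α (D.mk S m) = D.mk S m' ↔ IsTransform (α : H ≃ₐ[R] H) m m' := by
  have h := (exists_isTransform hH α.2 m).choose_spec
  refine ⟨fun e => ?_, fun h' => IsTransform.mk_eq_mk h h' rfl⟩
  exact one_mul (α : H ≃ₐ[R] H) ▸ h.trans (mk_eq_mk_iff.1 e)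

/-- The action of `Aut H` on `D_H`. -/
abbrev transformAction [Module.Flat R H] (hH : IsGradedHopf ℋ ΔH)
    (S : HopfResolution.{u, v, w} ℋ ΔH) :
    MulAction (hopfAut ℋ ΔH) S.D where
  smul := transform hH
  one_smul := by
    rintro ⟨m⟩
    exact (transform_mk_eq_iff hH 1).2 (.refl m)
  mul_smul := by
    rintro α β ⟨m⟩
    obtain ⟨m', h⟩ := exists_isTransform hH β.2 m
    obtain ⟨m'', h'⟩ := exists_isTransform hH α.2 m'
    refine ((transform_mk_eq_iff hH (α * β)).2 (h.trans h')).trans ?_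
    rw [← (transform_mk_eq_iff hH α).2 h', ← (transform_mk_eq_iff hH β).2 h]
    rfl

/-! ### The classification of weak homotopy types -/

/-- Having `(RH, d_h, Δ_ν)` as the source of a weak equivalence is invariant under weak equivalence,
since maps out of a semifree algebra lift through weak equivalences. -/
theorem exists_isWeakMap_of_weakEquivalent {A B : Hah.{u, v} R} (h : Hah.WeakEquivalent A B)
    (hA : ∃ f, Hah.IsWeakMap m.toHah A f) : ∃ f, Hah.IsWeakMap m.toHah B f := by
  obtain ⟨C, f, g, hf, hg⟩ := h
  obtain ⟨a, ha⟩ := hA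
  obtain ⟨X, x, lev, deg, -, hP⟩ := m.exists_semiFree
  obtain ⟨b, hb, hab⟩ := hP.exists_hahMap_lift m.isHah C.isHah A.isHah hf.1 hf.2 ha.1
  have hfb : IsWeakEquiv m.diff A.diff (f ∘ₗ b) :=
    ha.2.of_homotopy (hf.1.comp hb).isDGAMap.comm_apply hab.homologous
  have hb' : Hah.IsWeakMap m.toHah C b := ⟨hb, hf.2.of_comp hb.isDGAMap.comm_apply hfb⟩
  exact ⟨_, hg.comp hb'⟩

theorem IsTransform.weakEquivalent {α : H ≃ₐ[R] H} (h : IsTransform α m m') :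
    Hah.WeakEquivalent m.toHah m'.toHah := by
  obtain ⟨k, hk, hα⟩ := h
  exact ⟨m.toHah, LinearMap.id, k, .id _, hk, IsTransform.isWeakEquiv hk hα⟩

theorem exists_isWeakMap_iff {A B : {A : Hah.{u, v} R // A.HasHomology ℋ ΔH}}
    (h : WeakTypes.mk ℋ ΔH A.1 A.2 = WeakTypes.mk ℋ ΔH B.1 B.2) :
    (∃ f, Hah.IsWeakMap m.toHah A.1 f) ↔ ∃ f, Hah.IsWeakMap m.toHah B.1 f := by
  replace h : Relation.EqvGen _ A B := Quot.eqvGen_exact h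
  induction h with
  | rel A B h =>
    obtain ⟨C, f, g, hf, hg⟩ := id h
    exact ⟨exists_isWeakMap_of_weakEquivalent h,
      exists_isWeakMap_of_weakEquivalent ⟨C, g, f, hg, hf⟩⟩
  | refl A => exact Iff.rfl
  | symm A B _ ih => exact ih.symm
  | trans A B C _ _ ih ih' => exact ih.trans ih'

theorem weakTypes_eq_iff [Module.Flat R H] :
    WeakTypes.mk ℋ ΔH m.toHah m.hasHomology = WeakTypes.mk ℋ ΔH m'.toHah m'.hasHomology ↔
      ∃ α ∈ hopfAut ℋ ΔH, IsTransform α m m' := by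
  refine ⟨fun h => ?_, fun ⟨α, _, h⟩ => Quot.sound h.weakEquivalent⟩
  obtain ⟨k, hk, hw⟩ := (exists_isWeakMap_iff (m := m)
    (A := ⟨_, m.hasHomology⟩) (B := ⟨_, m'.hasHomology⟩) h).1 ⟨_, .id _⟩
  obtain ⟨α, hα, h⟩ := exists_induces hk hw
  exact ⟨α, hα, k, hk, h⟩

theorem exists_weakTypes_eq [Module.Flat R H] (hH : IsGradedHopf ℋ ΔH)
    (S : HopfResolution.{u, v, w} ℋ ΔH) (A : Hah.{u, v} R) (hA : A.HasHomology ℋ ΔH) :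
    ∃ m : S.Perturbation, WeakTypes.mk ℋ ΔH m.toHah m.hasHomology = WeakTypes.mk ℋ ΔH A hA := by
  obtain ⟨i, hi⟩ := hA
  obtain ⟨m, f, hf, hfi⟩ := S.exists_model hH A.isHah hi
  exact ⟨m, Quot.sound ⟨m.toHah, LinearMap.id, f, .id _, hf,
    m.isDiff.isWeakEquiv_of_represents hf.isDGAMap.comm_apply hfi⟩⟩

end HopfResolution

end HopfPert

end

theorem theorem5p2 {R : Type u} [CommRing R] {H : Type w} [Ring H] [Algebra R H]
    (ℋ : ℕ → Submodule R H) [GradedAlgebra ℋ] [Module.Flat R H]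
    (ΔH : H →ₗ[R] (ℋ ᵍ⊗[R] ℋ)) (hH : HopfPert.IsGradedHopf ℋ ΔH)
    (S : HopfPert.HopfResolution.{u, v, w} ℋ ΔH) :
    ∃ act : MulAction (HopfPert.hopfAut ℋ ΔH) S.D,
      (∀ (α : HopfPert.hopfAut ℋ ΔH) (m m' : S.Perturbation),
        α • HopfPert.HopfResolution.D.mk S m = HopfPert.HopfResolution.D.mk S m' ↔
          HopfPert.HopfResolution.IsTransform (α : H ≃ₐ[R] H) m m') ∧
      ∃ Φ : MulAction.orbitRel.Quotient (HopfPert.hopfAut ℋ ΔH) S.D ≃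
          HopfPert.WeakTypes.{u, v, w} ℋ ΔH,
        ∀ m : S.Perturbation, ∃ hm : m.toHah.HasHomology ℋ ΔH,
          Φ (Quotient.mk _ (HopfPert.HopfResolution.D.mk S m)) =
            HopfPert.WeakTypes.mk ℋ ΔH m.toHah hm := by
  let act := HopfPert.HopfResolution.transformAction hH S
  refine ⟨act, fun α m m' => HopfPert.HopfResolution.transform_mk_eq_iff hH α, ?_⟩
  -- transforms are the elements of an orbit
  have hact : ∀ m m' : S.Perturbation,
      (∃ α ∈ HopfPert.hopfAut ℋ ΔH, HopfPert.HopfResolution.IsTransform α m m') ↔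
      MulAction.orbitRel (HopfPert.hopfAut ℋ ΔH) S.D (HopfPert.HopfResolution.D.mk S m')
        (HopfPert.HopfResolution.D.mk S m) := fun m m' =>
    ⟨fun ⟨α, hα, h⟩ => ⟨⟨α, hα⟩, (HopfPert.HopfResolution.transform_mk_eq_iff hH _).2 h⟩,
      fun ⟨α, h⟩ => ⟨α, α.2, (HopfPert.HopfResolution.transform_mk_eq_iff hH α).1 h⟩⟩
  let φ : S.D → HopfPert.WeakTypes.{u, v, w} ℋ ΔH :=
    Quot.lift (fun m => HopfPert.WeakTypes.mk ℋ ΔH m.toHah m.hasHomology) fun m m' h =>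
      HopfPert.HopfResolution.weakTypes_eq_iff.2
        ⟨1, one_mem _, HopfPert.HopfResolution.mk_eq_mk_iff.1 (Quot.sound h)⟩
  have hφ : ∀ x y : S.D, φ x = φ y ↔ MulAction.orbitRel (HopfPert.hopfAut ℋ ΔH) S.D x y := by
    rintro ⟨m⟩ ⟨m'⟩
    exact (eq_comm.trans HopfPert.HopfResolution.weakTypes_eq_iff).trans (hact m' m)
  refine ⟨Equiv.ofBijective (Quotient.lift φ fun x y => (hφ x y).2) ⟨?_, ?_⟩,
    fun m => ⟨m.hasHomology, rfl⟩⟩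
  · rintro ⟨x⟩ ⟨y⟩ h
    exact Quotient.sound ((hφ x y).1 h)
  · rintro ⟨A, hA⟩
    obtain ⟨m, hm⟩ := HopfPert.HopfResolution.exists_weakTypes_eq hH S A hA
    exact ⟨Quotient.mk _ (HopfPert.HopfResolution.D.mk S m), hm⟩
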